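/- Let $\Sigma$ be a finite alphabet with a total order $\preceq$. A \emph{Wheeler NFA} $(\mathcal A,\le)$ consists of an NFA $\mathcal A=(Q,E,s,F)$ with $Q$ finite, $E\subseteq Q\times Q\times\Sigma$, $s\in Q$, $F\subseteq Q$, in which every state is reachable from $s$ and can reach a final state, and of a total order $\le$ on $Q$ such that (1) $s\le u$ for every $u\in Q$; (2) if $(u,v,a),(u',v',b)\in E$ and $v<v'$, then $a\preceq b$; (3) if $(u,v,a),(u',v',a)\in E$ and $v<v'$, then $u\le u'$. A \emph{bisimulation} on $\mathcal A$ is a relation $R\subseteq Q\times Q$ such that $s\,R\,s$; $u\,R\,u'$ implies ($u\in F\Leftrightarrow u'\in F$); if $u\,R\,u'$ and $(u,v,a)\in E$, then there is $v'$ with $v\,R\,v'$ and $(u',v',a)\in E$; and if $u\,R\,u'$ and $(u',v',a)\in E$, then there is $v$ with $v\,R\,v'$ and $(u,v,a)\in E$. A \emph{Wheeler autobisimulation} on $(\mathcal A,\le)$ is a reflexive bisimulation $R$ on $\mathcal A$ such that $R(C)$ and $R^{-1}(C)$ are $\le$-convex for every $\le$-convex $C\subseteq Q$. Let $\equiv_{\mathcal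 A,\le}$ be the union of all Wheeler autobisimulations on $(\mathcal A,\le)$, and write $[u]=\{v\in Q: u\equiv_{\mathcal A,\le}v\}$. The \emph{quotient} $(\mathcal A_*,\le_*)$, with $\mathcal A_*=(Q_*,E_*,s_*,F_*)$, is defined by $Q_*=\{[u]: u\in Q\}$, $E_*=\{(U',U,a): (\exists u'\in U')(\exists u\in U)\ (u',u,a)\in E\}$, $s_*=[s]$, $F_*=\{U\in Q_*: U\cap F\neq\emptyset\}$, and $U\le_* V$ if and only if $u\le v$ for some $u\in U$, $v\in V$. \textbf{Theorem.} For every Wheeler NFA $(\mathcal A,\le)$, $\equiv_{\mathcal A,\le}$ is the maximum Wheeler autobisimulation on $(\mathcal A,\le)$ and a $\le$-convex equivalence relation, and $(\mathcal A_*,\le_*)$ is a Wheeler NFA. If edge labels can be sorted in linear time, then $(\mathcal A_*,\le_*)$ can be built from $(\mathcal A,\le)$ in $O(|E|)$ time. Precisely, the machine is a word RAM with finitely many registers and arrays, which evaluates each operation (addition, truncated subtraction, multiplication, integer division, remainder, comparison), memory access, assignment and test in one step, and whose words are at most a bound $W$. States are represented by their positions $0,\dots,|Q|-1$ in the order $\le$,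 and labels by codes, that is, by an arbitrary injective map $\Sigma\to\mathbb N$. An ordered automaton is represented by its number of states, its number of edges, its initial state, a list of its edges (source, target, label) without repetitions in any order, and the bit array of its final states; the rest of the memory is zero at the beginning. Then for every program $S$ there is a program $P$ such that for every $c$ there is a constant $C$ with the following property. For every finite totally ordered alphabet $\Sigma$, every Wheeler NFA $(\mathcal A,\le)$ over $\Sigma$, every representation of it as above, and every $W$: if $S$, with words at most $W$, given the list of the labels of the edges, replaces it by the sorted list in at most $c(|E|+1)$ steps, then $P$, started on the representation of $(\mathcal A,\le)$ and with words at most $C(W+1)$, halts after at most $C(|E|+1)$ steps with a representation of $(\mathcal A_*,\le_*)$ in memory, together with an array that maps every $u\in Q$ to the state $[u]$ of the quotient, and a bit array $B$ that marks the boundaries between the classes: if $u_1<u_2<\dots<u_{|Q|}$ are the states, then for every $2\le i\le|Q|$ the entry of $B$ at $u_i$ is $1$ if $u_{i-1}\not\equiv_{\mathcal A,\le}u_i$, and $0$ otherwise. -/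

import Mathlib

universe u v w

namespace WheelerMin

/-! ### Automata and Wheeler automata -/

/-- A nondeterministic automaton with states `Q`, alphabet `α`, a set `E` of labelled edges
`(u, v, a)` from `u` to `v`, one initial state `s` and a set `F` of final states. -/
structure Automaton (Q : Type u) (α : Type v) where
  E : Set (Q × Q × α)
  s : Q
  F : Set Q

section Automata

variable {Q : Type u} {Q' : Type w} {α : Type v}

/-- There is an edge from `x` to `y`, with some label. -/
def Automaton.Step (A : Automaton Q α) (x y : Q) : Prop := ∃ a, (x, y, a) ∈ A.E

/-- There is a walk (possibly of length zero) from `x` to `y`. -/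
def Automaton.Walk (A : Automaton Q α) : Q → Q → Prop := Relation.ReflTransGen A.Step

structure IsTotalOrder (le : Q → Q → Prop) : Prop where
  refl : ∀ x, le x x
  antisymm : ∀ x y, le x y → le y x → x = y
  trans : ∀ x y z, le x y → le y z → le x z
  total : ∀ x y, le x y ∨ le y x

/-- `(A, le)` is a Wheeler NFA. All states are reachable and co-reachable. -/
structure IsWheelerNFA [LinearOrder α] (A : Automaton Q α) (le : Q → Q → Prop) : Prop where
  finite : Finite Q
  reachable : ∀ x, A.Walk A.s x
  coreachable : ∀ x, ∃ y ∈ A.F, A.Walk x y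
  order : IsTotalOrder le
  axiom1 : ∀ x, le A.s x
  axiom2 : ∀ x y x' y' a b, (x, y, a) ∈ A.E → (x', y', b) ∈ A.E → le y y' → y ≠ y' → a ≤ b
  axiom3 : ∀ x y x' y' a, (x, y, a) ∈ A.E → (x', y', a) ∈ A.E → le y y' → y ≠ y' → le x x'

/-- `C` is convex with respect to `le`. -/
def IsConvex (le : Q → Q → Prop) (C : Set Q) : Prop :=
  ∀ x y z, le x y → le y z → x ∈ C → z ∈ C → y ∈ C

/-! ### Bisimulations and Wheeler bisimulations -/

structure IsBisimulation (A : Automaton Q α) (A' : Automaton Q' α) (R : Q → Q' → Prop) :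
    Prop where
  forth : ∀ x y x' a, R x x' → (x, y, a) ∈ A.E → ∃ y', R y y' ∧ (x', y', a) ∈ A'.E
  back : ∀ x x' y' a, R x x' → (x', y', a) ∈ A'.E → ∃ y, R y y' ∧ (x, y, a) ∈ A.E
  start : R A.s A'.s
  final : ∀ x x', R x x' → (x ∈ A.F ↔ x' ∈ A'.F)

structure IsWheelerBisimulation (A : Automaton Q α) (le : Q → Q → Prop)
    (A' : Automaton Q' α) (le' : Q' → Q' → Prop) (R : Q → Q' → Prop) : Prop where
  bisimulation : IsBisimulation A A' R
  image_convex : ∀ C : Set Q, IsConvex le C → IsConvex le' {x' | ∃ x ∈ C, R x x'}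
  preimage_convex : ∀ C' : Set Q', IsConvex le' C' → IsConvex le {x | ∃ x' ∈ C', R x x'}

/-- A Wheeler autobisimulation is a reflexive Wheeler bisimulation from `(A, le)` to itself. -/
structure IsWheelerAutobisimulation (A : Automaton Q α) (le : Q → Q → Prop)
    (R : Q → Q → Prop) : Prop where
  refl : ∀ x, R x x
  wheeler : IsWheelerBisimulation A le A le R

/-- The union of all Wheeler autobisimulations on `(A, le)`. For a Wheeler NFA it is the maximum
Wheeler autobisimulation (which is part of what the theorem asserts). -/
def maxAutobisim (A : Automaton Q α) (le : Q → Q → Prop) : Q → Q → Prop :=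
  fun x y => ∃ R, IsWheelerAutobisimulation A le R ∧ R x y

/-! ### The quotient automaton -/

/-- The class `[x]` of a state. -/
def cls (A : Automaton Q α) (le : Q → Q → Prop) (x : Q) : Set Q := {y | maxAutobisim A le x y}

/-- The states of the quotient: the set of all classes. -/
def QuotState (A : Automaton Q α) (le : Q → Q → Prop) : Type u :=
  {U : Set Q // ∃ x, U = cls A le x}

/-- The class of `x`, as a state of the quotient. -/
def toQuot (A : Automaton Q α) (le : Q → Q → Prop) (x : Q) : QuotState A le :=
  ⟨cls A le x, x, rfl⟩

def quotAutomaton (A : Automaton Q α) (le : Q → Q → Prop) : Automaton (QuotState A le) α where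
  E := {e | ∃ x ∈ e.1.val, ∃ y ∈ e.2.1.val, (x, y, e.2.2) ∈ A.E}
  s := toQuot A le A.s
  F := {U | ∃ x ∈ U.val, x ∈ A.F}

def quotLe (A : Automaton Q α) (le : Q → Q → Prop) (U V : QuotState A le) : Prop :=
  ∃ x ∈ U.val, ∃ y ∈ V.val, le x y

end Automata

/-! ### The machine model

A word RAM. The memory consists of registers and of arrays, both numbered by natural numbers (a
program mentions only finitely many of them); each array cell can be read and written at a computed
address in one step. All words, addresses included, must stay at most a bound `W`; a computation
that exceeds it gets stuck. Every evaluated node of an expression, every assignment and every test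
costs one step. -/

structure State where
  reg : ℕ → ℕ
  mem : ℕ → ℕ → ℕ

/-- All words in the memory are at most `W`. -/
def State.Bounded (W : ℕ) (σ : State) : Prop :=
  (∀ r, σ.reg r ≤ W) ∧ ∀ a k, σ.mem a k ≤ W

inductive Op where
  | add | sub | mul | div | mod | lt | eq

/-- Subtraction is truncated, division is integer division (with quotient `0` for divisor `0`),
and the comparisons return `1` or `0`. -/
def Op.eval : Op → ℕ → ℕ → ℕ
  | .add, x, y => x + y
  | .sub, x, y => x - y
  | .mul, x, y => x * y
  | .div, x, y => x / y
  | .mod, x, y => x % y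
  | .lt, x, y => if x < y then 1 else 0
  | .eq, x, y => if x = y then 1 else 0

inductive Expr where
  | lit (k : ℕ)
  | reg (r : ℕ)
  | read (a : ℕ) (i : Expr)
  | bin (o : Op) (e f : Expr)

def Expr.eval (σ : State) : Expr → ℕ
  | .lit k => k
  | .reg r => σ.reg r
  | .read a i => σ.mem a (i.eval σ)
  | .bin o e f => o.eval (e.eval σ) (f.eval σ)

/-- The number of steps taken to evaluate an expression. -/
def Expr.cost : Expr → ℕ
  | .lit _ => 1
  | .reg _ => 1
  | .read _ i => i.cost + 1
  | .bin _ e f => e.cost + f.cost + 1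

/-- All values that occur in the evaluation of the expression are at most `W`. -/
def Expr.Fits (W : ℕ) (σ : State) : Expr → Prop
  | .lit k => k ≤ W
  | .reg r => σ.reg r ≤ W
  | .read a i => i.Fits W σ ∧ σ.mem a (i.eval σ) ≤ W
  | .bin o e f => e.Fits W σ ∧ f.Fits W σ ∧ o.eval (e.eval σ) (f.eval σ) ≤ W

inductive Prog where
  | skip
  /-- register `r` becomes the value of `e` -/
  | assign (r : ℕ) (e : Expr)
  /-- the cell of array `a` at the address given by `i` becomes the value of `e` -/
  | write (a : ℕ) (i e : Expr)
  | seq (p q : Prog)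
  /-- run `p` if the value of `e` is not `0`, otherwise `q` -/
  | branch (e : Expr) (p q : Prog)
  /-- run `p` as long as the value of `e` is not `0` -/
  | loop (e : Expr) (p : Prog)

def State.setReg (σ : State) (r x : ℕ) : State :=
  { σ with reg := Function.update σ.reg r x }

def State.setMem (σ : State) (a k x : ℕ) : State :=
  { σ with mem := Function.update σ.mem a (Function.update (σ.mem a) k x) }

/-- `Exec W p σ t τ`: with word bound `W`, the program `p` started in `σ` halts in `τ` after exactly
`t` steps. -/
inductive Exec (W : ℕ) : Prog → State → ℕ → State → Prop where
  | skip (σ : State) : Exec W .skip σ 1 σ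
  | assign (r : ℕ) (e : Expr) (σ : State) (he : e.Fits W σ) :
      Exec W (.assign r e) σ (e.cost + 1) (σ.setReg r (e.eval σ))
  | write (a : ℕ) (i e : Expr) (σ : State) (hi : i.Fits W σ) (he : e.Fits W σ) :
      Exec W (.write a i e) σ (i.cost + e.cost + 1) (σ.setMem a (i.eval σ) (e.eval σ))
  | seq {p q : Prog} {σ τ ρ : State} {t t' : ℕ} (hp : Exec W p σ t τ) (hq : Exec W q τ t' ρ) :
      Exec W (.seq p q) σ (t + t') ρ
  | branch_then {e : Expr} {p q : Prog} {σ τ : State} {t : ℕ} (he : e.Fits W σ)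
      (h : e.eval σ ≠ 0) (hp : Exec W p σ t τ) : Exec W (.branch e p q) σ (e.cost + 1 + t) τ
  | branch_else {e : Expr} {p q : Prog} {σ τ : State} {t : ℕ} (he : e.Fits W σ)
      (h : e.eval σ = 0) (hq : Exec W q σ t τ) : Exec W (.branch e p q) σ (e.cost + 1 + t) τ
  | loop_step {e : Expr} {p : Prog} {σ τ ρ : State} {t t' : ℕ} (he : e.Fits W σ)
      (h : e.eval σ ≠ 0) (hp : Exec W p σ t τ) (hl : Exec W (.loop e p) τ t' ρ) :
      Exec W (.loop e p) σ (e.cost + 1 + t + t') ρ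
  | loop_stop {e : Expr} {p : Prog} {σ : State} (he : e.Fits W σ) (h : e.eval σ = 0) :
      Exec W (.loop e p) σ (e.cost + 1) σ

/-- On a machine with words at most `W`, which hold the initial memory `σ`, the program `p` started
in `σ` halts in `τ` after at most `T` steps. -/
def Prog.RunsTo (p : Prog) (W T : ℕ) (σ τ : State) : Prop :=
  σ.Bounded W ∧ ∃ t ≤ T, Exec W p σ t τ

/-! ### Sorting labels

Labels are stored in memory through a code `code : α → ℕ`, which need not respect the order
of the alphabet. -/

/-- The memory that holds the list `l` in array `0`, its length in register `0`, and nothing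
else. -/
def listState (l : List ℕ) : State where
  reg := fun r => if r = 0 then l.length else 0
  mem := fun a k => if a = 0 then l.getD k 0 else 0

/-- On a machine with words at most `W`, the program `S` sorts the list `ls` of labels in at most
`T` steps: the sorted list replaces `ls` in array `0`. -/
def SortsLabels {α : Type v} [LinearOrder α] (S : Prog) (W T : ℕ) (code : α → ℕ) (ls : List α) :
    Prop :=
  ∃ τ, S.RunsTo W T (listState (ls.map code)) τ ∧
    ∃ ls' : List α, ls'.Perm ls ∧ ls'.Pairwise (· ≤ ·) ∧
      ∀ (k : ℕ) (hk : k < ls'.length), τ.mem 0 k = code ls'[k]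

/-! ### Ordered automata in memory -/

section Encoding

variable {Q : Type u} {α : Type v}

/-- `idx` numbers the states in increasing order by `0, 1, …, n - 1`. -/
structure IsNumbering (le : Q → Q → Prop) (n : ℕ) (idx : Q → ℕ) : Prop where
  lt : ∀ x, idx x < n
  surj : ∀ i < n, ∃ x, idx x = i
  le_iff : ∀ x y, le x y ↔ idx x ≤ idx y

/-- The memory `σ` holds `(A, le)`: a state is represented by its position in the order, and a label
by its code. Registers `0`, `1`, `2` hold the number of states, the number of edges and the initial
state. Arrays `0`, `1`, `2` hold the sources, targets and labels of the edges, in the order of the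
list `L`, which contains every edge exactly once. Array `3` is the bit array of the final states. -/
structure Holds (A : Automaton Q α) (le : Q → Q → Prop) (code : α → ℕ) (idx : Q → ℕ)
    (L : List (Q × Q × α)) (σ : State) : Prop where
  numbering : IsNumbering le (σ.reg 0) idx
  nodup : L.Nodup
  mem_iff : ∀ e, e ∈ L ↔ e ∈ A.E
  length : σ.reg 1 = L.length
  start : σ.reg 2 = idx A.s
  source : ∀ (k : ℕ) (hk : k < L.length), σ.mem 0 k = idx L[k].1
  target : ∀ (k : ℕ) (hk : k < L.length), σ.mem 1 k = idx L[k].2.1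
  label : ∀ (k : ℕ) (hk : k < L.length), σ.mem 2 k = code L[k].2.2
  final_one : ∀ x ∈ A.F, σ.mem 3 (idx x) = 1
  final_zero : ∀ x ∉ A.F, σ.mem 3 (idx x) = 0

/-- All registers and cells that are not used by the representation above are zero. -/
structure CleanElsewhere (σ : State) : Prop where
  reg : ∀ r, 3 ≤ r → σ.reg r = 0
  edges : ∀ a k, a < 3 → σ.reg 1 ≤ k → σ.mem a k = 0
  final : ∀ k, σ.reg 0 ≤ k → σ.mem 3 k = 0
  others : ∀ a k, 4 ≤ a → σ.mem a k = 0

end Encoding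

end WheelerMin

/-! Existence and quotient. Wheeler autobisimulations include equality and are closed under inverses
and composition. Since `Q` is finite, there is a maximal one. By reflexivity its composite with any
other contains both, so it is the greatest, and the closure properties make it an equivalence. Its
classes are images of singletons, hence convex; so distinct classes are ordered like any of their
members, and the Wheeler axioms pass to the quotient.

Boundaries. A convex equivalence is determined by the positions `i` at which the states `i - 1` and
`i` are inequivalent. List the edges by label, and for each label by source and target at once,
which axiom 3 permits. A boundary is forced where finality changes, and where a run of neighbouring
sources with a common label starts or ends. If two consecutive edges with one label have targets on
different sides of a boundary, a further one is forced: between the sources if these are adjacent,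
and on both sides of the source if they coincide. The reason is that in a class with at least two
states all successors by one label are equivalent (`succ_equiv`, `succ_equiv_self`). `Marked` is the
closure under these rules. `Marked.not_equiv` shows that every mark separates classes; conversely,
`isWheelerAutobisimulation_unseparated` shows that the relation "no mark in between" is itself a
Wheeler autobisimulation. Together they give `maxAutobisim_iff`.

Linear time. Every state but the initial one has an incoming edge, so `|Q| ≤ |E| + 1`
(`Holds.states_le`). Edges are sorted by two stable counting sorts: first by the sum of source and
target, then by label ranks, which come from running `S`. Consecutive edges with one label have
equal or adjacent targets (`target_succ_le`), and a boundary at a given target triggers at most one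
propagation rule (`rule_unique`). Hence two arrays indexed by targets hold all rules, and a queue
that takes each position at most once computes the closure. The number of a class is the number of
boundaries up to its states. This numbering is monotone, so duplicate edges of the quotient are
neighbours in the sorted list and are removed in one pass. -/

namespace WheelerMin

section MaximumAutobisimulation

variable {Q : Type u} {α : Type v} {A : Automaton Q α} {le : Q → Q → Prop}

theorem IsWheelerAutobisimulation.eq (A : Automaton Q α) (le : Q → Q → Prop) :
    IsWheelerAutobisimulation A le Eq where
  refl _ := rfl
  wheeler :=
    { bisimulation :=
        { forth := by rintro x y _ a rfl h; exact ⟨y, rfl, h⟩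
          back := by rintro x _ y a rfl h; exact ⟨y, rfl, h⟩
          start := rfl
          final := by rintro x _ rfl; rfl }
      image_convex := by intro C hC; simpa using hC
      preimage_convex := by intro C hC; simpa using hC }

theorem IsWheelerAutobisimulation.swap {R : Q → Q → Prop}
    (h : IsWheelerAutobisimulation A le R) : IsWheelerAutobisimulation A le (fun x y => R y x) where
  refl := h.refl
  wheeler :=
    { bisimulation :=
        { forth := fun x y x' a hx he => h.wheeler.bisimulation.back x' x y a hx he
          back := fun x x' y' a hx he => h.wheeler.bisimulation.forth x' y' x a hx he
          start := h.wheeler.bisimulation.start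
          final := fun x x' hx => (h.wheeler.bisimulation.final x' x hx).symm }
      image_convex := h.wheeler.preimage_convex
      preimage_convex := h.wheeler.image_convex }

theorem IsWheelerAutobisimulation.comp {R R' : Q → Q → Prop}
    (h : IsWheelerAutobisimulation A le R) (h' : IsWheelerAutobisimulation A le R') :
    IsWheelerAutobisimulation A le (fun x z => ∃ y, R x y ∧ R' y z) where
  refl x := ⟨x, h.refl x, h'.refl x⟩
  wheeler :=
    { bisimulation :=
        { forth := by
            rintro x y x'' a ⟨x', h1, h2⟩ he
            obtain ⟨y', hy, he'⟩ := h.wheeler.bisimulation.forth x y x' a h1 he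
            obtain ⟨y'', hy', he''⟩ := h'.wheeler.bisimulation.forth x' y' x'' a h2 he'
            exact ⟨y'', ⟨y', hy, hy'⟩, he''⟩
          back := by
            rintro x x'' y'' a ⟨x', h1, h2⟩ he
            obtain ⟨y', hy, he'⟩ := h'.wheeler.bisimulation.back x' x'' y'' a h2 he
            obtain ⟨y, hy', he''⟩ := h.wheeler.bisimulation.back x x' y' a h1 he'
            exact ⟨y, ⟨y', hy', hy⟩, he''⟩
          start := ⟨A.s, h.wheeler.bisimulation.start, h'.wheeler.bisimulation.start⟩
          final := by
            rintro x z ⟨y, h1, h2⟩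
            exact (h.wheeler.bisimulation.final x y h1).trans
              (h'.wheeler.bisimulation.final y z h2) }
      image_convex := by
        intro C hC
        convert h'.wheeler.image_convex _ (h.wheeler.image_convex C hC) using 1
        ext z
        simp only [Set.mem_ofPred_eq]
        tauto
      preimage_convex := by
        intro C hC
        convert h.wheeler.preimage_convex _ (h'.wheeler.preimage_convex C hC) using 1
        ext z
        simp only [Set.mem_ofPred_eq]
        tauto }

theorem isGreatest_maxAutobisim [Finite Q] (A : Automaton Q α) (le : Q → Q → Prop) :
    IsGreatest {R | IsWheelerAutobisimulation A le R} (maxAutobisim A le) := by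
  obtain ⟨R, hR, hmax⟩ := (Set.toFinite {R | IsWheelerAutobisimulation A le R}).exists_maximal
    ⟨Eq, IsWheelerAutobisimulation.eq A le⟩
  have hub : ∀ R', IsWheelerAutobisimulation A le R' → ∀ x y, R' x y → R x y := by
    intro R' hR' x y hxy
    -- Reflexivity of `R'` puts `R` inside the composite, so maximality puts the composite inside
    -- `R`; reflexivity of `R` puts `R'` inside the composite.
    have hle : R ≤ fun x z => ∃ y, R x y ∧ R' y z := fun x y h => ⟨y, h, hR'.refl y⟩
    exact hmax (hR.comp hR') hle x y ⟨x, hR.refl x, hxy⟩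
  have heq : maxAutobisim A le = R := by
    ext x y
    exact ⟨fun ⟨R', hR', h⟩ => hub R' hR' x y h, fun h => ⟨R, hR, h⟩⟩
  rw [heq]
  exact ⟨hR, fun R' hR' x y h => hub R' hR' x y h⟩

theorem isWheelerAutobisimulation_maxAutobisim [Finite Q] (A : Automaton Q α)
    (le : Q → Q → Prop) : IsWheelerAutobisimulation A le (maxAutobisim A le) :=
  (isGreatest_maxAutobisim A le).1

theorem equivalence_maxAutobisim [Finite Q] (A : Automaton Q α) (le : Q → Q → Prop) :
    Equivalence (maxAutobisim A le) where
  refl _ := ⟨Eq, IsWheelerAutobisimulation.eq A le, rfl⟩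
  symm := fun ⟨_, hR, h⟩ => ⟨_, hR.swap, h⟩
  trans := fun ⟨_, hR, h⟩ ⟨_, hR', h'⟩ => ⟨_, hR.comp hR', _, h, h'⟩

theorem isConvex_cls [Finite Q] (hle : IsTotalOrder le) (x : Q) :
    IsConvex le (cls A le x) := by
  have h := (isWheelerAutobisimulation_maxAutobisim A le).wheeler.image_convex {x} (by
    intro a b c hab hbc ha hc
    rw [Set.mem_singleton_iff] at *
    subst ha; subst hc
    exact hle.antisymm _ _ hbc hab)
  simpa [cls] using h

theorem toQuot_eq_iff [Finite Q] {x y : Q} :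
    toQuot A le x = toQuot A le y ↔ maxAutobisim A le x y := by
  have e := equivalence_maxAutobisim A le
  constructor
  · intro h
    have : y ∈ cls A le x := by
      rw [show cls A le x = cls A le y from congrArg Subtype.val h]
      exact e.refl y
    exact this
  · intro h
    apply Subtype.ext
    ext z
    exact ⟨fun hz => e.trans (e.symm h) hz, fun hz => e.trans h hz⟩

theorem mem_val_iff [Finite Q] {U : QuotState A le} {x : Q} :
    x ∈ U.val ↔ toQuot A le x = U := by
  obtain ⟨U, y, rfl⟩ := U
  change maxAutobisim A le y x ↔ toQuot A le x = toQuot A le y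
  rw [toQuot_eq_iff]
  exact ⟨(equivalence_maxAutobisim A le).symm, (equivalence_maxAutobisim A le).symm⟩

theorem toQuot_surjective : Function.Surjective (toQuot A le) := by
  rintro ⟨U, x, rfl⟩
  exact ⟨x, rfl⟩

theorem quotLe_toQuot_iff [Finite Q] {x y : Q} :
    quotLe A le (toQuot A le x) (toQuot A le y) ↔
      ∃ x' y', maxAutobisim A le x x' ∧ maxAutobisim A le y y' ∧ le x' y' := by
  constructor
  · rintro ⟨x', hx, y', hy, h⟩
    exact ⟨x', y', hx, hy, h⟩
  · rintro ⟨x', y', hx, hy, h⟩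
    exact ⟨x', hx, y', hy, h⟩

theorem mem_quotAutomaton_E [Finite Q] {U V : QuotState A le} {a : α} :
    (U, V, a) ∈ (quotAutomaton A le).E ↔
      ∃ x y, toQuot A le x = U ∧ toQuot A le y = V ∧ (x, y, a) ∈ A.E := by
  constructor
  · rintro ⟨x, hx, y, hy, h⟩
    exact ⟨x, y, mem_val_iff.1 hx, mem_val_iff.1 hy, h⟩
  · rintro ⟨x, y, hx, hy, h⟩
    exact ⟨x, mem_val_iff.2 hx, y, mem_val_iff.2 hy, h⟩

/-- Distinct classes are ordered like any of their members. -/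
theorem le_of_quotLe [Finite Q] (hle : IsTotalOrder le) {x y : Q}
    (h : quotLe A le (toQuot A le x) (toQuot A le y)) (hne : toQuot A le x ≠ toQuot A le y) :
    le x y := by
  have e := equivalence_maxAutobisim A le
  obtain ⟨x', y', hx, hy, hxy⟩ := quotLe_toQuot_iff.1 h
  by_contra hn
  have hyx : le y x := (hle.total x y).resolve_left hn
  apply hne
  rw [toQuot_eq_iff]
  -- Here `y ≤ x` while `x' ≤ y'`. Either `x` lies between `y` and `y'`, or `y'` lies between `x'`
  -- and `x`; convexity of a class merges the two classes in both cases.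
  rcases hle.total x y' with h1 | h1
  · exact e.symm (isConvex_cls (A := A) hle y y x y' hyx h1 (e.refl y) hy)
  · exact e.trans (isConvex_cls (A := A) hle x x' y' x hxy h1 hx (e.refl x)) (e.symm hy)

theorem quotLe_of_le [Finite Q] {x y : Q} (h : le x y) :
    quotLe A le (toQuot A le x) (toQuot A le y) :=
  ⟨x, (equivalence_maxAutobisim A le).refl x, y, (equivalence_maxAutobisim A le).refl y, h⟩

theorem walk_toQuot [Finite Q] {x y : Q} (h : A.Walk x y) :
    (quotAutomaton A le).Walk (toQuot A le x) (toQuot A le y) := by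
  induction h with
  | refl => exact .refl
  | tail _ h ih =>
    obtain ⟨a, h⟩ := h
    exact ih.tail ⟨a, mem_quotAutomaton_E.2 ⟨_, _, rfl, rfl, h⟩⟩

theorem isTotalOrder_quotLe [Finite Q] (hle : IsTotalOrder le) :
    IsTotalOrder (quotLe A le) where
  refl U := by
    obtain ⟨x, rfl⟩ := toQuot_surjective U
    exact quotLe_of_le (hle.refl x)
  antisymm U V h h' := by
    obtain ⟨x, rfl⟩ := toQuot_surjective U
    obtain ⟨y, rfl⟩ := toQuot_surjective V
    by_contra hne
    exact hne (congrArg _ (hle.antisymm _ _ (le_of_quotLe hle h hne)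
      (le_of_quotLe hle h' (Ne.symm hne))))
  trans U V Z h h' := by
    by_cases h1 : U = V
    · rwa [h1]
    by_cases h2 : V = Z
    · rwa [← h2]
    obtain ⟨x, rfl⟩ := toQuot_surjective U
    obtain ⟨y, rfl⟩ := toQuot_surjective V
    obtain ⟨z, rfl⟩ := toQuot_surjective Z
    exact quotLe_of_le (hle.trans _ _ _ (le_of_quotLe hle h h1) (le_of_quotLe hle h' h2))
  total U V := by
    obtain ⟨x, rfl⟩ := toQuot_surjective U
    obtain ⟨y, rfl⟩ := toQuot_surjective V
    exact (hle.total x y).imp quotLe_of_le quotLe_of_le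

/-- Walks project to the quotient, and an edge of the quotient comes from an edge between
representatives. By `le_of_quotLe` distinct target classes are ordered like these representatives,
so axioms 2 and 3 apply to the original edges. -/
theorem IsWheelerNFA.quot [LinearOrder α] (h : IsWheelerNFA A le) :
    IsWheelerNFA (quotAutomaton A le) (quotLe A le) := by
  have := h.finite
  refine ⟨.of_surjective _ (toQuot_surjective (A := A) (le := le)), ?_, ?_,
    isTotalOrder_quotLe h.order, ?_, ?_, ?_⟩
  · intro U
    obtain ⟨x, rfl⟩ := toQuot_surjective U
    exact walk_toQuot (h.reachable x)
  · intro U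
    obtain ⟨x, rfl⟩ := toQuot_surjective U
    obtain ⟨y, hy, hw⟩ := h.coreachable x
    exact ⟨toQuot A le y, ⟨y, (equivalence_maxAutobisim A le).refl y, hy⟩, walk_toQuot hw⟩
  · intro U
    obtain ⟨x, rfl⟩ := toQuot_surjective U
    exact quotLe_of_le (h.axiom1 x)
  · intro U V U' V' a b hE hE' hV hne
    obtain ⟨x, y, rfl, rfl, he⟩ := mem_quotAutomaton_E.1 hE
    obtain ⟨x', y', rfl, rfl, he'⟩ := mem_quotAutomaton_E.1 hE'
    exact h.axiom2 x y x' y' a b he he' (le_of_quotLe h.order hV hne) (fun h => hne (h ▸ rfl))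
  · intro U V U' V' a hE hE' hV hne
    obtain ⟨x, y, rfl, rfl, he⟩ := mem_quotAutomaton_E.1 hE
    obtain ⟨x', y', rfl, rfl, he'⟩ := mem_quotAutomaton_E.1 hE'
    exact quotLe_of_le (h.axiom3 x y x' y' a he he' (le_of_quotLe h.order hV hne)
      (fun h => hne (h ▸ rfl)))

end MaximumAutobisimulation

/-! ### Reasoning about programs of the word RAM -/

section Machine

variable {W : ℕ}

theorem Expr.Fits.eval_le {σ : State} {e : Expr} (h : e.Fits W σ) : e.eval σ ≤ W := by
  cases e with
  | lit k => exact h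
  | reg r => exact h
  | read a i => exact h.2
  | bin o e f => exact h.2.2

theorem Exec.loop_exit {e : Expr} {p : Prog} {σ : State} (he : e.Fits W σ) (h : e.eval σ = 0) :
    Exec W (.loop e p) σ (e.cost + 1) σ := (Exec.loop_stop) he h

theorem State.Bounded.setReg {σ : State} (h : σ.Bounded W) (r : ℕ) {x : ℕ} (hx : x ≤ W) :
    (σ.setReg r x).Bounded W := by
  refine ⟨fun r' => ?_, h.2⟩
  simp only [State.setReg, Function.update_apply]
  split_ifs
  · exact hx
  · exact h.1 r'

theorem State.Bounded.setMem {σ : State} (h : σ.Bounded W) (a k : ℕ) {x : ℕ} (hx : x ≤ W) :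
    (σ.setMem a k x).Bounded W := by
  refine ⟨h.1, fun a' k' => ?_⟩
  simp only [State.setMem, Function.update_apply]
  split_ifs
  · simp only [Function.update_apply]
    split_ifs
    · exact hx
    · exact h.2 _ _
  · exact h.2 _ _

theorem Exec.bounded {p : Prog} {σ τ : State} {t : ℕ} (h : Exec W p σ t τ)
    (hσ : σ.Bounded W) : τ.Bounded W := by
  induction h with
  | skip => exact hσ
  | assign r e σ he => exact hσ.setReg r he.eval_le
  | write a i e σ hi he => exact hσ.setMem a _ he.eval_le
  | seq _ _ ih ih' => exact ih' (ih hσ)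
  | branch_then _ _ _ ih => exact ih hσ
  | branch_else _ _ _ ih => exact ih hσ
  | loop_step _ _ _ _ ih ih' => exact ih' (ih hσ)
  | loop_stop => exact hσ

/-! ### Frames -/

/-- The program may write to register `r`. -/
def Prog.wReg : Prog → ℕ → Bool
  | .skip, _ => false
  | .assign r _, r' => r == r'
  | .write _ _ _, _ => false
  | .seq p q, r => p.wReg r || q.wReg r
  | .branch _ p q, r => p.wReg r || q.wReg r
  | .loop _ p, r => p.wReg r

/-- The program may write to array `a`. -/
def Prog.wMem : Prog → ℕ → Bool
  | .skip, _ => false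
  | .assign _ _, _ => false
  | .write a _ _, a' => a == a'
  | .seq p q, a => p.wMem a || q.wMem a
  | .branch _ p q, a => p.wMem a || q.wMem a
  | .loop _ p, a => p.wMem a

/-- The two memories agree on what `p` does not write. -/
structure Prog.Frame (p : Prog) (σ τ : State) : Prop where
  reg : ∀ r, p.wReg r = false → τ.reg r = σ.reg r
  mem : ∀ a, p.wMem a = false → τ.mem a = σ.mem a

theorem Prog.Frame.refl (p : Prog) (σ : State) : p.Frame σ σ := ⟨fun _ _ => rfl, fun _ _ => rfl⟩

theorem Prog.Frame.trans {p : Prog} {σ τ ρ : State} (h : p.Frame σ τ) (h' : p.Frame τ ρ) :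
    p.Frame σ ρ :=
  ⟨fun r hr => (h'.reg r hr).trans (h.reg r hr), fun a ha => (h'.mem a ha).trans (h.mem a ha)⟩

/-- Registers and arrays that are not targets of any command keep their contents. For a concrete
program the side condition is a computation, so later proofs discharge it by `rfl`. -/
theorem Exec.frame {p : Prog} {σ τ : State} {t : ℕ} (h : Exec W p σ t τ) : p.Frame σ τ := by
  induction h with
  | skip => exact .refl _ _
  | assign r e σ he =>
    refine ⟨fun r' hr => ?_, fun _ _ => rfl⟩
    simp only [Prog.wReg, beq_eq_false_iff_ne] at hr
    simp [State.setReg, hr.symm]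
  | write a i e σ hi he =>
    refine ⟨fun _ _ => rfl, fun a' ha => ?_⟩
    simp only [Prog.wMem, beq_eq_false_iff_ne] at ha
    simp [State.setMem, ha.symm]
  | seq _ _ ih ih' =>
    constructor
    · intro r hr
      simp only [Prog.wReg, Bool.or_eq_false_iff] at hr
      exact (ih'.reg r hr.2).trans (ih.reg r hr.1)
    · intro r hr
      simp only [Prog.wMem, Bool.or_eq_false_iff] at hr
      exact (ih'.mem r hr.2).trans (ih.mem r hr.1)
  | branch_then _ _ _ ih =>
    constructor
    · intro r hr
      simp only [Prog.wReg, Bool.or_eq_false_iff] at hr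
      exact ih.reg r hr.1
    · intro r hr
      simp only [Prog.wMem, Bool.or_eq_false_iff] at hr
      exact ih.mem r hr.1
  | branch_else _ _ _ ih =>
    constructor
    · intro r hr
      simp only [Prog.wReg, Bool.or_eq_false_iff] at hr
      exact ih.reg r hr.2
    · intro r hr
      simp only [Prog.wMem, Bool.or_eq_false_iff] at hr
      exact ih.mem r hr.2
  | loop_step _ _ _ _ ih ih' =>
    exact ⟨fun r hr => (ih'.reg r hr).trans (ih.reg r hr),
      fun r hr => (ih'.mem r hr).trans (ih.mem r hr)⟩
  | loop_stop => exact .refl _ _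

/-! ### Terminating executions -/

/-- Started in `σ`, the program halts after at most `T` steps in a memory that satisfies `Φ`. -/
def Prog.Reaches (p : Prog) (W T : ℕ) (σ : State) (Φ : State → Prop) : Prop :=
  ∃ t τ, t ≤ T ∧ Exec W p σ t τ ∧ Φ τ

theorem Prog.Reaches.mono {p : Prog} {T T' : ℕ} {σ : State} {Φ Ψ : State → Prop}
    (h : p.Reaches W T σ Φ) (hT : T ≤ T') (hΦ : ∀ τ, Φ τ → Ψ τ) : p.Reaches W T' σ Ψ := by
  obtain ⟨t, τ, ht, he, hτ⟩ := h
  exact ⟨t, τ, ht.trans hT, he, hΦ τ hτ⟩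

/-- Adds the boundedness of the final memory and the frame property to the postcondition. -/
theorem Prog.Reaches.with_frame {p : Prog} {T : ℕ} {σ : State} {Φ : State → Prop}
    (h : p.Reaches W T σ Φ) (hσ : σ.Bounded W) :
    p.Reaches W T σ (fun τ => Φ τ ∧ τ.Bounded W ∧ p.Frame σ τ) := by
  obtain ⟨t, τ, ht, he, hτ⟩ := h
  exact ⟨t, τ, ht, he, hτ, he.bounded hσ, he.frame⟩

theorem Prog.Reaches.seq {p q : Prog} {T T' : ℕ} {σ : State} {Φ Ψ : State → Prop}
    (h : p.Reaches W T σ Φ) (h' : ∀ τ, Φ τ → q.Reaches W T' τ Ψ) :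
    (Prog.seq p q).Reaches W (T + T') σ Ψ := by
  obtain ⟨t, τ, ht, he, hτ⟩ := h
  obtain ⟨t', τ', ht', he', hτ'⟩ := h' τ hτ
  exact ⟨t + t', τ', by omega, .seq he he', hτ'⟩

/-! ### Loop-free programs -/

/-- Sufficient for `Expr.Fits` in a bounded memory. -/
def Expr.Ok (W : ℕ) (σ : State) : Expr → Prop
  | .lit k => k ≤ W
  | .reg _ => True
  | .read _ i => i.Ok W σ
  | .bin .add e f => e.Ok W σ ∧ f.Ok W σ ∧ e.eval σ + f.eval σ ≤ W
  | .bin .mul e f => e.Ok W σ ∧ f.Ok W σ ∧ e.eval σ * f.eval σ ≤ W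
  | .bin _ e f => e.Ok W σ ∧ f.Ok W σ

/-- In a bounded memory only literals, sums and products can exceed the bound: differences,
quotients and remainders are at most their first operand, and comparisons are at most `1 ≤ W`. -/
theorem Expr.Ok.fits {σ : State} (hσ : σ.Bounded W) (hW : 1 ≤ W) {e : Expr} (h : e.Ok W σ) :
    e.Fits W σ := by
  induction e with
  | lit k => exact h
  | reg r => exact hσ.1 r
  | read a i ih => exact ⟨ih h, hσ.2 _ _⟩
  | bin o e f ihe ihf =>
    cases o with
    | add => exact ⟨ihe h.1, ihf h.2.1, h.2.2⟩
    | mul => exact ⟨ihe h.1, ihf h.2.1, h.2.2⟩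
    | sub => exact ⟨ihe h.1, ihf h.2, (Nat.sub_le _ _).trans (ihe h.1).eval_le⟩
    | div => exact ⟨ihe h.1, ihf h.2, (Nat.div_le_self _ _).trans (ihe h.1).eval_le⟩
    | mod => exact ⟨ihe h.1, ihf h.2, (Nat.mod_le _ _).trans (ihe h.1).eval_le⟩
    | lt => exact ⟨ihe h.1, ihf h.2, by simp only [Op.eval]; split_ifs <;> omega⟩
    | eq => exact ⟨ihe h.1, ihf h.2, by simp only [Op.eval]; split_ifs <;> omega⟩

/-- The effect of a loop-free program. -/
def Prog.run : Prog → State → State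
  | .skip, σ => σ
  | .assign r e, σ => σ.setReg r (e.eval σ)
  | .write a i e, σ => σ.setMem a (i.eval σ) (e.eval σ)
  | .seq p q, σ => q.run (p.run σ)
  | .branch e p q, σ => if e.eval σ ≠ 0 then p.run σ else q.run σ
  | .loop _ _, σ => σ

/-- The program is loop-free, and its execution from `σ` respects the word bound. -/
def Prog.Safe (W : ℕ) : Prog → State → Prop
  | .skip, _ => True
  | .assign _ e, σ => e.Ok W σ
  | .write _ i e, σ => i.Ok W σ ∧ e.Ok W σ
  | .seq p q, σ => p.Safe W σ ∧ q.Safe W (p.run σ)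
  | .branch e p q, σ => e.Ok W σ ∧ if e.eval σ ≠ 0 then p.Safe W σ else q.Safe W σ
  | .loop _ _, _ => False

/-- An upper bound for the running time of a loop-free program. -/
def Prog.cost : Prog → ℕ
  | .skip => 1
  | .assign _ e => e.cost + 1
  | .write _ i e => i.cost + e.cost + 1
  | .seq p q => p.cost + q.cost
  | .branch e p q => e.cost + 1 + (p.cost + q.cost)
  | .loop _ _ => 0

/-- Replaces derivations in `Exec` by evaluation of the functions `run` and `Safe`, which `simp` can
unfold. -/
theorem Prog.Safe.exec (hW : 1 ≤ W) {p : Prog} {σ : State} (h : p.Safe W σ)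
    (hσ : σ.Bounded W) : ∃ t ≤ p.cost, Exec W p σ t (p.run σ) := by
  induction p generalizing σ with
  | skip => exact ⟨1, le_rfl, .skip σ⟩
  | assign r e => exact ⟨_, le_rfl, .assign r e σ (Expr.Ok.fits hσ hW h)⟩
  | write a i e =>
    exact ⟨_, le_rfl, .write a i e σ (Expr.Ok.fits hσ hW h.1) (Expr.Ok.fits hσ hW h.2)⟩
  | seq p q ihp ihq =>
    obtain ⟨t, ht, he⟩ := ihp h.1 hσ
    obtain ⟨t', ht', he'⟩ := ihq h.2 (he.bounded hσ)
    exact ⟨t + t', by simp only [Prog.cost]; omega, .seq he he'⟩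
  | branch e p q ihp ihq =>
    obtain ⟨h1, h2⟩ := h
    by_cases hc : e.eval σ = 0
    · rw [if_neg (not_not.2 hc)] at h2
      obtain ⟨t, ht, he⟩ := ihq h2 hσ
      rw [Prog.run, if_neg (not_not.2 hc)]
      exact ⟨_, by simp only [Prog.cost]; omega, .branch_else (h1.fits hσ hW) hc he⟩
    · rw [if_pos hc] at h2
      obtain ⟨t, ht, he⟩ := ihp h2 hσ
      rw [Prog.run, if_pos hc]
      exact ⟨_, by simp only [Prog.cost]; omega, .branch_then (h1.fits hσ hW) hc he⟩
  | loop e p => exact h.elim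

theorem Prog.Safe.reaches (hW : 1 ≤ W) {p : Prog} {σ : State} (h : p.Safe W σ)
    (hσ : σ.Bounded W) {Φ : State → Prop} (hΦ : Φ (p.run σ)) : p.Reaches W p.cost σ Φ := by
  obtain ⟨t, ht, he⟩ := h.exec hW hσ
  exact ⟨t, _, ht, he, hΦ⟩

/-! ### Loops -/

/-- Strong induction on the potential `μ`: every round costs at most one run of the body and one
test, and the final failing test accounts for the `+ 1` after `μ σ`. -/
theorem Prog.reaches_loop (hW : 1 ≤ W) {e : Expr} {p : Prog} (I : State → Prop)
    (μ : State → ℕ) (hok : ∀ σ, σ.Bounded W → I σ → e.Ok W σ)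
    (hstep : ∀ σ, σ.Bounded W → I σ → e.eval σ ≠ 0 →
      p.Safe W σ ∧ I (p.run σ) ∧ μ (p.run σ) < μ σ)
    {σ : State} (hσ : σ.Bounded W) (hI : I σ) :
    (Prog.loop e p).Reaches W ((p.cost + e.cost + 1) * (μ σ + 1)) σ
      (fun τ => I τ ∧ e.eval τ = 0) := by
  induction hn : μ σ using Nat.strong_induction_on generalizing σ with
  | _ n ih =>
    have hfit := (hok σ hσ hI).fits hσ hW
    by_cases hc : e.eval σ = 0
    · exact ⟨_, σ, by nlinarith [Nat.zero_le p.cost, Nat.zero_le e.cost],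
        .loop_exit hfit hc, hI, hc⟩
    · obtain ⟨hs, hI', hμ⟩ := hstep σ hσ hI hc
      obtain ⟨t, ht, he⟩ := hs.exec hW hσ
      obtain ⟨t', τ, ht', he', hτ⟩ := ih _ (hn ▸ hμ) (he.bounded hσ) hI' rfl
      refine ⟨_, τ, ?_, .loop_step hfit hc he he', hτ⟩
      have : (p.cost + e.cost + 1) * (μ (p.run σ) + 1) ≤ (p.cost + e.cost + 1) * n :=
        Nat.mul_le_mul_left _ (by omega)
      rw [Nat.mul_succ]
      omega

/-- Runs `body` with register `3` equal to `0, 1, …, n - 1`, where `n` is the value of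
register `N`. -/
def Prog.forLoop (N : ℕ) (body : Prog) : Prog :=
  .seq (.assign 3 (.lit 0))
    (.loop (.bin .lt (.reg 3) (.reg N))
      (.seq body (.assign 3 (.bin .add (.reg 3) (.lit 1)))))

/-- A round costs 8 steps beyond the body, 4 for the test and 4 for the increment; the initial
assignment costs 2, whence the 10. The step receives the frame of the whole loop, so that unchanged
data need not appear in the invariant. -/
theorem Prog.reaches_forLoop {N : ℕ} {body : Prog} (hN3 : N ≠ 3)
    (hbN : body.wReg N = false) (hb3 : body.wReg 3 = false) (hW : 1 ≤ W) {n : ℕ}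
    (Inv : ℕ → State → Prop) {σ : State} (hσ : σ.Bounded W) (hn : σ.reg N = n)
    (h0 : Inv 0 (σ.setReg 3 0))
    (hstep : ∀ k < n, ∀ ρ, ρ.Bounded W → (forLoop N body).Frame σ ρ → ρ.reg 3 = k → Inv k ρ →
      body.Safe W ρ ∧ Inv (k + 1) ((body.run ρ).setReg 3 (k + 1))) :
    (forLoop N body).Reaches W ((body.cost + 10) * (n + 1)) σ (Inv n) := by
  have hwN : (forLoop N body).wReg N = false := by
    simp [forLoop, Prog.wReg, hbN, hN3.symm]
  set p := Prog.seq body (.assign 3 (.bin .add (.reg 3) (.lit 1))) with hp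
  have hnW : n ≤ W := hn ▸ hσ.1 N
  have hfr0 : (forLoop N body).Frame σ (σ.setReg 3 0) := by
    refine ⟨fun r hr => ?_, fun _ _ => rfl⟩
    have : r ≠ 3 := by
      rintro rfl
      simp [forLoop, Prog.wReg] at hr
    simp [State.setReg, this]
  have hloop := Prog.reaches_loop (p := p) (e := .bin .lt (.reg 3) (.reg N)) hW
    (fun ρ => (forLoop N body).Frame σ ρ ∧ ρ.reg 3 ≤ n ∧ Inv (ρ.reg 3) ρ) (fun ρ => n - ρ.reg 3)
    (fun ρ _ _ => ⟨trivial, trivial⟩) (by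
      rintro ρ hρ ⟨hf, hle, hI⟩ hc
      have hρN : ρ.reg N = n := (hf.reg N hwN).trans hn
      have hlt : ρ.reg 3 < n := by
        simp only [Expr.eval, Op.eval, hρN] at hc
        by_contra h
        simp [h] at hc
      obtain ⟨hs, hI'⟩ := hstep _ hlt ρ hρ hf rfl hI
      obtain ⟨t, -, he⟩ := hs.exec hW hρ
      have h3 : (body.run ρ).reg 3 = ρ.reg 3 := he.frame.reg 3 hb3
      have hsafe : p.Safe W ρ := by
        refine ⟨hs, trivial, hW, ?_⟩
        simp only [Expr.eval, h3]
        omega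
      have hrun : p.run ρ = (body.run ρ).setReg 3 (ρ.reg 3 + 1) := by
        simp [hp, Prog.run, Expr.eval, Op.eval, h3]
      have h3' : (p.run ρ).reg 3 = ρ.reg 3 + 1 := by simp [hrun, State.setReg]
      obtain ⟨t', -, he'⟩ := hsafe.exec hW hρ
      refine ⟨hsafe, ⟨hf.trans ⟨fun r hr => ?_, fun a ha => ?_⟩, by omega, ?_⟩, by omega⟩
      · refine he'.frame.reg r ?_
        simp only [forLoop, Prog.wReg, Bool.or_eq_false_iff] at hr
        simpa [hp, Prog.wReg] using hr.2
      · refine he'.frame.mem a ?_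
        simpa [forLoop, hp, Prog.wMem] using ha
      · rw [h3', hrun]
        exact hI')
    (hσ.setReg 3 (Nat.zero_le W)) ⟨hfr0, by simp [State.setReg], by simpa [State.setReg] using h0⟩
  obtain ⟨t, τ, ht, he, ⟨hf, hle, hI⟩, hc⟩ := hloop
  have hτN : τ.reg N = n := (hf.reg N hwN).trans hn
  have h3 : τ.reg 3 = n := by
    simp only [Expr.eval, Op.eval, hτN] at hc
    by_contra h
    rw [if_pos (by omega)] at hc
    omega
  have h3' : (σ.setReg 3 0).reg 3 = 0 := by simp [State.setReg]
  refine ⟨_, τ, ?_, .seq (.assign 3 (.lit 0) σ (Nat.zero_le W)) he, h3 ▸ hI⟩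
  rw [h3'] at ht
  simp only [hp, Prog.cost, Expr.cost, Nat.sub_zero] at ht ⊢
  nlinarith [ht, Nat.zero_le (body.cost * n)]

/-- A loop that fills the first cells of array `a`. -/
theorem Prog.reaches_fill {N a : ℕ} {e : Expr} (hN3 : N ≠ 3) (hW : 1 ≤ W) {n : ℕ}
    (f : ℕ → ℕ) {σ : State} (hσ : σ.Bounded W) (hn : σ.reg N = n)
    (he : ∀ k < n, ∀ ρ, ρ.Bounded W → (∀ r, r ≠ 3 → ρ.reg r = σ.reg r) →
      (∀ b, b ≠ a → ρ.mem b = σ.mem b) → ρ.reg 3 = k → e.Ok W ρ ∧ e.eval ρ = f k) :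
    (forLoop N (.write a (.reg 3) e)).Reaches W ((e.cost + 12) * (n + 1)) σ
      (fun τ => (∀ k < n, τ.mem a k = f k) ∧ ∀ k, n ≤ k → τ.mem a k = σ.mem a k) := by
  refine (Prog.reaches_forLoop (body := .write a (.reg 3) e) hN3 rfl rfl hW
    (fun k τ => (∀ j < k, τ.mem a j = f j) ∧ ∀ j, k ≤ j → τ.mem a j = σ.mem a j) hσ hn
    (by simp [State.setReg]) ?_).mono ?_ (fun _ h => h)
  · intro k hk ρ hρ hf h3 hI
    obtain ⟨hok, hev⟩ := he k hk ρ hρ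
      (fun r hr => hf.reg r (by simp [forLoop, Prog.wReg, hr.symm]))
      (fun b hb => hf.mem b (by simp [forLoop, Prog.wMem, hb.symm])) h3
    refine ⟨⟨trivial, hok⟩, fun j hj => ?_, fun j hj => ?_⟩
    · simp only [Prog.run, State.setMem, State.setReg, Expr.eval, h3, hev, Function.update_self,
        Function.update_apply]
      split_ifs with h
      · rw [h]
      · exact hI.1 j (by omega)
    · simp only [Prog.run, State.setMem, State.setReg, Expr.eval, h3, Function.update_self,
        Function.update_apply]
      rw [if_neg (by omega)]
      exact hI.2 j (by omega)
  · simp only [Prog.cost, Expr.cost]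
    apply Nat.mul_le_mul_right
    omega

/-! ### Relocation -/

/-- Renames register `r` to `r + d` and array `a` to `a + d`. -/
def Expr.shift (d : ℕ) : Expr → Expr
  | .lit k => .lit k
  | .reg r => .reg (r + d)
  | .read a i => .read (a + d) (i.shift d)
  | .bin o e f => .bin o (e.shift d) (f.shift d)

/-- Renames register `r` to `r + d` and array `a` to `a + d`. -/
def Prog.shift (d : ℕ) : Prog → Prog
  | .skip => .skip
  | .assign r e => .assign (r + d) (e.shift d)
  | .write a i e => .write (a + d) (i.shift d) (e.shift d)
  | .seq p q => .seq (p.shift d) (q.shift d)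
  | .branch e p q => .branch (e.shift d) (p.shift d) (q.shift d)
  | .loop e p => .loop (e.shift d) (p.shift d)

/-- `σ'` contains `σ`, with registers and arrays renumbered by adding `d`. -/
structure State.Shifted (d : ℕ) (σ σ' : State) : Prop where
  reg : ∀ r, σ'.reg (r + d) = σ.reg r
  mem : ∀ a, σ'.mem (a + d) = σ.mem a

theorem Expr.eval_shift {d : ℕ} {σ σ' : State} (h : σ.Shifted d σ') (e : Expr) :
    (e.shift d).eval σ' = e.eval σ := by
  induction e with
  | lit k => rfl
  | reg r => exact h.reg r
  | read a i ih => simp only [Expr.shift, Expr.eval, ih, h.mem]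
  | bin o e f ihe ihf => simp only [Expr.shift, Expr.eval, ihe, ihf]

theorem Expr.cost_shift (d : ℕ) (e : Expr) : (e.shift d).cost = e.cost := by
  induction e with
  | lit k => rfl
  | reg r => rfl
  | read a i ih => simp only [Expr.shift, Expr.cost, ih]
  | bin o e f ihe ihf => simp only [Expr.shift, Expr.cost, ihe, ihf]

theorem Expr.Fits.shift {d W' : ℕ} (hW : W ≤ W') {σ σ' : State} (h : σ.Shifted d σ') {e : Expr}
    (he : e.Fits W σ) : (e.shift d).Fits W' σ' := by
  induction e with
  | lit k => exact le_trans he hW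
  | reg r => exact (h.reg r).trans_le (le_trans he hW)
  | read a i ih =>
    refine ⟨ih he.1, ?_⟩
    rw [Expr.eval_shift h, h.mem]
    exact he.2.trans hW
  | bin o e f ihe ihf =>
    refine ⟨ihe he.1, ihf he.2.1, ?_⟩
    rw [Expr.eval_shift h, Expr.eval_shift h]
    exact he.2.2.trans hW

/-- Lets the unknown program `S` run as a subroutine: after relocation it cannot touch registers and
arrays numbered below `d`, it takes the same number of steps, and a larger word bound does no harm.
-/
theorem Exec.shift {d W' : ℕ} (hW : W ≤ W') {p : Prog} {σ τ : State} {t : ℕ}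
    (h : Exec W p σ t τ) {σ' : State} (hσ : σ.Shifted d σ') :
    ∃ τ', Exec W' (p.shift d) σ' t τ' ∧ τ.Shifted d τ' := by
  induction h generalizing σ' with
  | skip σ => exact ⟨σ', .skip σ', hσ⟩
  | assign r e σ he =>
    refine ⟨σ'.setReg (r + d) ((e.shift d).eval σ'), Expr.cost_shift d e ▸ .assign (r + d) (e.shift d) σ' (he.shift hW hσ),
      ?_, hσ.mem⟩
    intro r'
    simp [State.setReg, Function.update_apply, hσ.reg, Expr.eval_shift hσ]
  | write a i e σ hi he =>
    refine ⟨σ'.setMem (a + d) ((i.shift d).eval σ') ((e.shift d).eval σ'),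
      Expr.cost_shift d i ▸ Expr.cost_shift d e ▸
      .write (a + d) (i.shift d) (e.shift d) σ' (hi.shift hW hσ) (he.shift hW hσ), hσ.reg, ?_⟩
    intro a'
    simp [State.setMem, Function.update_apply, hσ.mem, Expr.eval_shift hσ]
  | seq _ _ ih ih' =>
    obtain ⟨τ', he, hτ⟩ := ih hσ
    obtain ⟨ρ', he', hρ⟩ := ih' hτ
    exact ⟨ρ', .seq he he', hρ⟩
  | @branch_then e p q σ τ t he hc _ ih =>
    obtain ⟨τ', hx, hτ⟩ := ih hσ
    exact ⟨τ', Expr.cost_shift d e ▸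
      .branch_then (he.shift hW hσ) (by rwa [Expr.eval_shift hσ]) hx, hτ⟩
  | @branch_else e p q σ τ t he hc _ ih =>
    obtain ⟨τ', hx, hτ⟩ := ih hσ
    exact ⟨τ', Expr.cost_shift d e ▸
      .branch_else (he.shift hW hσ) (by rwa [Expr.eval_shift hσ]) hx, hτ⟩
  | @loop_step e p σ τ ρ t t' he hc _ _ ih ih' =>
    obtain ⟨τ', hx, hτ⟩ := ih hσ
    obtain ⟨ρ', hx', hρ⟩ := ih' hτ
    exact ⟨ρ', Expr.cost_shift d e ▸
      .loop_step (he.shift hW hσ) (by rwa [Expr.eval_shift hσ]) hx hx', hρ⟩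
  | loop_stop =>
    rename_i e p σ he hc
    exact ⟨σ', Expr.cost_shift d e ▸
      .loop_exit (he.shift hW hσ) (by rwa [Expr.eval_shift hσ]), hσ⟩

theorem Prog.wReg_shift (d : ℕ) (p : Prog) {r : ℕ} (hr : r < d) : (p.shift d).wReg r = false := by
  induction p with
  | assign r' e => simp [Prog.shift, Prog.wReg]; omega
  | _ => simp_all [Prog.shift, Prog.wReg]

theorem Prog.wMem_shift (d : ℕ) (p : Prog) {a : ℕ} (ha : a < d) : (p.shift d).wMem a = false := by
  induction p with
  | write a' i e => simp [Prog.shift, Prog.wMem]; omega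
  | _ => simp_all [Prog.shift, Prog.wMem]

end Machine

/-! ### Class boundaries as the closure under local rules on the sorted edges -/

section Boundaries

variable {Q : Type u} {α : Type v}

/-- The edges of `A` are enumerated by sources `U`, targets `V` and label codes `Lb`, grouped by
labels, and with nondecreasing sources and targets for each label. -/
structure IsEdgeSorting (A : Automaton Q α) (code : α → ℕ) (idx : Q → ℕ) (m : ℕ)
    (U V Lb : ℕ → ℕ) : Prop where
  edge : ∀ k < m, ∃ x y a, (x, y, a) ∈ A.E ∧ U k = idx x ∧ V k = idx y ∧ Lb k = code a
  exists_index : ∀ x y a, (x, y, a) ∈ A.E → ∃ k < m, U k = idx x ∧ V k = idx y ∧ Lb k = code a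
  mono : ∀ p q, p ≤ q → q < m → Lb p = Lb q → U p ≤ U q ∧ V p ≤ V q
  contiguous : ∀ p r q, p ≤ r → r ≤ q → q < m → Lb p = Lb q → Lb r = Lb q

/-- The positions `i` such that the states `i - 1` and `i` have to be distinguished: the least set
closed under the local rules for consecutive edges. Positions outside `1, …, n - 1` are
meaningless. -/
inductive Marked (n m : ℕ) (fb U V Lb : ℕ → ℕ) : ℕ → Prop where
  | final (i : ℕ) : 0 < i → i < n → fb (i - 1) ≠ fb i → Marked n m fb U V Lb i
  | first : 0 < m → Marked n m fb U V Lb (U 0)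
  | last : 0 < m → Marked n m fb U V Lb (U (m - 1) + 1)
  | gap_left (k : ℕ) : k + 1 < m → (Lb k ≠ Lb (k + 1) ∨ U k + 1 < U (k + 1)) →
      Marked n m fb U V Lb (U k + 1)
  | gap_right (k : ℕ) : k + 1 < m → (Lb k ≠ Lb (k + 1) ∨ U k + 1 < U (k + 1)) →
      Marked n m fb U V Lb (U (k + 1))
  | prop_left (k : ℕ) : k + 1 < m → Lb k = Lb (k + 1) → V k ≠ V (k + 1) →
      Marked n m fb U V Lb (V (k + 1)) → Marked n m fb U V Lb (U k + 1)
  | prop_right (k : ℕ) : k + 1 < m → Lb k = Lb (k + 1) → V k ≠ V (k + 1) →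
      Marked n m fb U V Lb (V (k + 1)) → Marked n m fb U V Lb (U (k + 1))

/-- No position in the half-open interval between `i` and `j` satisfies `M`. -/
def Unseparated (M : ℕ → Prop) (i j : ℕ) : Prop := ∀ l, min i j < l → l ≤ max i j → ¬ M l

theorem Unseparated.refl (M : ℕ → Prop) (i : ℕ) : Unseparated M i i := by
  intro l h h'
  omega

theorem Unseparated.symm {M : ℕ → Prop} {i j : ℕ} (h : Unseparated M i j) :
    Unseparated M j i := by
  intro l h1 h2
  exact h l (by omega) (by omega)

theorem Unseparated.trans {M : ℕ → Prop} {i j k : ℕ} (h : Unseparated M i j)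
    (h' : Unseparated M j k) : Unseparated M i k := by
  intro l h1 h2
  by_cases hl : min i j < l ∧ l ≤ max i j
  · exact h l hl.1 hl.2
  · exact h' l (by omega) (by omega)

theorem Unseparated.subinterval {M : ℕ → Prop} {i j i' j' : ℕ} (h : Unseparated M i j)
    (h1 : min i j ≤ min i' j') (h2 : max i' j' ≤ max i j) : Unseparated M i' j' :=
  fun l h3 h4 => h l (by omega) (by omega)

theorem unseparated_succ {M : ℕ → Prop} {i : ℕ} (h : ¬ M (i + 1)) : Unseparated M i (i + 1) := by
  intro l h1 h2
  obtain rfl : l = i + 1 := by omega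
  exact h

/-- Reduces a reflexive and transitive property of unseparated positions to neighbours. Both
directions are required because `P` need not be symmetric. -/
theorem Unseparated.induct {M : ℕ → Prop} {n : ℕ} (P : ℕ → ℕ → Prop) (hrefl : ∀ i, P i i)
    (htrans : ∀ i j k, P i j → P j k → P i k) (hup : ∀ i, i + 1 < n → ¬ M (i + 1) → P i (i + 1))
    (hdown : ∀ i, i + 1 < n → ¬ M (i + 1) → P (i + 1) i) {i j : ℕ} (hi : i < n) (hj : j < n)
    (h : Unseparated M i j) : P i j := by
  have key : ∀ d i, i + d < n → Unseparated M i (i + d) → P i (i + d) ∧ P (i + d) i := by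
    intro d
    induction d with
    | zero => exact fun i _ _ => ⟨hrefl i, hrefl i⟩
    | succ d ih =>
      intro i hid hsep
      obtain ⟨h1, h2⟩ := ih i (by omega) (hsep.subinterval (by omega) (by omega))
      have hM : ¬ M (i + d + 1) := hsep _ (by omega) (by omega)
      exact ⟨htrans _ _ _ h1 (hup _ hid hM), htrans _ _ _ (hdown _ hid hM) h2⟩
  rcases le_total i j with hij | hij
  · obtain ⟨d, rfl⟩ := Nat.exists_eq_add_of_le hij
    exact (key d i hj h).1
  · obtain ⟨d, rfl⟩ := Nat.exists_eq_add_of_le hij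
    exact (key d j hi h.symm).2

variable {A : Automaton Q α} {le : Q → Q → Prop} {code : α → ℕ} {idx : Q → ℕ}
  {n m : ℕ} {fb U V Lb : ℕ → ℕ}

theorem IsNumbering.injective (hidx : IsNumbering le n idx) (hle : IsTotalOrder le) :
    Function.Injective idx := fun x y h =>
  hle.antisymm x y ((hidx.le_iff x y).2 h.le) ((hidx.le_iff y x).2 h.ge)

/-- By axiom 1 a state with something strictly below it is not initial, so the walk that reaches it
has a last edge. -/
theorem IsWheelerNFA.exists_edge [LinearOrder α] (hA : IsWheelerNFA A le) {x y : Q}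
    (hxy : le x y) (hne : x ≠ y) : ∃ z a, (z, y, a) ∈ A.E := by
  have hy : y ≠ A.s := by
    rintro rfl
    exact hne (hA.order.antisymm _ _ hxy (hA.axiom1 x))
  rcases Relation.ReflTransGen.cases_tail (hA.reachable y) with h | ⟨z, -, a, h⟩
  · exact absurd h hy
  · exact ⟨z, a, h⟩

/-- Consecutive edges with the same label have equal or adjacent targets. -/
theorem IsEdgeSorting.target_succ_le [LinearOrder α] (hS : IsEdgeSorting A code idx m U V Lb)
    (hA : IsWheelerNFA A le) (hcode : Function.Injective code) (hidx : IsNumbering le n idx) {k : ℕ}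
    (hk : k + 1 < m) (hl : Lb k = Lb (k + 1)) : V (k + 1) ≤ V k + 1 := by
  by_contra! hlt
  have hinj := hidx.injective hA.order
  obtain ⟨x, y, a, he, hUx, hVy, hLa⟩ := hS.edge k (by omega)
  obtain ⟨x', y', a', he', hUx', hVy', hLa'⟩ := hS.edge (k + 1) hk
  obtain rfl : a = a' := hcode (by omega)
  obtain ⟨z, hz⟩ := hidx.surj (V k + 1) (hlt.trans (hVy' ▸ hidx.lt y'))
  have hyz : le y z := (hidx.le_iff _ _).2 (by omega)
  have hyz' : y ≠ z := fun h => by subst h; omega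
  have hzy : le z y' := (hidx.le_iff _ _).2 (by omega)
  have hzy' : z ≠ y' := fun h => by subst h; omega
  -- The state `z` lies strictly between the two targets. Axiom 2 squeezes the label of an edge into
  -- `z` from both sides, so this edge would have to be listed strictly between the positions `k`
  -- and `k + 1`.
  obtain ⟨w, b, hb⟩ := hA.exists_edge hyz hyz'
  obtain rfl : a = b := le_antisymm (hA.axiom2 _ _ _ _ _ _ he hb hyz hyz')
    (hA.axiom2 _ _ _ _ _ _ hb he' hzy hzy')
  obtain ⟨p, hp, -, hVp, hLp⟩ := hS.exists_index _ _ _ hb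
  rcases Nat.lt_or_ge k p with h | h
  · have := (hS.mono (k + 1) p h hp (by omega)).2
    omega
  · have := (hS.mono p k h (by omega) (by omega)).2
    omega

/-- No two pairs of consecutive edges trigger a rule at the same position. -/
theorem IsEdgeSorting.rule_unique [LinearOrder α] (hS : IsEdgeSorting A code idx m U V Lb)
    (hA : IsWheelerNFA A le) (hcode : Function.Injective code) (hidx : IsNumbering le n idx)
    {k k' : ℕ} (hk : k + 1 < m) (hk' : k' + 1 < m) (hl : Lb k = Lb (k + 1))
    (hl' : Lb k' = Lb (k' + 1)) (hv : V k ≠ V (k + 1)) (hv' : V k' ≠ V (k' + 1))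
    (h : V (k + 1) = V (k' + 1)) : k = k' := by
  obtain ⟨x, y, a, he, -, hVy, hLa⟩ := hS.edge k (by omega)
  obtain ⟨x₁, y₁, a₁, he₁, -, hVy₁, hLa₁⟩ := hS.edge (k + 1) hk
  obtain ⟨x', y', b, he', -, hVy', hLb⟩ := hS.edge k' (by omega)
  obtain ⟨x₁', y₁', b₁, he₁', -, hVy₁', hLb₁⟩ := hS.edge (k' + 1) hk'
  obtain rfl : a = a₁ := hcode (by omega)
  obtain rfl : b = b₁ := hcode (by omega)
  have h1 := (hS.mono k (k + 1) (by omega) hk hl).2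
  have h2 := (hS.mono k' (k' + 1) (by omega) hk' hl').2
  -- Each pair has its first target strictly below the common second target, so axiom 2 compares the
  -- labels in both directions. Within one label the targets can rise to a given value only once.
  obtain rfl : a = b := by
    apply le_antisymm
    · exact hA.axiom2 _ _ _ _ _ _ he he₁' ((hidx.le_iff _ _).2 (by omega))
        (fun h => by subst h; omega)
    · exact hA.axiom2 _ _ _ _ _ _ he' he₁ ((hidx.le_iff _ _).2 (by omega))
        (fun h => by subst h; omega)
  rcases Nat.lt_trichotomy k k' with hlt | rfl | hlt
  · have := (hS.mono (k + 1) k' hlt (by omega) (by omega)).2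
    omega
  · rfl
  · have := (hS.mono (k' + 1) k hlt (by omega) (by omega)).2
    omega

/-! ### Marked positions separate classes -/

section Sound

variable [LinearOrder α]

/-- Successors of two distinct equivalent states by the same label are equivalent. -/
theorem IsWheelerNFA.succ_equiv (hA : IsWheelerNFA A le) {x y v w : Q} {a : α}
    (h : maxAutobisim A le x y) (hne : x ≠ y) (hv : (x, v, a) ∈ A.E) (hw : (y, w, a) ∈ A.E) :
    maxAutobisim A le v w := by
  have := hA.finite
  have e := equivalence_maxAutobisim A le
  have hb := (isWheelerAutobisimulation_maxAutobisim A le).wheeler.bisimulation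
  wlog hxy : le x y generalizing x y v w
  · exact e.symm (this (e.symm h) hne.symm hw hv ((hA.order.total x y).resolve_left hxy))
  -- By axiom 3, all successors of `x` by `a` lie below all successors of `y` by `a`.
  have hle : ∀ v w, (x, v, a) ∈ A.E → (y, w, a) ∈ A.E → le v w := by
    intro v w hv hw
    rcases hA.order.total v w with h1 | h1
    · exact h1
    by_cases h2 : w = v
    · exact h2 ▸ hA.order.refl w
    · exact absurd (hA.order.antisymm _ _ hxy (hA.axiom3 _ _ _ _ _ hw hv h1 h2)) hne
  obtain ⟨w₁, hvw, hw₁⟩ := hb.forth x v y a h hv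
  obtain ⟨v₁, hwv, hv₁⟩ := hb.back x y w a h hw
  -- With `v ≡ w₁` and `v₁ ≡ w`, the larger of `v`, `v₁` lies between the smaller one and its
  -- partner among the successors of `y`. Convexity gives `v ≡ v₁`.
  rcases hA.order.total v v₁ with h1 | h1
  · exact e.trans (isConvex_cls (A := A) hA.order v v v₁ w₁ h1 (hle _ _ hv₁ hw₁) (e.refl v) hvw) hwv
  · exact isConvex_cls (A := A) hA.order v₁ v₁ v w h1 (hle _ _ hv hw) (e.refl v₁) hwv |>
      fun h => e.trans (e.symm h) hwv

/-- Successors by the same label of a state that is not alone in its class are equivalent. -/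
theorem IsWheelerNFA.succ_equiv_self (hA : IsWheelerNFA A le) {x y v v' : Q} {a : α}
    (h : maxAutobisim A le x y) (hne : x ≠ y) (hv : (x, v, a) ∈ A.E) (hv' : (x, v', a) ∈ A.E) :
    maxAutobisim A le v v' := by
  have := hA.finite
  have e := equivalence_maxAutobisim A le
  obtain ⟨w, -, hw⟩ := (isWheelerAutobisimulation_maxAutobisim A le).wheeler.bisimulation.forth
    x v y a h hv
  exact e.trans (hA.succ_equiv h hne hv hw) (e.symm (hA.succ_equiv h hne hv' hw))

/-- Equivalent states have the same outgoing labels. -/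
theorem IsEdgeSorting.exists_index_of_equiv (hS : IsEdgeSorting A code idx m U V Lb)
    (hA : IsWheelerNFA A le) (hidx : IsNumbering le n idx) {x y : Q}
    (h : maxAutobisim A le x y) {k : ℕ} (hk : k < m) (hU : U k = idx x) :
    ∃ k' < m, U k' = idx y ∧ Lb k' = Lb k := by
  have := hA.finite
  obtain ⟨x', v, a, he, hx, -, hL⟩ := hS.edge k hk
  obtain rfl : x = x' := hidx.injective hA.order (by omega)
  obtain ⟨w, -, hw⟩ := (isWheelerAutobisimulation_maxAutobisim A le).wheeler.bisimulation.forth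
    x v y a h he
  obtain ⟨k', hk', h1, -, h2⟩ := hS.exists_index _ _ _ hw
  exact ⟨k', hk', h1, by omega⟩

/-- One of the two neighbours is the source of an edge of the pair, so the other one also has an
edge with this label. Edges with one label are contiguous and ordered by source, so the other edge
of the pair lies between these two and leaves no room for a gap. -/
theorem IsEdgeSorting.no_gap_of_equiv (hS : IsEdgeSorting A code idx m U V Lb)
    (hA : IsWheelerNFA A le) (hidx : IsNumbering le n idx) {x y : Q}
    (h : maxAutobisim A le x y) (hxy : idx y = idx x + 1) {k : ℕ} (hk : k + 1 < m)
    (hy : idx y = U k + 1 ∨ idx y = U (k + 1)) :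
    Lb k = Lb (k + 1) ∧ U (k + 1) ≤ U k + 1 := by
  have := hA.finite
  have e := equivalence_maxAutobisim A le
  rcases hy with hy | hy
  · obtain ⟨k', hk', hU, hL⟩ := hS.exists_index_of_equiv hA hidx h (k := k) (by omega) (by omega)
    have hlt : k < k' := by
      by_contra hn
      have := (hS.mono k' k (by omega) (by omega) hL).1
      omega
    have hL' := hS.contiguous k (k + 1) k' (by omega) hlt hk' hL.symm
    have := (hS.mono (k + 1) k' hlt hk' hL').1
    omega
  · obtain ⟨k', hk', hU, hL⟩ := hS.exists_index_of_equiv hA hidx (e.symm h) (k := k + 1) hk hy.symm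
    have hlt : k' ≤ k := by
      by_contra hn
      have := (hS.mono (k + 1) k' (by omega) (by omega) hL.symm).1
      omega
    have hL' := hS.contiguous k' k (k + 1) hlt (by omega) hk hL
    have := (hS.mono k' k hlt (by omega) (by omega)).1
    omega

/-- Induction on the derivation of the mark. The base rules contradict equal finality or equal sets
of outgoing labels; in the propagation rules, equivalence of the neighbours would make the two
targets equivalent. -/
theorem Marked.not_equiv (hS : IsEdgeSorting A code idx m U V Lb) (hA : IsWheelerNFA A le)
    (hcode : Function.Injective code) (hidx : IsNumbering le n idx)
    (hfb : ∀ x y, fb (idx x) = fb (idx y) ↔ (x ∈ A.F ↔ y ∈ A.F)) {i : ℕ}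
    (hi : Marked n m fb U V Lb i) :
    ∀ x y, idx y = i → idx y = idx x + 1 → ¬ maxAutobisim A le x y := by
  have := hA.finite
  have e := equivalence_maxAutobisim A le
  have hinj := hidx.injective hA.order
  have hm : ∀ x y, idx y = idx x + 1 → 0 < m := by
    intro x y h
    obtain ⟨z, a, he⟩ := hA.exists_edge (x := x) (y := y) ((hidx.le_iff _ _).2 (by omega))
      (fun h' => by subst h'; omega)
    obtain ⟨k, hk, -⟩ := hS.exists_index _ _ _ he
    omega
  have hprop : ∀ k, k + 1 < m → V k ≠ V (k + 1) →
      (∀ v w, idx w = V (k + 1) → idx w = idx v + 1 → ¬ maxAutobisim A le v w) →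
      ∀ x y, (idx y = U k + 1 ∨ idx y = U (k + 1)) → idx y = idx x + 1 →
        ¬ maxAutobisim A le x y := by
    intro k hk hV hvw x y hy hxy h
    have hne : x ≠ y := fun h' => by subst h'; omega
    obtain ⟨hL, hU⟩ := hS.no_gap_of_equiv hA hidx h hxy hk hy
    have hm := hS.mono k (k + 1) (by omega) hk hL
    have hadj := hS.target_succ_le hA hcode hidx hk hL
    obtain ⟨z, v, a, he, hz, hv, ha⟩ := hS.edge k (by omega)
    obtain ⟨z', w, b, he', hz', hw, hb⟩ := hS.edge (k + 1) hk
    obtain rfl : a = b := hcode (by omega)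
    refine hvw v w hw.symm (by omega) ?_
    -- If both edges leave the same state, this state is one of `x`, `y` and has an equivalent
    -- neighbour, so its own two successors are equivalent. Otherwise the sources are exactly `x`
    -- and `y`.
    by_cases hzz : idx z = idx z'
    · obtain rfl : z = z' := hinj hzz
      rcases hy with hy | hy
      · obtain rfl : z = x := hinj (by omega)
        exact hA.succ_equiv_self h hne he he'
      · obtain rfl : z = y := hinj (by omega)
        exact hA.succ_equiv_self (e.symm h) hne.symm he he'
    · obtain rfl : z = x := hinj (by omega)
      obtain rfl : z' = y := hinj (by omega)
      exact hA.succ_equiv h hne he he'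
  induction hi with
  | final i h0 hn hne =>
    intro x y hy hxy h
    apply hne
    rw [show i - 1 = idx x by omega, ← hy]
    exact (hfb x y).2
      ((isWheelerAutobisimulation_maxAutobisim A le).wheeler.bisimulation.final x y h)
  | first _ =>
    intro x y hy hxy h
    obtain ⟨k', hk', hU, hL⟩ := hS.exists_index_of_equiv hA hidx (e.symm h) (hm x y hxy) hy.symm
    have := (hS.mono 0 k' (by omega) hk' hL.symm).1
    omega
  | last _ =>
    intro x y hy hxy h
    have := hm x y hxy
    obtain ⟨k', hk', hU, hL⟩ := hS.exists_index_of_equiv hA hidx h (k := m - 1) (by omega)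
      (by omega)
    have := (hS.mono k' (m - 1) (by omega) (by omega) hL).1
    omega
  | gap_left k hk hgap =>
    intro x y hy hxy h
    have := hS.no_gap_of_equiv hA hidx h hxy hk (.inl hy)
    omega
  | gap_right k hk hgap =>
    intro x y hy hxy h
    have := hS.no_gap_of_equiv hA hidx h hxy hk (.inr hy)
    omega
  | prop_left k hk _ hV _ ih => exact fun x y hy => hprop k hk hV ih x y (.inl hy)
  | prop_right k hk _ hV _ ih => exact fun x y hy => hprop k hk hV ih x y (.inr hy)

end Sound

/-! ### Unseparated states are equivalent -/

section Complete

variable [LinearOrder α]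

/-- The targets are equal or adjacent, and a mark between adjacent ones would have been propagated
to both source positions. -/
theorem IsEdgeSorting.unseparated_target (hS : IsEdgeSorting A code idx m U V Lb)
    (hA : IsWheelerNFA A le) (hcode : Function.Injective code) (hidx : IsNumbering le n idx)
    {k : ℕ} (hk : k + 1 < m) (hL : Lb k = Lb (k + 1))
    (h : ¬ Marked n m fb U V Lb (U k + 1) ∨ ¬ Marked n m fb U V Lb (U (k + 1))) :
    Unseparated (Marked n m fb U V Lb) (V k) (V (k + 1)) := by
  by_cases hV : V k = V (k + 1)
  · rw [hV]
    exact .refl _ _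
  · have h1 := hS.target_succ_le hA hcode hidx hk hL
    have h2 := (hS.mono k (k + 1) (by omega) hk hL).2
    have h3 : V (k + 1) = V k + 1 := by omega
    have h4 : ¬ Marked n m fb U V Lb (V (k + 1)) := fun h' =>
      h.elim (fun h => h (.prop_left k hk hL hV h')) (fun h => h (.prop_right k hk hL hV h'))
    rw [h3] at h4 ⊢
    exact unseparated_succ h4

/-- Walk right in the edge list until the source changes. The missing mark excludes the end of the
list (`last`) and gaps (`gap_left`), so the label stays the same and the new source is the next
state; along the way targets stay unseparated. -/
theorem IsEdgeSorting.exists_index_up (hS : IsEdgeSorting A code idx m U V Lb)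
    (hA : IsWheelerNFA A le) (hcode : Function.Injective code) (hidx : IsNumbering le n idx)
    {k : ℕ} (hk : k < m) (h : ¬ Marked n m fb U V Lb (U k + 1)) :
    ∃ p < m, U p = U k + 1 ∧ Lb p = Lb k ∧
      Unseparated (Marked n m fb U V Lb) (V k) (V p) := by
  induction hd : m - k using Nat.strong_induction_on generalizing k with
  | _ d ih =>
    have hk1 : k + 1 < m := by
      by_contra hn
      obtain rfl : k = m - 1 := by omega
      exact h (.last (by omega))
    have hgap : Lb k = Lb (k + 1) ∧ U (k + 1) ≤ U k + 1 := by
      by_contra hn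
      exact h (.gap_left k hk1 (by omega))
    have hsep := hS.unseparated_target hA hcode hidx hk1 hgap.1 (.inl h)
    have hmono := (hS.mono k (k + 1) (by omega) hk1 hgap.1).1
    by_cases hU : U (k + 1) = U k
    · obtain ⟨p, hp, h1, h2, h3⟩ := ih (m - (k + 1)) (by omega) hk1 (by rwa [hU]) rfl
      exact ⟨p, hp, by omega, by omega, hsep.trans h3⟩
    · exact ⟨k + 1, hk1, by omega, hgap.1.symm, hsep⟩

/-- The mirror image of `exists_index_up`, with `first` and `gap_right`. -/
theorem IsEdgeSorting.exists_index_down (hS : IsEdgeSorting A code idx m U V Lb)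
    (hA : IsWheelerNFA A le) (hcode : Function.Injective code) (hidx : IsNumbering le n idx)
    {k : ℕ} (hk : k < m) (h : ¬ Marked n m fb U V Lb (U k)) :
    ∃ p < m, U p + 1 = U k ∧ Lb p = Lb k ∧
      Unseparated (Marked n m fb U V Lb) (V k) (V p) := by
  induction k with
  | zero => exact absurd (.first hk) h
  | succ k ih =>
    have hgap : Lb k = Lb (k + 1) ∧ U (k + 1) ≤ U k + 1 := by
      by_contra hn
      exact h (.gap_right k hk (by omega))
    have hsep := (hS.unseparated_target hA hcode hidx hk hgap.1 (.inr h)).symm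
    have hmono := (hS.mono k (k + 1) (by omega) hk hgap.1).1
    by_cases hU : U (k + 1) = U k
    · obtain ⟨p, hp, h1, h2, h3⟩ := ih (by omega) (by rwa [hU] at h)
      exact ⟨p, hp, by omega, by omega, hsep.trans h3⟩
    · exact ⟨k, by omega, by omega, hgap.1, hsep⟩

/-- The forward condition of a bisimulation, transported from neighbour to neighbour along the
unmarked interval. -/
theorem IsEdgeSorting.exists_edge_of_unseparated (hS : IsEdgeSorting A code idx m U V Lb)
    (hA : IsWheelerNFA A le) (hcode : Function.Injective code) (hidx : IsNumbering le n idx)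
    {x y v : Q} {a : α} (h : Unseparated (Marked n m fb U V Lb) (idx x) (idx y))
    (he : (x, v, a) ∈ A.E) :
    ∃ w, Unseparated (Marked n m fb U V Lb) (idx v) (idx w) ∧ (y, w, a) ∈ A.E := by
  have key := Unseparated.induct (M := Marked n m fb U V Lb) (n := n)
    (fun i j => ∀ x v a, idx x = i → (x, v, a) ∈ A.E → ∃ y w, idx y = j ∧
      Unseparated (Marked n m fb U V Lb) (idx v) (idx w) ∧ (y, w, a) ∈ A.E)
    (fun i x v a hx he => ⟨x, v, hx, .refl _ _, he⟩) ?_ ?_ ?_ (hidx.lt x) (hidx.lt y) h x v a rfl he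
  · obtain ⟨y', w, hy, hw, he'⟩ := key
    obtain rfl := hidx.injective hA.order hy
    exact ⟨w, hw, he'⟩
  · intro i j k hij hjk x v a hx he
    obtain ⟨y, w, hy, hw, he'⟩ := hij x v a hx he
    obtain ⟨z, u, hz, hu, he''⟩ := hjk y w a hy he'
    exact ⟨z, u, hz, hw.trans hu, he''⟩
  · intro i hi hM x v a hx he
    obtain ⟨k, hk, hU, hV, hL⟩ := hS.exists_index x v a he
    obtain ⟨p, hp, h1, h2, h3⟩ := hS.exists_index_up hA hcode hidx hk (by rwa [hU, hx])
    obtain ⟨y, w, b, he', hy, hw, hb⟩ := hS.edge p hp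
    obtain rfl : a = b := hcode (by omega)
    exact ⟨y, w, by omega, by rwa [← hV, ← hw], he'⟩
  · intro i hi hM x v a hx he
    obtain ⟨k, hk, hU, hV, hL⟩ := hS.exists_index x v a he
    obtain ⟨p, hp, h1, h2, h3⟩ := hS.exists_index_down hA hcode hidx hk (by rwa [hU, hx])
    obtain ⟨y, w, b, he', hy, hw, hb⟩ := hS.edge p hp
    obtain rfl : a = b := hcode (by omega)
    exact ⟨y, w, by omega, by rwa [← hV, ← hw], he'⟩

/-- A point between two image points either lies between their preimages, hence in `C`, or lies
between one of the image points and its preimage, hence is unseparated from that preimage. -/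
theorem isConvex_unseparated (hidx : IsNumbering le n idx) {M : ℕ → Prop} {C : Set Q}
    (hC : IsConvex le C) : IsConvex le {y | ∃ x ∈ C, Unseparated M (idx x) (idx y)} := by
  rintro p q r hpq hqr ⟨c, hc, hcp⟩ ⟨d, hd, hdr⟩
  rw [hidx.le_iff] at hpq hqr
  by_cases h1 : idx c ≤ idx q
  · by_cases h2 : idx q ≤ idx d
    · exact ⟨q, hC c q d ((hidx.le_iff _ _).2 h1) ((hidx.le_iff _ _).2 h2) hc hd, .refl _ _⟩
    · exact ⟨d, hd, hdr.subinterval (by omega) (by omega)⟩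
  · exact ⟨c, hc, hcp.subinterval (by omega) (by omega)⟩

theorem IsEdgeSorting.isWheelerAutobisimulation_unseparated
    (hS : IsEdgeSorting A code idx m U V Lb)
    (hA : IsWheelerNFA A le) (hcode : Function.Injective code) (hidx : IsNumbering le n idx)
    (hfb : ∀ x y, fb (idx x) = fb (idx y) ↔ (x ∈ A.F ↔ y ∈ A.F)) :
    IsWheelerAutobisimulation A le
      (fun x y => Unseparated (Marked n m fb U V Lb) (idx x) (idx y)) where
  refl x := .refl _ _
  wheeler :=
    { bisimulation :=
        { forth := fun x v y a h he => hS.exists_edge_of_unseparated hA hcode hidx h he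
          back := by
            intro x y w a h he
            obtain ⟨v, hv, he'⟩ := hS.exists_edge_of_unseparated hA hcode hidx h.symm he
            exact ⟨v, hv.symm, he'⟩
          start := .refl _ _
          final := by
            intro x y h
            rw [← hfb]
            exact Unseparated.induct (n := n) (fun i j => fb i = fb j) (fun _ => rfl)
              (fun _ _ _ h h' => h.trans h')
              (fun i hi hM => by
                by_contra hne
                exact hM (.final _ (by omega) hi hne))
              (fun i hi hM => by
                by_contra hne
                exact hM (.final _ (by omega) hi (Ne.symm hne)))
              (hidx.lt x) (hidx.lt y) h }
      image_convex := fun C hC => isConvex_unseparated hidx hC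
      preimage_convex := by
        intro C hC
        convert isConvex_unseparated (M := Marked n m fb U V Lb) hidx hC using 1
        ext x
        exact ⟨fun ⟨y, hy, h⟩ => ⟨y, hy, h.symm⟩, fun ⟨y, hy, h⟩ => ⟨y, hy, h.symm⟩⟩ }

theorem IsEdgeSorting.maxAutobisim_iff (hS : IsEdgeSorting A code idx m U V Lb)
    (hA : IsWheelerNFA A le) (hcode : Function.Injective code) (hidx : IsNumbering le n idx)
    (hfb : ∀ x y, fb (idx x) = fb (idx y) ↔ (x ∈ A.F ↔ y ∈ A.F)) {x y : Q} :
    maxAutobisim A le x y ↔ Unseparated (Marked n m fb U V Lb) (idx x) (idx y) := by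
  have := hA.finite
  have e := equivalence_maxAutobisim A le
  constructor
  · intro h l h1 h2 hl
    wlog hxy : idx x ≤ idx y generalizing x y
    · exact this (e.symm h) (by omega) (by omega) (by omega)
    have hlt := hidx.lt y
    obtain ⟨v, hv⟩ := hidx.surj (l - 1) (by omega)
    obtain ⟨w, hw⟩ := hidx.surj l (by omega)
    -- By convexity the class of `x` contains everything from `x` to `y`, in particular the states
    -- on both sides of the mark `l`.
    have hmem : ∀ z, idx x ≤ idx z → idx z ≤ idx y → maxAutobisim A le x z := fun z h3 h4 =>
      isConvex_cls (A := A) hA.order x x z y ((hidx.le_iff _ _).2 h3) ((hidx.le_iff _ _).2 h4)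
        (e.refl x) h
    exact hl.not_equiv hS hA hcode hidx hfb v w hw (by omega)
      (e.trans (e.symm (hmem v (by omega) (by omega))) (hmem w (by omega) (by omega)))
  · exact fun h => ⟨_, hS.isWheelerAutobisimulation_unseparated hA hcode hidx hfb, h⟩

end Complete

end Boundaries

/-! ### Stable counting sort -/

section CountingSort

/-- `O` lists `0, …, m - 1`, sorted by `key`, and in increasing order for each key. -/
structure IsStableSort (key : ℕ → ℕ) (m : ℕ) (O : ℕ → ℕ) : Prop where
  lt : ∀ q < m, O q < m
  exists_eq : ∀ k < m, ∃ q < m, O q = k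
  sorted : ∀ p q, p < q → q < m →
    key (O p) < key (O q) ∨ key (O p) = key (O q) ∧ O p < O q

variable (key : ℕ → ℕ) (m : ℕ)

/-- The position of `k` in the stable order by `key`. -/
def sortPos (k : ℕ) : ℕ :=
  Nat.count (fun j => key j < key k) m + Nat.count (fun j => key j = key k) k

variable {key m}

/-- The recurrence behind the prefix sums. -/
theorem count_lt_succ (c n : ℕ) :
    Nat.count (fun j => key j < c + 1) n =
      Nat.count (fun j => key j < c) n + Nat.count (fun j => key j = c) n := by
  induction n with
  | zero => simp
  | succ n ih =>
    simp only [Nat.count_succ, ih]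
    split_ifs <;> omega

theorem count_eq_lt_count_eq {k n : ℕ} (h : k < n) :
    Nat.count (fun j => key j = key k) k < Nat.count (fun j => key j = key k) n :=
  Nat.count_strict_mono (p := fun j => key j = key k) rfl h

theorem sortPos_lt_count {k : ℕ} (h : k < m) :
    sortPos key m k < Nat.count (fun j => key j < key k + 1) m := by
  rw [count_lt_succ, sortPos]
  have := count_eq_lt_count_eq (key := key) h
  omega

theorem sortPos_lt {k : ℕ} (h : k < m) : sortPos key m k < m :=
  (sortPos_lt_count h).trans_le (Nat.count_le _)

theorem sortPos_lt_sortPos {j k : ℕ} (hj : j < m)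
    (h : key j < key k ∨ key j = key k ∧ j < k) : sortPos key m j < sortPos key m k := by
  rcases h with h | ⟨h, hjk⟩
  · calc sortPos key m j < Nat.count (fun i => key i < key j + 1) m := sortPos_lt_count hj
      _ ≤ Nat.count (fun i => key i < key k) m :=
        Nat.count_mono_left (fun i hi => by omega)
      _ ≤ sortPos key m k := Nat.le_add_right _ _
  · have := count_eq_lt_count_eq (key := key) hjk
    simp only [sortPos, h] at this ⊢
    omega

theorem sortPos_injOn {j k : ℕ} (hj : j < m) (hk : k < m)
    (h : sortPos key m j = sortPos key m k) : j = k := by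
  by_contra hne
  rcases Nat.lt_trichotomy (key j) (key k) with h1 | h1 | h1
  · exact (sortPos_lt_sortPos hj (.inl h1)).ne h
  · rcases Nat.lt_or_gt_of_ne hne with h2 | h2
    · exact (sortPos_lt_sortPos hj (.inr ⟨h1, h2⟩)).ne h
    · exact (sortPos_lt_sortPos hk (.inr ⟨h1.symm, h2⟩)).ne h.symm
  · exact (sortPos_lt_sortPos hk (.inl h1)).ne h.symm

/-- `sortPos` is an injective map of `0, …, m - 1` into itself, hence a permutation, and `O` is its
inverse. -/
theorem isStableSort_of_sortPos {O : ℕ → ℕ} (hO : ∀ k < m, O (sortPos key m k) = k) :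
    IsStableSort key m O := by
  have hsurj : ∀ q < m, ∃ k < m, sortPos key m k = q := by
    let f : Fin m → Fin m := fun k => ⟨sortPos key m k, sortPos_lt k.2⟩
    have hf : Function.Injective f := fun j k h =>
      Fin.ext (sortPos_injOn j.2 k.2 (congrArg Fin.val h))
    intro q hq
    obtain ⟨k, hk⟩ := (Finite.injective_iff_surjective.1 hf) ⟨q, hq⟩
    exact ⟨k, k.2, congrArg Fin.val hk⟩
  refine ⟨fun q hq => ?_, fun k hk => ⟨_, sortPos_lt hk, hO k hk⟩, fun p q hpq hq => ?_⟩
  · obtain ⟨k, hk, rfl⟩ := hsurj q hq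
    rwa [hO k hk]
  · obtain ⟨j, hj, rfl⟩ := hsurj p (hpq.trans hq)
    obtain ⟨k, hk, rfl⟩ := hsurj q hq
    rw [hO j hj, hO k hk]
    by_contra hn
    rcases eq_or_ne j k with rfl | hne
    · exact lt_irrefl _ hpq
    · exact (sortPos_lt_sortPos hk (j := k) (k := j) (by omega)).not_gt hpq

/-- Counting sort: writes the stable order of the keys in array `K` to array `O`, using the
(initially zero) array `Cn`. -/
def Prog.countingSort (K Cn O : ℕ) : Prog :=
  .seq (forLoop 1
    (.write Cn (.bin .add (.read K (.reg 3)) (.lit 1))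
      (.bin .add (.read Cn (.bin .add (.read K (.reg 3)) (.lit 1))) (.lit 1)))) <|
  .seq (.assign 4 (.bin .add (.bin .add (.reg 1) (.reg 1)) (.lit 1))) <|
  .seq (forLoop 4
    (.write Cn (.bin .add (.reg 3) (.lit 1))
      (.bin .add (.read Cn (.bin .add (.reg 3) (.lit 1))) (.read Cn (.reg 3))))) <|
  forLoop 1
    (.seq (.write O (.read Cn (.read K (.reg 3))) (.reg 3))
      (.write Cn (.read K (.reg 3)) (.bin .add (.read Cn (.read K (.reg 3))) (.lit 1))))

theorem Prog.reaches_countingSort {K Cn O W : ℕ} (hKC : K ≠ Cn) (hKO : K ≠ O) (hCO : Cn ≠ O)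
    (hW : 20 * (m + 1) ≤ W) {σ : State} (hσ : σ.Bounded W) (hm : σ.reg 1 = m)
    (hC : ∀ c, σ.mem Cn c = 0) (hK : ∀ k < m, σ.mem K k = key k) (hkey : ∀ k < m, key k ≤ 2 * m) :
    (countingSort K Cn O).Reaches W (200 * (m + 1)) σ
      (fun τ => IsStableSort key m (τ.mem O)) := by
  have hW1 : 1 ≤ W := by omega
  have hcount : ∀ c k, Nat.count (fun j => key j = c) k ≤ k := fun _ _ => Nat.count_le _
  have hcount' : ∀ c k, Nat.count (fun j => key j < c) k ≤ k := fun _ _ => Nat.count_le _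
  -- The frequency of key `c` is stored in cell `c + 1`, so that summation in place leaves in cell
  -- `c` the number of keys below `c`.
  have h1 := (reaches_forLoop (N := 1) (body := .write Cn (.bin .add (.read K (.reg 3)) (.lit 1))
      (.bin .add (.read Cn (.bin .add (.read K (.reg 3)) (.lit 1))) (.lit 1)))
      (by decide) rfl rfl hW1
      (fun k τ => τ.mem Cn 0 = 0 ∧ ∀ c, τ.mem Cn (c + 1) = Nat.count (fun j => key j = c) k)
      hσ hm (by simp [State.setReg, hC]) (by
        rintro k hk ρ hρ hf h3 ⟨h0, hI⟩
        have hKk : ρ.mem K k = key k := by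
          rw [hf.mem K (by simp [forLoop, Prog.wMem, hKC.symm]), hK k hk]
        have := hkey k hk
        have := hcount (key k) k
        simp [Safe, run, Expr.Ok, Expr.eval, Op.eval, h3, hKk, State.setMem, State.setReg,
          Function.update_apply, h0, hI, Nat.count_succ]
        refine ⟨⟨by omega, by omega⟩, fun c => ?_⟩
        by_cases h : c = key k
        · simp [h]
        · simp [h, Ne.symm h])).with_frame hσ
  refine (h1.seq (T' := 100 * (m + 1)) ?_).mono ?_ fun _ h => h
  swap
  · simp only [cost, Expr.cost]
    omega
  rintro σ₁ ⟨⟨hz₁, hc₁⟩, hσ₁, hf₁⟩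
  have hm₁ : σ₁.reg 1 = m := (hf₁.reg 1 rfl).trans hm
  have hK₁ : ∀ k < m, σ₁.mem K k = key k := by
    rw [hf₁.mem K (by simp [forLoop, Prog.wMem, hKC.symm])]
    exact hK
  -- Keys are at most `2 * m`, so there are `2 * m + 1` possible keys.
  have h2 := (Safe.reaches (p := .assign 4 (.bin .add (.bin .add (.reg 1) (.reg 1)) (.lit 1)))
    hW1 (Φ := fun τ => τ.reg 4 = 2 * m + 1 ∧ τ.reg 1 = m ∧ τ.mem = σ₁.mem) (by
      simp [Safe, Expr.Ok, Expr.eval, Op.eval, hm₁]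
      omega) hσ₁ (by
      simp [run, Expr.eval, Op.eval, hm₁, State.setReg, two_mul])).with_frame hσ₁
  refine (h2.seq (T' := 90 * (m + 1)) ?_).mono ?_ fun _ h => h
  swap
  · simp only [cost, Expr.cost]
    omega
  rintro σ₂ ⟨⟨h4₂, hm₂, hmem₂⟩, hσ₂, -⟩
  have h3 := (reaches_forLoop (N := 4) (body := .write Cn (.bin .add (.reg 3) (.lit 1))
      (.bin .add (.read Cn (.bin .add (.reg 3) (.lit 1))) (.read Cn (.reg 3))))
      (by decide) rfl rfl hW1
      (fun c τ => (∀ d ≤ c, τ.mem Cn d = Nat.count (fun j => key j < d) m) ∧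
        ∀ d, c ≤ d → τ.mem Cn (d + 1) = Nat.count (fun j => key j = d) m)
      hσ₂ h4₂ (by simp [State.setReg, hmem₂, hz₁, hc₁]) (by
        rintro c hc ρ hρ - h3 ⟨h0, hI⟩
        have e1 := h0 c le_rfl
        have e2 := hI c le_rfl
        have := count_lt_succ (key := key) c m
        have := hcount' (c + 1) m
        simp only [Safe, run, Expr.Ok, Expr.eval, Op.eval, h3, State.setMem, State.setReg,
          Function.update_apply, if_true, e1, e2]
        refine ⟨⟨⟨trivial, by omega, by omega⟩, ⟨trivial, by omega, by omega⟩, trivial, by omega⟩,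
          fun d hd => ?_, fun d hd => ?_⟩
        · split_ifs with h
          · subst h
            omega
          · exact h0 d (by omega)
        · rw [if_neg (by omega)]
          exact hI d (by omega))).with_frame hσ₂
  refine (h3.seq (T' := 40 * (m + 1)) ?_).mono ?_ fun _ h => h
  swap
  · simp only [cost, Expr.cost]
    omega
  rintro σ₃ ⟨⟨hc₃, -⟩, hσ₃, hf₃⟩
  have hm₃ : σ₃.reg 1 = m := (hf₃.reg 1 rfl).trans hm₂
  have hK₃ : ∀ k < m, σ₃.mem K k = key k := by
    rw [hf₃.mem K (by simp [forLoop, Prog.wMem, hKC.symm]), hmem₂]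
    exact hK₁
  -- Cell `c` is now the next free position for key `c`; for the current `k` it equals `sortPos key
  -- m k`.
  have h4 := (reaches_forLoop (N := 1)
      (body := (.seq (.write O (.read Cn (.read K (.reg 3))) (.reg 3))
        (.write Cn (.read K (.reg 3)) (.bin .add (.read Cn (.read K (.reg 3))) (.lit 1)))))
      (by decide) rfl rfl hW1
      (fun k τ => (∀ c ≤ 2 * m, τ.mem Cn c =
          Nat.count (fun j => key j < c) m + Nat.count (fun j => key j = c) k) ∧
        ∀ j < k, τ.mem O (sortPos key m j) = j)
      hσ₃ hm₃ (by
        simp only [State.setReg, Nat.count_zero]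
        exact ⟨fun c hc => hc₃ c (by omega), by simp⟩) (by
        rintro k hk ρ hρ hf h3 ⟨h0, hI⟩
        have hKk : ρ.mem K k = key k := by
          rw [hf.mem K (by simp [forLoop, Prog.wMem, hKC.symm, hKO.symm]), hK₃ k hk]
        have e1 : ρ.mem Cn (key k) = sortPos key m k := h0 _ (hkey k hk)
        have hp := sortPos_lt (key := key) hk
        simp only [Safe, run, Expr.Ok, Expr.eval, Op.eval, h3, State.setMem, State.setReg,
          Function.update_apply, hKk, hKO, hCO, hCO.symm, if_false, e1,
          if_true]
        refine ⟨⟨⟨trivial, trivial⟩, trivial, trivial, by omega, by omega⟩, fun c hc => ?_,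
          fun j hj => ?_⟩
        · rw [Nat.count_succ]
          split_ifs with h1 h2 h2
          · subst h1
            simp only [sortPos]
            omega
          · exact absurd h1.symm h2
          · exact absurd h2.symm h1
          · simpa using h0 c hc
        · split_ifs with h
          · exact (sortPos_injOn (by omega) hk h).symm
          · refine hI j ?_
            have : j ≠ k := fun h' => h (by rw [h'])
            omega))
  refine h4.mono ?_ fun τ h => isStableSort_of_sortPos h.2
  simp only [cost, Expr.cost]
  omega

end CountingSort

/-! ### Sorting the edges of a Wheeler automaton in linear time -/

section SortEdges

variable {Q : Type u} {α : Type v} {A : Automaton Q α} {le : Q → Q → Prop} {code : α → ℕ}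
  {idx : Q → ℕ} {L : List (Q × Q × α)}

/-- Sorting by the sum of source and target, and then by labels, sorts the edges of a Wheeler
automaton. -/
theorem isEdgeSorting_of_isStableSort [LinearOrder α] {n : ℕ} (hA : IsWheelerNFA A le)
    (hcode : Function.Injective code) (hidx : IsNumbering le n idx)
    (hL : ∀ e, e ∈ L ↔ e ∈ A.E) {src tgt lab rk O₁ O₂ : ℕ → ℕ}
    (hsrc : ∀ (k : ℕ) (hk : k < L.length), src k = idx L[k].1)
    (htgt : ∀ (k : ℕ) (hk : k < L.length), tgt k = idx L[k].2.1)
    (hlab : ∀ (k : ℕ) (hk : k < L.length), lab k = code L[k].2.2)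
    (hrk : ∀ j < L.length, ∀ k < L.length, rk (lab j) = rk (lab k) → lab j = lab k)
    (h₁ : IsStableSort (fun k => src k + tgt k) L.length O₁)
    (h₂ : IsStableSort (fun p => rk (lab (O₁ p))) L.length O₂) :
    IsEdgeSorting A code idx L.length (fun q => src (O₁ (O₂ q))) (fun q => tgt (O₁ (O₂ q)))
      (fun q => lab (O₁ (O₂ q))) where
  edge q hq := by
    have hk := h₁.lt _ (h₂.lt q hq)
    exact ⟨_, _, _, (hL _).1 (L.getElem_mem hk), hsrc _ hk, htgt _ hk, hlab _ hk⟩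
  exists_index x y a he := by
    obtain ⟨k, hk, hLk⟩ := List.getElem_of_mem ((hL _).2 he)
    obtain ⟨p, hp, rfl⟩ := h₁.exists_eq k hk
    obtain ⟨q, hq, rfl⟩ := h₂.exists_eq p hp
    refine ⟨q, hq, ?_⟩
    simp only [hsrc _ hk, htgt _ hk, hlab _ hk, hLk, and_self]
  mono p q hpq hq hl := by
    rcases hpq.eq_or_lt with rfl | hlt
    · exact ⟨le_rfl, le_rfl⟩
    have hp₂ := h₂.lt p (by omega)
    have hq₂ := h₂.lt q hq
    have hp₁ := h₁.lt _ hp₂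
    have hq₁ := h₁.lt _ hq₂
    have hsort : O₂ p < O₂ q := by
      rcases h₂.sorted p q hlt hq with h | h
      · rw [hl] at h
        exact absurd h (lt_irrefl _)
      · exact h.2
    have hsum : src (O₁ (O₂ p)) + tgt (O₁ (O₂ p)) ≤ src (O₁ (O₂ q)) + tgt (O₁ (O₂ q)) := by
      rcases h₁.sorted _ _ hsort hq₂ with h | h
      · exact h.le
      · exact h.1.le
    -- By axiom 3 two edges with one label cannot be ordered strictly oppositely by source and
    -- target, so comparing the sums compares both coordinates.
    have hcmp : ∀ j k, (hj : j < L.length) → (hk : k < L.length) → lab j = lab k →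
        tgt j < tgt k → src j ≤ src k := by
      intro j k hj hk h ht
      rw [htgt j hj, htgt k hk] at ht
      rw [hlab j hj, hlab k hk] at h
      rw [hsrc j hj, hsrc k hk, ← hidx.le_iff]
      have hej := (hL _).1 (L.getElem_mem hj)
      have hek : (L[k].1, L[k].2.1, L[j].2.2) ∈ A.E := by
        rw [hcode h]
        exact (hL _).1 (L.getElem_mem hk)
      refine hA.axiom3 _ _ _ _ _ hej hek ((hidx.le_iff _ _).2 ht.le)
        fun (h : L[j].2.1 = L[k].2.1) => ?_
      rw [h] at ht
      exact lt_irrefl _ ht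
    have hpq' := hcmp _ _ hp₁ hq₁ hl
    have hqp' := hcmp _ _ hq₁ hp₁ hl.symm
    omega
  contiguous p r q hpr hrq hq hl := by
    have hmono : ∀ i j, i ≤ j → j < L.length →
        rk (lab (O₁ (O₂ i))) ≤ rk (lab (O₁ (O₂ j))) := by
      intro i j hij hj
      rcases hij.eq_or_lt with rfl | hlt
      · exact le_rfl
      · rcases h₂.sorted i j hlt hj with h | h
        · exact h.le
        · exact h.1.le
    refine hrk _ (h₁.lt _ (h₂.lt r (by omega))) _ (h₁.lt _ (h₂.lt q hq)) (le_antisymm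
      (hmono r q hrq hq) ?_)
    rw [← hl]
    exact hmono p r hpr (by omega)

namespace Prog

/-- Copies the labels to array `20` and sorts them by means of `S`. -/
def sortLabels (S : Prog) : Prog :=
  .seq (forLoop 1 (.write 20 (.reg 3) (.read 2 (.reg 3)))) <|
  .seq (.assign 20 (.reg 1)) (S.shift 20)

/-- Numbers the labels by their (last) positions in the sorted list. -/
def rankLabels : Prog := forLoop 1 (.write 6 (.read 20 (.reg 3)) (.reg 3))

/-- Writes the sorted edges to arrays `13`, `14` and `15`. -/
def arrangeEdges : Prog :=
  .seq (forLoop 1 (.write 7 (.reg 3) (.bin .add (.read 0 (.reg 3)) (.read 1 (.reg 3))))) <|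
  .seq (countingSort 7 8 9) <|
  .seq (forLoop 1 (.write 10 (.reg 3) (.read 6 (.read 2 (.read 9 (.reg 3)))))) <|
  .seq (countingSort 10 11 12) <|
  .seq (forLoop 1 (.write 13 (.reg 3) (.read 0 (.read 9 (.read 12 (.reg 3)))))) <|
  .seq (forLoop 1 (.write 14 (.reg 3) (.read 1 (.read 9 (.read 12 (.reg 3)))))) <|
  forLoop 1 (.write 15 (.reg 3) (.read 2 (.read 9 (.read 12 (.reg 3)))))

def sortEdges (S : Prog) : Prog := .seq (sortLabels S) (.seq rankLabels arrangeEdges)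

theorem reaches_sortLabels {S : Prog} {m W W' T : ℕ} {l ls : List ℕ} {lab : ℕ → ℕ} {σ : State}
    (hW : 20 * (W + 1) ≤ W') (hσ : σ.Bounded W') (hm : σ.reg 1 = m) (hlm : l.length = m)
    (hlab : σ.mem 2 = lab) (hl : ∀ (k : ℕ) (hk : k < l.length), lab k = l[k])
    (hreg : ∀ r, 3 ≤ r → σ.reg r = 0) (hmem : ∀ a k, 4 ≤ a → σ.mem a k = 0)
    {ρ : State} (hS : S.RunsTo W T (listState l) ρ)
    (hρ : ∀ (k : ℕ) (hk : k < ls.length), ρ.mem 0 k = ls[k]) :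
    (sortLabels S).Reaches W' (T + 30 * (m + 1)) σ
      (fun τ => ∀ (k : ℕ) (hk : k < ls.length), τ.mem 20 k = ls[k]) := by
  obtain ⟨hb, t, ht, hex⟩ := hS
  have hW1 : 1 ≤ W' := by omega
  have h1 := (reaches_fill (N := 1) (a := 20) (e := .read 2 (.reg 3)) (by decide) hW1 lab hσ hm
    (by
      intro k hk τ hτ hr hmem h3
      refine ⟨trivial, ?_⟩
      simp only [Expr.eval, h3, hmem 2 (by decide), hlab])).with_frame hσ
  refine (h1.seq (T' := T + 5) ?_).mono ?_ fun _ h => h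
  swap
  · simp only [Expr.cost]
    omega
  rintro σ₁ ⟨⟨hlo, hhi⟩, hσ₁, hf₁⟩
  have hm₁ : σ₁.reg 1 = m := (hf₁.reg 1 rfl).trans hm
  have hσ₁' : (σ₁.setReg 20 m).Bounded W' := hσ₁.setReg 20 (hm₁ ▸ hσ₁.1 1)
  have hex₁ : Exec W' (.assign 20 (.reg 1)) σ₁ 2 (σ₁.setReg 20 m) := by
    have h : Exec W' (.assign 20 (.reg 1)) σ₁ 2 (σ₁.setReg 20 (Expr.eval σ₁ (.reg 1))) :=
      .assign 20 (.reg 1) σ₁ (hσ₁.1 1)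
    simpa only [Expr.eval, hm₁] using h
  -- Everything numbered from 20 on was zero apart from the copied list and its length, so the
  -- relocated `S` sees exactly its own initial memory.
  have hshift : (listState l).Shifted 20 (σ₁.setReg 20 m) := by
    constructor
    · intro r
      simp only [State.setReg, Function.update_apply, listState, hlm]
      split_ifs with h1 h2 h2
      · rfl
      · omega
      · omega
      · rw [hf₁.reg _ (by simp [forLoop, wReg])]
        exact hreg _ (by omega)
    · intro a
      funext k
      simp only [State.setReg, listState]
      split_ifs with h
      · subst h
        by_cases hk : k < l.length
        · rw [hlo k (by omega), hl k hk, List.getD_eq_getElem _ _ hk]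
        · rw [hhi k (by omega), List.getD_eq_default _ _ (by omega)]
          exact hmem 20 k (by omega)
      · rw [hf₁.mem _ (by simp [forLoop, wMem]; omega)]
        exact hmem _ k (by omega)
  obtain ⟨τ, hτ, hsh⟩ := hex.shift (W' := W') (by omega) hshift
  refine ⟨2 + t, τ, by omega, .seq hex₁ hτ, fun k hk => ?_⟩
  rw [hsh.mem 0, hρ k hk]

/-- Array `6` is addressed by label codes, and repeated labels overwrite their entry. What is kept
is that the rank of a label is some position holding this label; so ranks are below `m` and distinct
labels have distinct ranks. -/
theorem reaches_rankLabels {m W : ℕ} {σ : State} (hW : 20 * (m + 1) ≤ W) (hσ : σ.Bounded W)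
    (hm : σ.reg 1 = m) :
    rankLabels.Reaches W (20 * (m + 1)) σ
      (fun τ => ∀ j < m, ∃ i < m, τ.mem 6 (σ.mem 20 j) = i ∧ σ.mem 20 i = σ.mem 20 j) := by
  have h := reaches_forLoop (N := 1) (body := .write 6 (.read 20 (.reg 3)) (.reg 3)) (by decide)
    rfl rfl (by omega)
    (fun k τ => ∀ j < k, ∃ i < m, τ.mem 6 (σ.mem 20 j) = i ∧ σ.mem 20 i = σ.mem 20 j) hσ hm
    (by simp) (by
      intro k hk ρ hρ hf h3 hI
      refine ⟨⟨trivial, trivial⟩, fun j hj => ?_⟩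
      simp only [run, State.setMem, State.setReg, Expr.eval, h3, Function.update_self,
        Function.update_apply, hf.mem 20 rfl]
      split_ifs with h
      · exact ⟨k, hk, rfl, h.symm⟩
      · refine hI j ?_
        have : j ≠ k := fun h' => h (by rw [h'])
        omega)
  refine h.mono ?_ fun _ h => h
  simp only [cost, Expr.cost]
  omega

theorem reaches_arrangeEdges {m W : ℕ} {src tgt lab rk : ℕ → ℕ} {σ : State}
    (hW : 20 * (m + 1) ≤ W) (hσ : σ.Bounded W)
    (hm : σ.reg 1 = m) (h0 : σ.mem 0 = src) (h1 : σ.mem 1 = tgt) (h2 : σ.mem 2 = lab)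
    (h6 : σ.mem 6 = rk) (h8 : ∀ k, σ.mem 8 k = 0) (h11 : ∀ k, σ.mem 11 k = 0)
    (hsrc : ∀ k < m, src k ≤ m) (htgt : ∀ k < m, tgt k ≤ m) (hrk : ∀ k < m, rk (lab k) ≤ m) :
    arrangeEdges.Reaches W (600 * (m + 1)) σ
      (fun τ => ∃ O₁ O₂, IsStableSort (fun k => src k + tgt k) m O₁ ∧
        IsStableSort (fun p => rk (lab (O₁ p))) m O₂ ∧
        (∀ q < m, τ.mem 13 q = src (O₁ (O₂ q))) ∧ (∀ q < m, τ.mem 14 q = tgt (O₁ (O₂ q))) ∧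
        ∀ q < m, τ.mem 15 q = lab (O₁ (O₂ q))) := by
  have hW1 : 1 ≤ W := by omega
  have s1 := (reaches_fill (N := 1) (a := 7) (e := .bin .add (.read 0 (.reg 3)) (.read 1 (.reg 3)))
    (by decide) hW1 (fun k => src k + tgt k) hσ hm (by
      intro k hk τ hτ hr hmem h3
      have := hsrc k hk
      have := htgt k hk
      simp only [Expr.Ok, Expr.eval, Op.eval, h3, hmem 0 (by decide), hmem 1 (by decide), h0, h1]
      exact ⟨⟨trivial, trivial, by omega⟩, trivial⟩)).with_frame hσ
  refine (s1.seq (T' := 580 * (m + 1)) ?_).mono ?_ fun _ h => h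
  swap
  · simp only [Expr.cost]
    omega
  rintro σ₁ ⟨⟨hk₁, -⟩, hσ₁, hf₁⟩
  have s2 := (reaches_countingSort (K := 7) (Cn := 8) (O := 9) (key := fun k => src k + tgt k)
    (by decide) (by decide) (by decide) hW hσ₁ ((hf₁.reg 1 rfl).trans hm)
    (by rwa [hf₁.mem 8 rfl]) hk₁ (fun k hk => by
      have := hsrc k hk
      have := htgt k hk
      omega)).with_frame hσ₁
  refine (s2.seq (T' := 380 * (m + 1)) ?_).mono ?_ fun _ h => h
  swap
  · omega
  rintro σ₂ ⟨hO₁, hσ₂, hf₂⟩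
  have s3 := (reaches_fill (N := 1) (a := 10) (e := .read 6 (.read 2 (.read 9 (.reg 3))))
    (by decide) hW1 (fun k => rk (lab (σ₂.mem 9 k))) hσ₂
    ((hf₂.reg 1 rfl).trans ((hf₁.reg 1 rfl).trans hm)) (by
      intro k hk τ hτ hr hmem h3
      refine ⟨trivial, ?_⟩
      simp only [Expr.eval, h3, hmem 6 (by decide), hmem 2 (by decide), hmem 9 (by decide),
        hf₂.mem 6 rfl, hf₁.mem 6 rfl, hf₂.mem 2 rfl, hf₁.mem 2 rfl, h6, h2])).with_frame hσ₂
  refine (s3.seq (T' := 360 * (m + 1)) ?_).mono ?_ fun _ h => h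
  swap
  · simp only [Expr.cost]
    omega
  rintro σ₃ ⟨⟨hk₃, -⟩, hσ₃, hf₃⟩
  have s4 := (reaches_countingSort (K := 10) (Cn := 11) (O := 12)
    (key := fun k => rk (lab (σ₂.mem 9 k))) (by decide) (by decide) (by decide) hW hσ₃
    ((hf₃.reg 1 rfl).trans ((hf₂.reg 1 rfl).trans ((hf₁.reg 1 rfl).trans hm)))
    (by rwa [hf₃.mem 11 rfl, hf₂.mem 11 rfl, hf₁.mem 11 rfl]) hk₃ (fun k hk => by
      have := hrk _ (hO₁.lt k hk)
      omega)).with_frame hσ₃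
  refine (s4.seq (T' := 150 * (m + 1)) ?_).mono ?_ fun _ h => h
  swap
  · omega
  rintro σ₄ ⟨hO₂, hσ₄, hf₄⟩
  have hm₄ : σ₄.reg 1 = m := by
    rw [hf₄.reg 1 rfl, hf₃.reg 1 rfl, hf₂.reg 1 rfl, hf₁.reg 1 rfl, hm]
  have h9 : σ₄.mem 9 = σ₂.mem 9 := by rw [hf₄.mem 9 rfl, hf₃.mem 9 rfl]
  have h0' : σ₄.mem 0 = src := by
    rw [hf₄.mem 0 rfl, hf₃.mem 0 rfl, hf₂.mem 0 rfl, hf₁.mem 0 rfl, h0]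
  have h1' : σ₄.mem 1 = tgt := by
    rw [hf₄.mem 1 rfl, hf₃.mem 1 rfl, hf₂.mem 1 rfl, hf₁.mem 1 rfl, h1]
  have h2' : σ₄.mem 2 = lab := by
    rw [hf₄.mem 2 rfl, hf₃.mem 2 rfl, hf₂.mem 2 rfl, hf₁.mem 2 rfl, h2]
  have s5 := (reaches_fill (N := 1) (a := 13) (e := .read 0 (.read 9 (.read 12 (.reg 3))))
    (by decide) hW1 (fun k => src (σ₂.mem 9 (σ₄.mem 12 k))) hσ₄ hm₄ (by
      intro k hk τ hτ hr hmem h3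
      refine ⟨trivial, ?_⟩
      simp only [Expr.eval, h3, hmem 0 (by decide), hmem 9 (by decide), hmem 12 (by decide),
        h9, h0'])).with_frame hσ₄
  refine (s5.seq (T' := 100 * (m + 1)) ?_).mono ?_ fun _ h => h
  swap
  · simp only [Expr.cost]
    omega
  rintro σ₅ ⟨⟨hk₅, -⟩, hσ₅, hf₅⟩
  have s6 := (reaches_fill (N := 1) (a := 14) (e := .read 1 (.read 9 (.read 12 (.reg 3))))
    (by decide) hW1 (fun k => tgt (σ₂.mem 9 (σ₄.mem 12 k))) hσ₅ ((hf₅.reg 1 rfl).trans hm₄) (by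
      intro k hk τ hτ hr hmem h3
      refine ⟨trivial, ?_⟩
      simp only [Expr.eval, h3, hmem 1 (by decide), hmem 9 (by decide), hmem 12 (by decide),
        hf₅.mem 1 rfl, hf₅.mem 9 rfl, hf₅.mem 12 rfl, h9, h1'])).with_frame hσ₅
  refine (s6.seq (T' := 50 * (m + 1)) ?_).mono ?_ fun _ h => h
  swap
  · simp only [Expr.cost]
    omega
  rintro σ₆ ⟨⟨hk₆, -⟩, hσ₆, hf₆⟩
  have s7 := (reaches_fill (N := 1) (a := 15) (e := .read 2 (.read 9 (.read 12 (.reg 3))))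
    (by decide) hW1 (fun k => lab (σ₂.mem 9 (σ₄.mem 12 k))) hσ₆
    ((hf₆.reg 1 rfl).trans ((hf₅.reg 1 rfl).trans hm₄)) (by
      intro k hk τ hτ hr hmem h3
      refine ⟨trivial, ?_⟩
      simp only [Expr.eval, h3, hmem 2 (by decide), hmem 9 (by decide), hmem 12 (by decide),
        hf₆.mem 2 rfl, hf₆.mem 9 rfl, hf₆.mem 12 rfl, hf₅.mem 2 rfl, hf₅.mem 9 rfl,
        hf₅.mem 12 rfl, h9, h2'])).with_frame hσ₆
  refine s7.mono ?_ ?_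
  · simp only [Expr.cost]
    omega
  rintro σ₇ ⟨⟨hk₇, -⟩, -, hf₇⟩
  refine ⟨σ₂.mem 9, σ₄.mem 12, hO₁, hO₂, ?_, ?_, hk₇⟩
  · rw [hf₇.mem 13 rfl, hf₆.mem 13 rfl]
    exact hk₅
  · rw [hf₇.mem 14 rfl]
    exact hk₆

/-- What `sortEdges S` leaves unchanged. -/
theorem wMem_sortEdges (S : Prog) {a : ℕ} (ha : a < 6 ∨ 16 ≤ a ∧ a < 20) :
    (sortEdges S).wMem a = false := by
  have h := wMem_shift 20 S (a := a) (by omega)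
  simp only [sortEdges, sortLabels, rankLabels, arrangeEdges, countingSort, forLoop, wMem, h,
    Bool.or_eq_false_iff, beq_eq_false_iff_ne, and_true, true_and]
  omega

theorem wReg_sortEdges (S : Prog) {r : ℕ} (hr : r < 3 ∨ 5 ≤ r ∧ r < 20) :
    (sortEdges S).wReg r = false := by
  have h := wReg_shift 20 S (r := r) (by omega)
  simp only [sortEdges, sortLabels, rankLabels, arrangeEdges, countingSort, forLoop, wReg, h,
    Bool.or_eq_false_iff, beq_eq_false_iff_ne, and_true, true_and]
  omega

end Prog

theorem IsEdgeSorting.congr {m : ℕ} {U V Lb U' V' Lb' : ℕ → ℕ}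
    (h : IsEdgeSorting A code idx m U V Lb) (hU : ∀ k < m, U' k = U k) (hV : ∀ k < m, V' k = V k)
    (hL : ∀ k < m, Lb' k = Lb k) : IsEdgeSorting A code idx m U' V' Lb' where
  edge k hk := by
    rw [hU k hk, hV k hk, hL k hk]
    exact h.edge k hk
  exists_index x y a he := by
    obtain ⟨k, hk, h1⟩ := h.exists_index x y a he
    refine ⟨k, hk, ?_⟩
    rwa [hU k hk, hV k hk, hL k hk]
  mono p q hpq hq hl := by
    have hp : p < m := by omega
    rw [hU p hp, hU q hq, hV p hp, hV q hq]
    exact h.mono p q hpq hq (by rwa [hL p hp, hL q hq] at hl)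
  contiguous p r q hpr hrq hq hl := by
    have hp : p < m := by omega
    have hr : r < m := by omega
    rw [hL r hr, hL q hq]
    exact h.contiguous p r q hpr hrq hq (by rwa [hL p hp, hL q hq] at hl)

/-- Every state other than the initial one is the target of an edge. -/
theorem Holds.states_le [LinearOrder α] {σ : State} (hA : IsWheelerNFA A le)
    (hσ : Holds A le code idx L σ) : σ.reg 0 ≤ L.length + 1 := by
  have hmem : ∀ i < σ.reg 0, i ≠ idx A.s → i ∈ (L.map fun e => idx e.2.1).toFinset := by
    intro i hi hne
    obtain ⟨x, rfl⟩ := hσ.numbering.surj i hi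
    obtain ⟨z, a, he⟩ := hA.exists_edge (hA.axiom1 x) (fun h => hne (by rw [h]))
    rw [List.mem_toFinset, List.mem_map]
    exact ⟨_, (hσ.mem_iff _).2 he, rfl⟩
  have hsub : Finset.range (σ.reg 0) ⊆
      insert (idx A.s) (L.map fun e => idx e.2.1).toFinset := by
    intro i hi
    rw [Finset.mem_range] at hi
    rw [Finset.mem_insert]
    exact or_iff_not_imp_left.2 (hmem i hi)
  have h1 := (Finset.card_le_card hsub).trans (Finset.card_insert_le _ _)
  have h2 := List.toFinset_card_le (L.map fun e => idx e.2.1)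
  rw [Finset.card_range] at h1
  rw [List.length_map] at h2
  omega

theorem Prog.reaches_sortEdges [LinearOrder α] {S : Prog} {σ : State} {W W' T : ℕ}
    (hA : IsWheelerNFA A le) (hcode : Function.Injective code) (hσ : Holds A le code idx L σ)
    (hclean : CleanElsewhere σ) (hS : SortsLabels S W T code (L.map fun e => e.2.2))
    (hW : 20 * (W + 1) ≤ W') (hB : σ.Bounded W') :
    (sortEdges S).Reaches W' (T + 700 * (L.length + 1)) σ
      (fun τ => IsEdgeSorting A code idx L.length (τ.mem 13) (τ.mem 14) (τ.mem 15)) := by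
  obtain ⟨ρ, hrun, ls, hperm, -, hls⟩ := hS
  have hlen : L.length ≤ W := by
    have := hrun.1.1 0
    simpa [listState] using this
  have hlsl : ls.length = L.length := by simpa using hperm.length_eq
  have hn := hσ.states_le hA
  have s1 := (reaches_sortLabels (ls := ls.map code) (lab := σ.mem 2) hW hB hσ.length (by simp) rfl
    (fun k hk => by
      rw [hσ.label k (by simpa using hk)]
      simp) hclean.reg (fun a k => hclean.others a k) hrun (fun k hk => by
        rw [hls k (by simpa using hk)]
        simp)).with_frame hB
  refine (s1.seq (T' := 650 * (L.length + 1)) ?_).mono (by omega) fun _ h => h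
  rintro σ₁ ⟨h20, hB₁, hf₁⟩
  have hmemf : ∀ a, a < 20 → σ₁.mem a = σ.mem a := fun a ha => hf₁.mem a (by
    have := wMem_shift 20 S ha
    simp only [sortLabels, forLoop, wMem, this, Bool.or_eq_false_iff, beq_eq_false_iff_ne, and_true,
      true_and]
    omega)
  have hregf : σ₁.reg 1 = σ.reg 1 := hf₁.reg 1 (by
    have := wReg_shift 20 S (r := 1) (by decide)
    simp [sortLabels, forLoop, wReg, this])
  have hlab : ∀ k < L.length, ∃ j < L.length, σ₁.mem 20 j = σ.mem 2 k := by
    intro k hk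
    have : L[k].2.2 ∈ ls := hperm.mem_iff.2 (List.mem_map.2 ⟨L[k], L.getElem_mem hk, rfl⟩)
    obtain ⟨j, hj, hjk⟩ := List.getElem_of_mem this
    refine ⟨j, by omega, ?_⟩
    rw [h20 j (by simpa using hj), hσ.label k hk]
    simp [hjk]
  have s2 := (reaches_rankLabels (by omega) hB₁ (hregf.trans hσ.length)).with_frame hB₁
  refine (s2.seq (T' := 600 * (L.length + 1)) ?_).mono (by omega) fun _ h => h
  rintro σ₂ ⟨h6, hB₂, hf₂⟩
  have hmemf₂ : ∀ a, a < 20 → a ≠ 6 → σ₂.mem a = σ.mem a := fun a ha h6 => by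
    rw [hf₂.mem a (by simp [rankLabels, forLoop, wMem, h6.symm]), hmemf a ha]
  have hrk : ∀ k < L.length, ∃ i < L.length, σ₂.mem 6 (σ.mem 2 k) = i ∧
      σ₁.mem 20 i = σ.mem 2 k := by
    intro k hk
    obtain ⟨j, hj, hjk⟩ := hlab k hk
    obtain ⟨i, hi, h1, h2⟩ := h6 j hj
    rw [hjk] at h1 h2
    exact ⟨i, hi, h1, h2⟩
  have s3 := reaches_arrangeEdges (m := L.length) (src := σ.mem 0) (tgt := σ.mem 1)
    (lab := σ.mem 2) (rk := σ₂.mem 6) (by omega) hB₂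
    ((hf₂.reg 1 rfl).trans (hregf.trans hσ.length)) (hmemf₂ 0 (by decide) (by decide))
    (hmemf₂ 1 (by decide) (by decide)) (hmemf₂ 2 (by decide) (by decide)) rfl
    (fun k => by rw [hmemf₂ 8 (by decide) (by decide), hclean.others 8 k (by decide)])
    (fun k => by rw [hmemf₂ 11 (by decide) (by decide), hclean.others 11 k (by decide)])
    (fun k hk => by
      rw [hσ.source k hk]
      have := hσ.numbering.lt L[k].1
      omega)
    (fun k hk => by
      rw [hσ.target k hk]
      have := hσ.numbering.lt L[k].2.1
      omega)
    (fun k hk => by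
      obtain ⟨i, hi, h1, -⟩ := hrk k hk
      omega)
  refine s3.mono le_rfl ?_
  rintro τ ⟨O₁, O₂, hO₁, hO₂, h13, h14, h15⟩
  refine (isEdgeSorting_of_isStableSort hA hcode hσ.numbering hσ.mem_iff hσ.source hσ.target
    hσ.label ?_ hO₁ hO₂).congr h13 h14 h15
  intro j hj k hk h
  obtain ⟨i, -, h1, h2⟩ := hrk j hj
  obtain ⟨i', -, h1', h2'⟩ := hrk k hk
  obtain rfl : i = i' := by omega
  rw [← h2, h2']

end SortEdges

/-! ### Computing the marks with a queue -/

section Marking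

theorem Prog.frame_run (p : Prog) (σ : State) : p.Frame σ (p.run σ) := by
  induction p generalizing σ with
  | skip => exact .refl _ _
  | assign r e =>
    refine ⟨fun r' hr => ?_, fun _ _ => rfl⟩
    simp only [Prog.wReg, beq_eq_false_iff_ne] at hr
    simp [Prog.run, State.setReg, hr.symm]
  | write a i e =>
    refine ⟨fun _ _ => rfl, fun a' ha => ?_⟩
    simp only [Prog.wMem, beq_eq_false_iff_ne] at ha
    simp [Prog.run, State.setMem, ha.symm]
  | seq p q ihp ihq =>
    constructor
    · intro r hr
      simp only [Prog.wReg, Bool.or_eq_false_iff] at hr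
      exact ((ihq _).reg r hr.2).trans ((ihp σ).reg r hr.1)
    · intro r hr
      simp only [Prog.wMem, Bool.or_eq_false_iff] at hr
      exact ((ihq _).mem r hr.2).trans ((ihp σ).mem r hr.1)
  | branch e p q ihp ihq =>
    constructor
    · intro r hr
      simp only [Prog.wReg, Bool.or_eq_false_iff] at hr
      simp only [Prog.run]
      split_ifs
      · exact (ihp σ).reg r hr.1
      · exact (ihq σ).reg r hr.2
    · intro r hr
      simp only [Prog.wMem, Bool.or_eq_false_iff] at hr
      simp only [Prog.run]
      split_ifs
      · exact (ihp σ).mem r hr.1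
      · exact (ihq σ).mem r hr.2
  | loop e p _ => exact .refl _ _

namespace Prog

variable {W : ℕ} {σ : State} {p q : Prog} {e : Expr}

theorem run_seq : (seq p q).run σ = q.run (p.run σ) := rfl

theorem run_branch_pos (h : e.eval σ ≠ 0) : (branch e p q).run σ = p.run σ := if_pos h

theorem run_branch_neg (h : e.eval σ = 0) : (branch e p q).run σ = q.run σ :=
  if_neg (not_not.2 h)

theorem Safe.branch_pos (h : e.eval σ ≠ 0) (he : e.Ok W σ) (hp : p.Safe W σ) :
    (branch e p q).Safe W σ := ⟨he, by rwa [if_pos h]⟩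

theorem Safe.branch_neg (h : e.eval σ = 0) (he : e.Ok W σ) (hq : q.Safe W σ) :
    (branch e p q).Safe W σ := ⟨he, by rwa [if_neg (not_not.2 h)]⟩

end Prog

/-- Array `18` is a queue with the distinct entries `l`, array `5` is their bit array, and all
entries are at most `n` and satisfy `M`. -/
structure IsQueue (M : ℕ → Prop) (n : ℕ) (l : List ℕ) (σ : State) : Prop where
  nodup : l.Nodup
  mem : ∀ x ∈ l, M x ∧ x ≤ n
  length : σ.reg 6 = l.length
  entry : ∀ (i : ℕ) (hi : i < l.length), σ.mem 18 i = l[i]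
  bit : ∀ i, σ.mem 5 i = if i ∈ l then 1 else 0

variable {M : ℕ → Prop} {n : ℕ} {l : List ℕ} {σ : State}

/-- This bounds both the addresses used by the queue and the number of rounds of `propagate`.
Position `n` may occur as the position after the last state. -/
theorem IsQueue.length_le (h : IsQueue M n l σ) : l.length ≤ n + 1 := by
  have h1 : l.toFinset ⊆ Finset.range (n + 1) := by
    intro x hx
    have := (h.mem x (List.mem_toFinset.1 hx)).2
    rw [Finset.mem_range]
    omega
  have := Finset.card_le_card h1
  rwa [List.toFinset_card_of_nodup h.nodup, Finset.card_range] at this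

theorem IsQueue.congr (h : IsQueue M n l σ) {τ : State} (h6 : τ.reg 6 = σ.reg 6)
    (h18 : τ.mem 18 = σ.mem 18) (h5 : τ.mem 5 = σ.mem 5) : IsQueue M n l τ :=
  ⟨h.nodup, h.mem, h6.trans h.length, by rw [h18]; exact h.entry, by rw [h5]; exact h.bit⟩

namespace Prog

/-- Appends the value of `e` to the queue unless it is there already. -/
def mark (e : Expr) : Prog :=
  .seq (.assign 7 e) <|
  .branch (.read 5 (.reg 7)) .skip <|
  .seq (.write 5 (.reg 7) (.lit 1)) <|
  .seq (.write 18 (.reg 6) (.reg 7)) (.assign 6 (.bin .add (.reg 6) (.lit 1)))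

/-- The new queue extends the old one, so entries that have been processed keep their places. -/
theorem mark_spec {W x : ℕ} {e : Expr} (hW : n + 2 ≤ W) (hq : IsQueue M n l σ) (hok : e.Ok W σ)
    (he : e.eval σ = x) (hM : M x) (hx : x ≤ n) :
    (mark e).Safe W σ ∧ ∃ l', IsQueue M n l' ((mark e).run σ) ∧ l <+: l' ∧ x ∈ l' := by
  have hlen := hq.length_le
  by_cases hxl : x ∈ l
  · have h5 : σ.mem 5 x = 1 := by rw [hq.bit, if_pos hxl]
    refine ⟨?_, l, ?_, List.prefix_rfl, hxl⟩
    · simp [mark, Safe, run, Expr.Ok, Expr.eval, State.setReg, he, h5, hok]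
    · refine hq.congr ?_ ?_ ?_ <;> simp [mark, run, Expr.eval, State.setReg, he, h5]
  · have h5 : σ.mem 5 x = 0 := by rw [hq.bit, if_neg hxl]
    have hrun : (mark e).run σ = (((σ.setReg 7 x).setMem 5 x 1).setMem 18 l.length x).setReg 6
        (l.length + 1) := by
      simp [mark, run, Expr.eval, Op.eval, State.setReg, State.setMem, he, h5, hq.length]
    refine ⟨?_, l ++ [x], ⟨?_, ?_, ?_, ?_, ?_⟩, List.prefix_append _ _, by simp⟩
    · simp [mark, Safe, run, Expr.Ok, Expr.eval, State.setReg, State.setMem, he, h5, hok,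
        hq.length]
      omega
    · rw [List.nodup_append]
      refine ⟨hq.nodup, List.nodup_singleton x, fun a ha b hb => ?_⟩
      rw [List.mem_singleton] at hb
      rintro rfl
      exact hxl (hb ▸ ha)
    · intro y hy
      rcases List.mem_append.1 hy with h | h
      · exact hq.mem y h
      · rw [List.mem_singleton] at h
        subst h
        exact ⟨hM, hx⟩
    · simp [hrun, State.setReg]
    · intro i hi
      rw [List.length_append, List.length_singleton] at hi
      by_cases hil : i = l.length
      · subst hil
        simp [hrun, State.setReg, State.setMem]
      · have hil' : i < l.length := by omega
        rw [List.getElem_append_left hil', ← hq.entry i hil']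
        simp [hrun, State.setReg, State.setMem, hil]
    · intro i
      have := hq.bit i
      by_cases hi : i = x
      · simp [hrun, State.setReg, State.setMem, hi]
      · simp [hrun, State.setReg, State.setMem, hi, this]

theorem mark_mark_spec {W x y : ℕ} {e f : Expr} (hW : n + 2 ≤ W) (hq : IsQueue M n l σ)
    (hoke : e.Ok W σ) (he : e.eval σ = x) (hMx : M x) (hx : x ≤ n)
    (hokf : f.Ok W ((mark e).run σ)) (hf : f.eval ((mark e).run σ) = y) (hMy : M y) (hy : y ≤ n) :
    (seq (mark e) (mark f)).Safe W σ ∧ ∃ l', IsQueue M n l' ((seq (mark e) (mark f)).run σ) ∧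
      l <+: l' ∧ x ∈ l' ∧ y ∈ l' := by
  obtain ⟨h1, l₁, h2, h3, h4⟩ := mark_spec hW hq hoke he hMx hx
  obtain ⟨h1', l₂, h2', h3', h4'⟩ := mark_spec hW h2 hokf hf hMy hy
  exact ⟨⟨h1, h1'⟩, l₂, h2', h3.trans h3', h3'.subset h4, h4'⟩

/-- Copies the bits of the final states to array `19`, and marks the positions where they change. -/
def markFinal : Prog :=
  forLoop 0 <| .seq (.write 19 (.reg 3) (.read 3 (.reg 3))) <|
    .branch (.bin .eq (.read 3 (.reg 3)) (.read 3 (.bin .sub (.reg 3) (.lit 1)))) .skip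
      (mark (.reg 3))

theorem reaches_markFinal {W : ℕ} {fb : ℕ → ℕ} (hW : n + 2 ≤ W) (hσ : σ.Bounded W)
    (hn : σ.reg 0 = n) (hfb : σ.mem 3 = fb) (hM : ∀ i, 0 < i → i < n → fb (i - 1) ≠ fb i → M i)
    (hq : IsQueue M n l σ) :
    markFinal.Reaches W (100 * (n + 1)) σ (fun τ => (∀ i < n, τ.mem 19 i = fb i) ∧
      ∃ l', IsQueue M n l' τ ∧ l <+: l' ∧ ∀ i < n, 0 < i → fb (i - 1) ≠ fb i → i ∈ l') := by
  refine (reaches_forLoop (by decide) rfl rfl (by omega)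
    (fun k τ => (∀ i < k, τ.mem 19 i = fb i) ∧
      ∃ l', IsQueue M n l' τ ∧ l <+: l' ∧ ∀ i < k, 0 < i → fb (i - 1) ≠ fb i → i ∈ l')
    hσ hn ?_ ?_).mono ?_ fun _ h => h
  · exact ⟨by simp, l, hq.congr rfl rfl rfl, List.prefix_rfl, by simp⟩
  · rintro k hk ρ hρ hf h3 ⟨hc, l', hq', hl, hI⟩
    have hm3 : ρ.mem 3 = fb := (hf.mem 3 rfl).trans hfb
    have hq₁ : IsQueue M n l' ((write 19 (.reg 3) (.read 3 (.reg 3))).run ρ) :=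
      hq'.congr rfl rfl rfl
    have hm3' : ((write 19 (.reg 3) (.read 3 (.reg 3))).run ρ).mem 3 = fb := hm3
    have h3' : ((write 19 (.reg 3) (.read 3 (.reg 3))).run ρ).reg 3 = k := h3
    have hc' : ∀ i < k + 1, ((write 19 (.reg 3) (.read 3 (.reg 3))).run ρ).mem 19 i = fb i := by
      intro i hi
      simp only [run, State.setMem, Expr.eval, h3, hm3, Function.update_self,
        Function.update_apply]
      split_ifs with h
      · rw [h]
      · exact hc i (by omega)
    set ρ' := (write 19 (.reg 3) (.read 3 (.reg 3))).run ρ with hρ'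
    rw [run_seq, ← hρ']
    by_cases h : fb k = fb (k - 1)
    · have hc0 : Expr.eval ρ' (.bin .eq (.read 3 (.reg 3))
          (.read 3 (.bin .sub (.reg 3) (.lit 1)))) ≠ 0 := by
        simp [Expr.eval, Op.eval, h3', hm3', h]
      refine ⟨⟨⟨trivial, trivial⟩, Safe.branch_pos hc0 ⟨trivial, trivial, (by omega : 1 ≤ W)⟩ trivial⟩, ?_⟩
      rw [run_branch_pos hc0]
      refine ⟨hc', l', hq₁.congr rfl rfl rfl, hl, fun i hi hi0 hne => ?_⟩
      have : i ≠ k := by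
        rintro rfl
        exact hne h.symm
      exact hI i (by omega) hi0 hne
    · have hk0 : 0 < k := by
        by_contra hk0
        obtain rfl : k = 0 := by omega
        exact h rfl
      have hc0 : Expr.eval ρ' (.bin .eq (.read 3 (.reg 3))
          (.read 3 (.bin .sub (.reg 3) (.lit 1)))) = 0 := by
        simp [Expr.eval, Op.eval, h3', hm3', h]
      obtain ⟨hs, l₁, hq₂, hl₁, hkl⟩ := mark_spec (e := .reg 3) hW hq₁ trivial h3'
        (hM k hk0 hk (Ne.symm h)) hk.le
      refine ⟨⟨⟨trivial, trivial⟩, Safe.branch_neg hc0 ⟨trivial, trivial, (by omega : 1 ≤ W)⟩ hs⟩, ?_⟩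
      rw [run_branch_neg hc0]
      refine ⟨?_, l₁, hq₂.congr rfl rfl rfl, hl.trans hl₁, fun i hi hi0 hne => ?_⟩
      · change ∀ i < k + 1, ((mark (.reg 3)).run ρ').mem 19 i = fb i
        rw [(frame_run (mark (.reg 3)) ρ').mem 19 rfl]
        exact hc'
      · by_cases hik : i = k
        · exact hik ▸ hkl
        · exact hl₁.subset (hI i (by omega) hi0 hne)
  · simp only [mark, cost, Expr.cost]
    omega

/-- Marks the first and the last source. -/
def markEnds : Prog :=
  .branch (.reg 1) (.seq (mark (.read 13 (.lit 0)))
    (mark (.bin .add (.read 13 (.bin .sub (.reg 1) (.lit 1))) (.lit 1)))) .skip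

theorem reaches_markEnds {W m : ℕ} {U : ℕ → ℕ} (hW : n + 2 ≤ W) (hσ : σ.Bounded W)
    (hm : σ.reg 1 = m) (hU : σ.mem 13 = U) (hUn : ∀ k < m, U k < n)
    (hM : 0 < m → M (U 0) ∧ M (U (m - 1) + 1)) (hq : IsQueue M n l σ) :
    markEnds.Reaches W 100 σ (fun τ => ∃ l', IsQueue M n l' τ ∧ l <+: l' ∧
      (0 < m → U 0 ∈ l' ∧ U (m - 1) + 1 ∈ l')) := by
  rcases Nat.eq_zero_or_pos m with h0 | h0
  · have hm0 : σ.reg 1 = 0 := hm.trans h0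
    refine (Safe.reaches (by omega) (p := markEnds) (σ := σ) ?_ hσ ?_).mono
      (T := markEnds.cost) (by decide) fun _ h => h
    · simp [markEnds, Safe, Expr.Ok, Expr.eval, hm0]
    · simp only [markEnds, run, Expr.eval, hm0]
      exact ⟨l, hq, List.prefix_rfl, fun h => absurd h (by omega)⟩
  · have hf := frame_run (mark (.read 13 (.lit 0))) σ
    have h1 := hUn 0 h0
    have h2 := hUn (m - 1) (by omega)
    obtain ⟨hs, l', hq', hl, hx, hy⟩ := mark_mark_spec (e := .read 13 (.lit 0))
      (f := .bin .add (.read 13 (.bin .sub (.reg 1) (.lit 1))) (.lit 1)) (x := U 0)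
      (y := U (m - 1) + 1) hW hq (Nat.zero_le W) (by simp only [Expr.eval, hU]) (hM h0).1 h1.le
      (by
        simp only [Expr.Ok, Expr.eval, Op.eval, hf.reg 1 rfl, hf.mem 13 rfl, hm, hU]
        exact ⟨⟨trivial, by omega⟩, by omega, by omega⟩)
      (by simp only [Expr.eval, Op.eval, hf.reg 1 rfl, hf.mem 13 rfl, hm, hU])
      (hM h0).2 (by omega)
    have hm0 : Expr.eval σ (.reg 1) ≠ 0 := by
      simp only [Expr.eval]
      omega
    refine (Safe.reaches (by omega) (p := markEnds) (σ := σ) ?_ hσ ?_).mono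
      (T := markEnds.cost) (by decide) fun _ h => h
    · rw [markEnds, Safe, if_pos hm0]
      exact ⟨trivial, hs⟩
    · rw [markEnds, run, if_pos hm0]
      exact ⟨l', hq', hl, fun _ => ⟨hx, hy⟩⟩

/-- The position after the source of the edge before the current one. -/
def afterPrevSource : Expr := .bin .add (.read 13 (.bin .sub (.reg 3) (.lit 1))) (.lit 1)

/-- Tests whether there is a gap between the previous edge and the current one. -/
def gapTest : Expr :=
  .bin .add
    (.bin .sub (.lit 1) (.bin .eq (.read 15 (.bin .sub (.reg 3) (.lit 1))) (.read 15 (.reg 3))))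
    (.bin .lt afterPrevSource (.read 13 (.reg 3)))

/-- Tests whether the previous edge and the current one have the same target. -/
def targetTest : Expr := .bin .eq (.read 14 (.bin .sub (.reg 3) (.lit 1))) (.read 14 (.reg 3))

/-- Compares consecutive edges: marks positions after gaps, and stores in arrays `16` and `17`,
for the target of the second edge, the positions to be marked when this target is marked. -/
def markEdges : Prog :=
  forLoop 1 <|
    .branch (.bin .eq (.reg 3) (.lit 0)) .skip <|
    .branch gapTest (.seq (mark afterPrevSource) (mark (.read 13 (.reg 3)))) <|
    .branch targetTest .skip <|
    .seq (.write 16 (.read 14 (.reg 3)) afterPrevSource)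
      (.write 17 (.read 14 (.reg 3)) (.read 13 (.reg 3)))

end Prog

/-- The edges `j` and `j + 1` have different labels, or a source without this label is skipped. -/
def IsGap (U Lb : ℕ → ℕ) (j : ℕ) : Prop := Lb j ≠ Lb (j + 1) ∨ U j + 1 < U (j + 1)

/-- The edges `j` and `j + 1` give rise to a propagation rule. -/
def IsRule (U V Lb : ℕ → ℕ) (j : ℕ) : Prop := ¬ IsGap U Lb j ∧ V j ≠ V (j + 1)

/-- Arrays `f` and `g` hold the propagation rules of the pairs up to `k`. -/
structure HoldsRules (U V Lb f g : ℕ → ℕ) (k : ℕ) : Prop where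
  left : ∀ j, j + 1 < k → IsRule U V Lb j → f (V (j + 1)) = U j + 1
  right : ∀ j, j + 1 < k → IsRule U V Lb j → g (V (j + 1)) = U (j + 1)
  default : ∀ v, (∃ j, j + 1 < k ∧ IsRule U V Lb j ∧ V (j + 1) = v) ∨ f v = 0 ∧ g v = 0

variable {m : ℕ} {U V Lb f g : ℕ → ℕ}

theorem HoldsRules.succ {k : ℕ} (h : HoldsRules U V Lb f g (k + 1)) (hk : ¬ IsRule U V Lb k) :
    HoldsRules U V Lb f g (k + 1 + 1) := by
  have hlt : ∀ j, j + 1 < k + 1 + 1 → IsRule U V Lb j → j + 1 < k + 1 := by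
    intro j hj hR
    have : j ≠ k := by
      rintro rfl
      exact hk hR
    omega
  exact ⟨fun j hj hR => h.left j (hlt j hj hR) hR, fun j hj hR => h.right j (hlt j hj hR) hR,
    fun v => (h.default v).imp_left fun ⟨j, hj, h⟩ => ⟨j, by omega, h⟩⟩

/-- Different rules are triggered by different targets, so the new entry does not overwrite an
earlier rule. -/
theorem HoldsRules.update {k : ℕ} (h : HoldsRules U V Lb f g (k + 1)) (hk : IsRule U V Lb k)
    (huniq : ∀ j, j + 1 < k + 1 + 1 → IsRule U V Lb j → V (j + 1) = V (k + 1) → j = k) :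
    HoldsRules U V Lb (Function.update f (V (k + 1)) (U k + 1))
      (Function.update g (V (k + 1)) (U (k + 1))) (k + 1 + 1) := by
  refine ⟨fun j hj hR => ?_, fun j hj hR => ?_, fun v => ?_⟩
  · by_cases hV : V (j + 1) = V (k + 1)
    · rw [hV, Function.update_self, huniq j hj hR hV]
    · rw [Function.update_of_ne hV]
      have : j ≠ k := fun h' => hV (by rw [h'])
      exact h.left j (by omega) hR
  · by_cases hV : V (j + 1) = V (k + 1)
    · rw [hV, Function.update_self, huniq j hj hR hV]
    · rw [Function.update_of_ne hV]
      have : j ≠ k := fun h' => hV (by rw [h'])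
      exact h.right j (by omega) hR
  · by_cases hv : v = V (k + 1)
    · exact .inl ⟨k, by omega, hk, hv.symm⟩
    · rw [Function.update_of_ne hv, Function.update_of_ne hv]
      exact (h.default v).imp_left fun ⟨j, hj, h⟩ => ⟨j, by omega, h⟩

theorem Prog.reaches_markEdges {W : ℕ} (hW : n + 2 ≤ W) (hσ : σ.Bounded W)
    (hm : σ.reg 1 = m) (hU : σ.mem 13 = U) (hV : σ.mem 14 = V) (hLb : σ.mem 15 = Lb)
    (hf : ∀ v, σ.mem 16 v = 0) (hg : ∀ v, σ.mem 17 v = 0)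
    (hUn : ∀ k < m, U k < n)
    (hM : ∀ j, j + 1 < m → IsGap U Lb j → M (U j + 1) ∧ M (U (j + 1)))
    (huniq : ∀ i j, i + 1 < m → j + 1 < m → IsRule U V Lb i → IsRule U V Lb j →
      V (i + 1) = V (j + 1) → i = j)
    (hq : IsQueue M n l σ) :
    markEdges.Reaches W (200 * (m + 1)) σ (fun τ => ∃ l', IsQueue M n l' τ ∧ l <+: l' ∧
      (∀ j, j + 1 < m → IsGap U Lb j → U j + 1 ∈ l' ∧ U (j + 1) ∈ l') ∧
      HoldsRules U V Lb (τ.mem 16) (τ.mem 17) m) := by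
  refine (reaches_forLoop (by decide) rfl rfl (by omega)
    (fun k τ => ∃ l', IsQueue M n l' τ ∧ l <+: l' ∧
      (∀ j, j + 1 < k → IsGap U Lb j → U j + 1 ∈ l' ∧ U (j + 1) ∈ l') ∧
      HoldsRules U V Lb (τ.mem 16) (τ.mem 17) k)
    hσ hm ?_ ?_).mono ?_ fun _ h => h
  · exact ⟨l, hq.congr rfl rfl rfl, List.prefix_rfl, by simp, by simp, by simp,
      fun v => .inr ⟨hf v, hg v⟩⟩
  · rintro k hk ρ hρ hfr h3 ⟨l', hq', hl, hgap, hrules⟩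
    have h13 : ρ.mem 13 = U := (hfr.mem 13 rfl).trans hU
    have h14 : ρ.mem 14 = V := (hfr.mem 14 rfl).trans hV
    have h15 : ρ.mem 15 = Lb := (hfr.mem 15 rfl).trans hLb
    rcases k with _ | k
    · constructor
      · simp [Safe, Expr.Ok, Expr.eval, Op.eval, h3]
      · simp only [run, Expr.eval, Op.eval, h3, if_true]
        exact ⟨l', hq'.congr rfl rfl rfl, hl, fun j hj => absurd hj (by omega),
          fun j hj => absurd hj (by omega), fun j hj => absurd hj (by omega),
          fun v => (hrules.default v).imp_left fun ⟨j, hj, _⟩ => absurd hj (by omega)⟩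
    have hUk := hUn k (by omega)
    have hUk1 := hUn (k + 1) hk
    have hc0 : Expr.eval ρ (.bin .eq (.reg 3) (.lit 0)) = 0 := by
      simp [Expr.eval, Op.eval, h3]
    have hprev : Expr.eval ρ afterPrevSource = U k + 1 := by
      simp only [afterPrevSource, Expr.eval, Op.eval, h3, h13, Nat.add_sub_cancel]
    have hprevok : afterPrevSource.Ok W ρ := by
      simp only [afterPrevSource, Expr.Ok, Expr.eval, Op.eval, h3, h13, Nat.add_sub_cancel]
      exact ⟨⟨trivial, by omega⟩, by omega, by omega⟩
    have hgapev : Expr.eval ρ gapTest = 1 - (if Lb k = Lb (k + 1) then 1 else 0) +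
        (if U k + 1 < U (k + 1) then 1 else 0) := by
      rw [← hprev]
      simp only [gapTest, Expr.eval, Op.eval, h3, h13, h15, Nat.add_sub_cancel]
    have hgapok : gapTest.Ok W ρ := by
      have hle : Expr.eval ρ gapTest ≤ W := by
        rw [hgapev]
        split_ifs <;> omega
      exact ⟨⟨by change 1 ≤ W; omega, ⟨trivial, by change 1 ≤ W; omega⟩, trivial⟩,
        ⟨hprevok, trivial⟩, hle⟩
    have hok0 : (Expr.bin .eq (.reg 3) (.lit 0)).Ok W ρ := ⟨trivial, Nat.zero_le W⟩
    rw [run_branch_neg hc0]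
    by_cases hG : IsGap U Lb k
    · have hfm := frame_run (mark afterPrevSource) ρ
      obtain ⟨hMx, hMy⟩ := hM k hk hG
      obtain ⟨hs, l₁, hq₁, hl₁, hx, hy⟩ := mark_mark_spec (e := afterPrevSource)
        (f := .read 13 (.reg 3)) hW hq' hprevok hprev hMx (by omega) trivial
        (by simp only [Expr.eval, hfm.mem 13 rfl, hfm.reg 3 rfl, h13, h3]) hMy (by omega)
      have hrunf := frame_run (seq (mark afterPrevSource) (mark (.read 13 (.reg 3)))) ρ
      have hcond : Expr.eval ρ gapTest ≠ 0 := by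
        rw [hgapev]
        rcases hG with h | h
        · simp [h]
        · simp [h]
      refine ⟨Safe.branch_neg hc0 hok0 (Safe.branch_pos hcond hgapok hs), ?_⟩
      rw [run_branch_pos hcond]
      refine ⟨l₁, hq₁.congr rfl rfl rfl, hl.trans hl₁, fun j hj hGj => ?_, ?_⟩
      · by_cases hjk : j = k
        · subst hjk
          exact ⟨hx, hy⟩
        · have := hgap j (by omega) hGj
          exact ⟨hl₁.subset this.1, hl₁.subset this.2⟩
      · change HoldsRules U V Lb ((run _ ρ).mem 16) ((run _ ρ).mem 17) (k + 1 + 1)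
        rw [hrunf.mem 16 rfl, hrunf.mem 17 rfl]
        exact hrules.succ fun hR => hR.1 hG
    · have hG' : Lb k = Lb (k + 1) ∧ ¬ U k + 1 < U (k + 1) := by
        rw [IsGap, not_or, not_not] at hG
        exact hG
      have hcond : Expr.eval ρ gapTest = 0 := by
        rw [hgapev]
        simp [hG']
      have htok : targetTest.Ok W ρ := ⟨⟨trivial, by change 1 ≤ W; omega⟩, trivial⟩
      have htev : Expr.eval ρ targetTest = if V k = V (k + 1) then 1 else 0 := by
        simp only [targetTest, Expr.eval, Op.eval, h3, h14, Nat.add_sub_cancel]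
      rw [run_branch_neg hcond]
      have hgap' : ∀ j, j + 1 < k + 1 + 1 → IsGap U Lb j → U j + 1 ∈ l' ∧ U (j + 1) ∈ l' := by
        intro j hj hGj
        have : j ≠ k := by
          rintro rfl
          exact hG hGj
        exact hgap j (by omega) hGj
      by_cases hVk : V k = V (k + 1)
      · have hcond' : Expr.eval ρ targetTest ≠ 0 := by
          rw [htev, if_pos hVk]
          exact one_ne_zero
        refine ⟨Safe.branch_neg hc0 hok0 (Safe.branch_neg hcond hgapok
          (Safe.branch_pos hcond' htok trivial)), ?_⟩
        rw [run_branch_pos hcond']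
        exact ⟨l', hq'.congr rfl rfl rfl, hl, hgap', hrules.succ fun hR => hR.2 hVk⟩
      · have hR : IsRule U V Lb k := ⟨hG, hVk⟩
        have hcond' : Expr.eval ρ targetTest = 0 := by
          rw [htev, if_neg hVk]
        refine ⟨Safe.branch_neg hc0 hok0 (Safe.branch_neg hcond hgapok
          (Safe.branch_neg hcond' htok ⟨⟨trivial, hprevok⟩, trivial, trivial⟩)), ?_⟩
        rw [run_branch_neg hcond']
        have hrun : run (.seq (.write 16 (.read 14 (.reg 3)) afterPrevSource)
            (.write 17 (.read 14 (.reg 3)) (.read 13 (.reg 3)))) ρ =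
            (ρ.setMem 16 (V (k + 1)) (U k + 1)).setMem 17 (V (k + 1)) (U (k + 1)) := by
          simp [run, hprev, State.setMem, Expr.eval, h3, h13, h14]
        rw [hrun]
        refine ⟨l', hq'.congr rfl rfl rfl, hl, hgap', ?_⟩
        have h16 : (((ρ.setMem 16 (V (k + 1)) (U k + 1)).setMem 17 (V (k + 1))
            (U (k + 1))).setReg 3 (k + 1 + 1)).mem 16 =
              Function.update (ρ.mem 16) (V (k + 1)) (U k + 1) := rfl
        have h17 : (((ρ.setMem 16 (V (k + 1)) (U k + 1)).setMem 17 (V (k + 1))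
            (U (k + 1))).setReg 3 (k + 1 + 1)).mem 17 =
              Function.update (ρ.mem 17) (V (k + 1)) (U (k + 1)) := rfl
        rw [h16, h17]
        exact hrules.update hR fun j hj hRj h => huniq j k (by omega) hk hRj hR h
  · simp only [gapTest, targetTest, afterPrevSource, mark, cost, Expr.cost]
    omega

/-- Takes the next entry from the queue, and marks the positions that depend on it. -/
def Prog.propagateStep : Prog :=
    .seq (.assign 8 (.read 18 (.reg 5))) <|
    .seq (.assign 5 (.bin .add (.reg 5) (.lit 1))) <|
    .seq (mark (.read 16 (.reg 8))) (mark (.read 17 (.reg 8)))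

/-- Works off the queue. -/
def Prog.propagate : Prog := .loop (.bin .lt (.reg 5) (.reg 6)) propagateStep

/-- Breadth-first closure: register `5` is the head of the queue, and all entries before it already
have their images under `f` and `g` in the queue. Since at most `n + 1` positions are ever queued,
`n + 1` minus the head is a potential. -/
theorem Prog.reaches_propagate {W : ℕ} {f g : ℕ → ℕ} (hW : n + 2 ≤ W) (hσ : σ.Bounded W)
    (h5 : σ.reg 5 = 0) (hf : σ.mem 16 = f) (hg : σ.mem 17 = g) (hfM : ∀ v, M v → M (f v) ∧ M (g v))
    (hfn : ∀ v, f v ≤ n ∧ g v ≤ n) (hq : IsQueue M n l σ) :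
    propagate.Reaches W (100 * (n + 2)) σ (fun τ => ∃ l', IsQueue M n l' τ ∧ l <+: l' ∧
      ∀ v ∈ l', f v ∈ l' ∧ g v ∈ l') := by
  refine (reaches_loop (e := .bin .lt (.reg 5) (.reg 6)) (p := propagateStep) (by omega)
    (fun τ => τ.mem 16 = f ∧ τ.mem 17 = g ∧ ∃ l', IsQueue M n l' τ ∧ l <+: l' ∧
      τ.reg 5 ≤ l'.length ∧
      ∀ (i : ℕ) (hi : i < l'.length), i < τ.reg 5 → f l'[i] ∈ l' ∧ g l'[i] ∈ l')
    (fun τ => n + 1 - τ.reg 5) (fun _ _ _ => ⟨trivial, trivial⟩) ?_ hσ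
    ⟨hf, hg, l, hq, List.prefix_rfl, by omega, fun i _ hi => absurd hi (by omega)⟩).mono ?_ ?_
  · rintro ρ hρ ⟨hf, hg, l', hq', hl, hle, hI⟩ hc
    have hlen := hq'.length_le
    have hlt : ρ.reg 5 < l'.length := by
      simp only [Expr.eval, Op.eval, hq'.length] at hc
      by_contra h
      simp [h] at hc
    set x := l'[ρ.reg 5] with hx
    set i₀ := ρ.reg 5 with hi₀
    have hxl : x ∈ l' := List.getElem_mem hlt
    have hentry : ρ.mem 18 i₀ = x := hq'.entry _ hlt
    obtain ⟨hMx, -⟩ := hq'.mem x hxl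
    set ρ₁ := (ρ.setReg 8 x).setReg 5 (i₀ + 1) with hρ₁
    have hq₁ : IsQueue M n l' ρ₁ := hq'.congr rfl rfl rfl
    have h8 : ρ₁.reg 8 = x := by simp [hρ₁, State.setReg]
    have h16 : ρ₁.mem 16 = f := hf
    have h17 : ρ₁.mem 17 = g := hg
    have hfr := frame_run (mark (.read 16 (.reg 8))) ρ₁
    obtain ⟨hs, l₁, hq₂, hl₁, hxf, hxg⟩ := mark_mark_spec (e := .read 16 (.reg 8))
      (f := .read 17 (.reg 8)) hW hq₁ trivial (by simp only [Expr.eval, h8, h16]) (hfM x hMx).1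
      (hfn x).1 trivial (by simp only [Expr.eval, hfr.reg 8 rfl, hfr.mem 17 rfl, h8, h17])
      (hfM x hMx).2 (hfn x).2
    have hinit : (assign 5 (.bin .add (.reg 5) (.lit 1))).run
        ((assign 8 (.read 18 (.reg 5))).run ρ) = ρ₁ := by
      simp [run, hρ₁, State.setReg, Expr.eval, Op.eval, ← hi₀, hentry]
    have hfr₂ := frame_run (seq (mark (.read 16 (.reg 8))) (mark (.read 17 (.reg 8)))) ρ₁
    have h5' : ((seq (mark (.read 16 (.reg 8))) (mark (.read 17 (.reg 8)))).run ρ₁).reg 5 =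
        i₀ + 1 := by
      rw [hfr₂.reg 5 rfl]
      simp [hρ₁, State.setReg]
    rw [propagateStep, run_seq, run_seq, hinit, h5']
    refine ⟨⟨trivial, ⟨trivial, (by omega : 1 ≤ W), ?_⟩, by rwa [hinit]⟩, ⟨(hfr₂.mem 16 rfl).trans h16,
      (hfr₂.mem 17 rfl).trans h17, l₁, hq₂, hl.trans hl₁, ?_, ?_⟩, by omega⟩
    · simp [run, State.setReg, Expr.eval]
      omega
    · have := hl₁.length_le
      omega
    · intro i hi hi'
      have hi'' : i < l'.length := by omega
      have hget : l₁[i] = l'[i] := (hl₁.getElem hi'').symm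
      rw [hget]
      by_cases h : i = i₀
      · subst h
        exact ⟨hxf, hxg⟩
      · have := hI i hi'' (by omega)
        exact ⟨hl₁.subset this.1, hl₁.subset this.2⟩
  · rw [h5]
    simp only [propagateStep, mark, cost, Expr.cost]
    omega
  · rintro τ ⟨⟨-, -, l', hq', hl, hle, hI⟩, hc⟩
    refine ⟨l', hq', hl, fun v hv => ?_⟩
    obtain ⟨i, hi, rfl⟩ := List.getElem_of_mem hv
    refine hI i hi ?_
    simp only [Expr.eval, Op.eval, hq'.length] at hc
    by_contra h
    rw [if_pos (by omega)] at hc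
    omega

end Marking

/-! ### Building the quotient in memory -/

section Quotient

variable {n m W : ℕ} {σ : State} {fb U V Lb : ℕ → ℕ}

namespace Prog

/-- Computes the bit array of the boundaries between the classes in array `5`. -/
def markBoundaries : Prog :=
  .seq markFinal <| .seq markEnds <| .seq markEdges <| .seq propagate (.write 5 (.lit 0) (.lit 0))

theorem reaches_markBoundaries (hW : n + m + 2 ≤ W) (hσ : σ.Bounded W)
    (hn : σ.reg 0 = n) (hm : σ.reg 1 = m) (h5 : σ.reg 5 = 0) (h6 : σ.reg 6 = 0)
    (hfb : σ.mem 3 = fb) (hU : σ.mem 13 = U) (hV : σ.mem 14 = V) (hLb : σ.mem 15 = Lb)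
    (hbit : ∀ i, σ.mem 5 i = 0) (hf : ∀ i, σ.mem 16 i = 0) (hg : ∀ i, σ.mem 17 i = 0)
    (hUn : ∀ k < m, U k < n)
    (hV0 : ∀ j, j + 1 < m → IsRule U V Lb j → V (j + 1) ≠ 0)
    (huniq : ∀ i j, i + 1 < m → j + 1 < m → IsRule U V Lb i → IsRule U V Lb j →
      V (i + 1) = V (j + 1) → i = j) :
    markBoundaries.Reaches W (700 * (n + m + 1)) σ (fun τ => (∀ i < n, τ.mem 19 i = fb i) ∧
      ∀ i, τ.mem 5 i = 1 ∧ i ≠ 0 ∧ Marked n m fb U V Lb i ∨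
        τ.mem 5 i = 0 ∧ ¬ (i ≠ 0 ∧ Marked n m fb U V Lb i)) := by
  -- Nothing is required of position `0`: targets without a rule have the default entries `0`, so
  -- `propagate` may put it into the queue although it separates nothing.
  have hq : IsQueue (fun i => i ≠ 0 → Marked n m fb U V Lb i) n [] σ :=
    ⟨List.nodup_nil, by simp, h6, by simp, by simpa using hbit⟩
  have s1 := (reaches_markFinal (n := n) (by omega) hσ hn hfb (fun i h0 hi hne _ => .final i h0 hi hne)
    hq).with_frame hσ
  refine (s1.seq (T' := 600 * (n + m + 1)) ?_).mono (by omega) fun _ h => h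
  rintro σ₁ ⟨⟨hfin, l₁, hq₁, -, hl₁⟩, hσ₁, hf₁⟩
  have s2 := (reaches_markEnds (n := n) (m := m) (by omega) hσ₁ ((hf₁.reg 1 rfl).trans hm)
    ((hf₁.mem 13 rfl).trans hU) hUn (fun h => ⟨fun _ => .first h, fun _ => .last h⟩)
    hq₁).with_frame hσ₁
  refine (s2.seq (T' := 500 * (n + m + 1)) ?_).mono (by omega) fun _ h => h
  rintro σ₂ ⟨⟨l₂, hq₂, hpre₂, hl₂⟩, hσ₂, hf₂⟩
  have s3 := (reaches_markEdges (n := n) (m := m) (by omega) hσ₂ (by rw [hf₂.reg 1 rfl, hf₁.reg 1 rfl, hm])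
    (by rw [hf₂.mem 13 rfl, hf₁.mem 13 rfl, hU]) (by rw [hf₂.mem 14 rfl, hf₁.mem 14 rfl, hV])
    (by rw [hf₂.mem 15 rfl, hf₁.mem 15 rfl, hLb])
    (by rwa [hf₂.mem 16 rfl, hf₁.mem 16 rfl]) (by rwa [hf₂.mem 17 rfl, hf₁.mem 17 rfl]) hUn
    (fun j hj hG => ⟨fun _ => .gap_left j hj hG, fun _ => .gap_right j hj hG⟩) huniq
    hq₂).with_frame hσ₂
  refine (s3.seq (T' := 100 * (n + m + 1) + 110) ?_).mono (by omega) fun _ h => h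
  rintro σ₃ ⟨⟨l₃, hq₃, hpre₃, hl₃, hrules⟩, hσ₃, hf₃⟩
  have s4 := (reaches_propagate (n := n) (by omega) hσ₃
    (by rw [hf₃.reg 5 rfl, hf₂.reg 5 rfl, hf₁.reg 5 rfl, h5]) rfl rfl ?_ ?_ hq₃).with_frame hσ₃
  rotate_left
  · intro v hv
    rcases hrules.default v with ⟨j, hj, hR, rfl⟩ | ⟨h, h'⟩
    · have hG := hR.1
      rw [IsGap, not_or, not_not] at hG
      have hMv := hv (hV0 j hj hR)
      rw [hrules.left j hj hR, hrules.right j hj hR]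
      exact ⟨fun _ => .prop_left j hj hG.1 hR.2 hMv, fun _ => .prop_right j hj hG.1 hR.2 hMv⟩
    · rw [h, h']
      exact ⟨fun h => absurd rfl h, fun h => absurd rfl h⟩
  · intro v
    rcases hrules.default v with ⟨j, hj, hR, rfl⟩ | ⟨h, h'⟩
    · rw [hrules.left j hj hR, hrules.right j hj hR]
      have := hUn j (by omega)
      have := hUn (j + 1) (by omega)
      omega
    · omega
  refine (s4.seq (T' := 3) ?_).mono (by omega) fun _ h => h
  rintro σ₄ ⟨⟨l₄, hq₄, hpre₄, hl₄⟩, hσ₄, hf₄⟩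
  have hmarked : ∀ i, Marked n m fb U V Lb i → i ∈ l₄ := by
    intro i hi
    have hsub₃ := hpre₄.subset
    have hsub₂ := fun x hx => hsub₃ (hpre₃.subset (a := x) hx)
    have hprop : ∀ k, k + 1 < m → Lb k = Lb (k + 1) → V k ≠ V (k + 1) → V (k + 1) ∈ l₄ →
        U k + 1 ∈ l₄ ∧ U (k + 1) ∈ l₄ := by
      intro k hk hL hVk hmem
      -- Pairs with a gap have no stored rule, but both of their positions are already marked.
      by_cases hG : IsGap U Lb k
      · exact ⟨hsub₃ (hl₃ k hk hG).1, hsub₃ (hl₃ k hk hG).2⟩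
      · have hR : IsRule U V Lb k := ⟨hG, hVk⟩
        have := hl₄ _ hmem
        rwa [hrules.left k hk hR, hrules.right k hk hR] at this
    induction hi with
    | final i h0 hi hne => exact hsub₂ _ (hpre₂.subset (hl₁ i hi h0 hne))
    | first h => exact hsub₂ _ (hl₂ h).1
    | last h => exact hsub₂ _ (hl₂ h).2
    | gap_left k hk hG => exact hsub₃ (hl₃ k hk hG).1
    | gap_right k hk hG => exact hsub₃ (hl₃ k hk hG).2
    | prop_left k hk hL hV _ ih => exact (hprop k hk hL hV ih).1
    | prop_right k hk hL hV _ ih => exact (hprop k hk hL hV ih).2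
  -- The last command clears the bit of position `0`, which may have been queued by a default entry
  -- or as the first source.
  refine Safe.reaches (p := .write 5 (.lit 0) (.lit 0)) (by omega)
    ⟨Nat.zero_le W, Nat.zero_le W⟩ hσ₄ ⟨?_, fun i => ?_⟩
  · change ∀ i < n, σ₄.mem 19 i = fb i
    rw [hf₄.mem 19 rfl, hf₃.mem 19 rfl, hf₂.mem 19 rfl]
    exact hfin
  · have hi : ((write 5 (.lit 0) (.lit 0)).run σ₄).mem 5 i = if i = 0 then 0 else σ₄.mem 5 i := by
      simp [run, State.setMem, Expr.eval, Function.update_apply]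
    rw [hi, hq₄.bit]
    by_cases h0 : i = 0
    · exact .inr ⟨if_pos h0, fun h => h.1 h0⟩
    · rw [if_neg h0]
      by_cases hil : i ∈ l₄
      · exact .inl ⟨if_pos hil, h0, (hq₄.mem i hil).1 h0⟩
      · exact .inr ⟨if_neg hil, fun h => hil (hmarked i h.2)⟩

/-- Numbers the classes: array `4` receives the number of boundaries up to each state. -/
def numberClasses : Prog :=
  forLoop 0 <| .seq (.assign 9 (.bin .add (.reg 9) (.read 5 (.reg 3)))) (.write 4 (.reg 3) (.reg 9))

theorem reaches_numberClasses {B : ℕ → ℕ} (hW : n + 1 ≤ W) (hσ : σ.Bounded W)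
    (hn : σ.reg 0 = n) (h9 : σ.reg 9 = 0) (hB : σ.mem 5 = B) (hB1 : ∀ i, B i ≤ 1) :
    numberClasses.Reaches W (50 * (n + 1)) σ
      (fun τ => τ.reg 9 = ∑ j ∈ Finset.range n, B j ∧
        ∀ i < n, τ.mem 4 i = ∑ j ∈ Finset.range (i + 1), B j) := by
  refine (reaches_forLoop (by decide) rfl rfl (by omega)
    (fun k τ => τ.reg 9 = ∑ j ∈ Finset.range k, B j ∧
        ∀ i < k, τ.mem 4 i = ∑ j ∈ Finset.range (i + 1), B j) hσ hn
    ⟨by simpa [State.setReg] using h9, by simp⟩ ?_).mono ?_ fun _ h => h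
  · rintro k hk ρ hρ hf h3 ⟨h9, hI⟩
    have hB' : ρ.mem 5 = B := (hf.mem 5 rfl).trans hB
    have hsum : ∑ j ∈ Finset.range k, B j ≤ k := by
      simpa using Finset.sum_le_card_nsmul (Finset.range k) B 1 (fun j _ => hB1 j)
    have hBk := hB1 k
    refine ⟨⟨⟨trivial, trivial, ?_⟩, trivial, trivial⟩, ?_, fun i hi => ?_⟩
    · simp only [Expr.eval, h3, h9, hB']
      omega
    · simp [run, State.setReg, State.setMem, Expr.eval, Op.eval, h3, h9, hB',
        Finset.sum_range_succ]
    · simp only [run, State.setReg, State.setMem, Expr.eval, Op.eval, h3, h9, hB']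
      by_cases h : i = k
      · subst h
        simp [h3, Finset.sum_range_succ]
      · simpa [h3, h] using hI i (by omega)
  · simp only [cost, Expr.cost]
    omega

/-- Writes the bits of the final classes to array `3`. -/
def finalClasses : Prog := forLoop 0 (.write 3 (.read 4 (.reg 3)) (.read 19 (.reg 3)))

/-- Every state writes its own bit to the cell of its class; the writes agree because finality is
constant on classes. -/
theorem reaches_finalClasses {c : ℕ → ℕ} (hW : 1 ≤ W) (hσ : σ.Bounded W)
    (hn : σ.reg 0 = n) (hc : σ.mem 4 = c) (hfb : ∀ i < n, σ.mem 19 i = fb i)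
    (hcf : ∀ i < n, ∀ j < n, c i = c j → fb i = fb j) :
    finalClasses.Reaches W (50 * (n + 1)) σ (fun τ => ∀ i < n, τ.mem 3 (c i) = fb i) := by
  refine (reaches_forLoop (by decide) rfl rfl (by omega)
    (fun k τ => ∀ i < k, τ.mem 3 (c i) = fb i) hσ hn (by simp) ?_).mono ?_ fun _ h => h
  · intro k hk ρ hρ hf h3 hI
    have hc' : ρ.mem 4 = c := (hf.mem 4 rfl).trans hc
    have hfk : ρ.mem 19 k = fb k := by rw [hf.mem 19 rfl, hfb k hk]
    refine ⟨⟨trivial, trivial⟩, fun i hi => ?_⟩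
    simp only [run, State.setReg, State.setMem, Expr.eval, h3, hc', hfk, Function.update_self,
      Function.update_apply]
    split_ifs with h
    · exact (hcf i (by omega) k hk h).symm
    · refine hI i ?_
      have : i ≠ k := fun h' => h (by rw [h'])
      omega
  · simp only [cost, Expr.cost]
    omega

/-- The class of the state at the current position of array `a`. -/
def classAt (a : ℕ) : Expr := .read 4 (.read a (.reg 3))

/-- The class of the state at the previous position of array `a`. -/
def prevClassAt (a : ℕ) : Expr := .read 4 (.read a (.bin .sub (.reg 3) (.lit 1)))

/-- Tests whether the current edge of the quotient differs from the previous one. -/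
def newTest : Expr :=
  .bin .add (.bin .add (.bin .eq (.reg 3) (.lit 0))
      (.bin .sub (.lit 1) (.bin .eq (prevClassAt 13) (classAt 13))))
    (.bin .add (.bin .sub (.lit 1) (.bin .eq (prevClassAt 14) (classAt 14)))
      (.bin .sub (.lit 1) (.bin .eq (.read 15 (.bin .sub (.reg 3) (.lit 1))) (.read 15 (.reg 3)))))

/-- Writes the edges of the quotient to arrays `0`, `1` and `2`, skipping duplicates. -/
def quotientEdges : Prog :=
  forLoop 1 <| .branch newTest
    (.seq (.write 0 (.reg 10) (classAt 13)) <|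
     .seq (.write 1 (.reg 10) (classAt 14)) <|
     .seq (.write 2 (.reg 10) (.read 15 (.reg 3)))
      (.assign 10 (.bin .add (.reg 10) (.lit 1)))) .skip

end Prog

/-- Arrays `0`, `1` and `2` hold the triples of the list `D`, and register `10` its length. -/
structure HoldsTriples (D : List (ℕ × ℕ × ℕ)) (σ : State) : Prop where
  length : σ.reg 10 = D.length
  fst : ∀ (i : ℕ) (hi : i < D.length), σ.mem 0 i = D[i].1
  snd : ∀ (i : ℕ) (hi : i < D.length), σ.mem 1 i = D[i].2.1
  trd : ∀ (i : ℕ) (hi : i < D.length), σ.mem 2 i = D[i].2.2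

theorem HoldsTriples.append {D : List (ℕ × ℕ × ℕ)} (h : HoldsTriples D σ) (x : ℕ × ℕ × ℕ)
    {τ : State} (h10 : τ.reg 10 = D.length + 1)
    (h0 : τ.mem 0 = Function.update (σ.mem 0) D.length x.1)
    (h1 : τ.mem 1 = Function.update (σ.mem 1) D.length x.2.1)
    (h2 : τ.mem 2 = Function.update (σ.mem 2) D.length x.2.2) : HoldsTriples (D ++ [x]) τ := by
  have key : ∀ (f : ℕ × ℕ × ℕ → ℕ) (g : ℕ → ℕ),
      (∀ (i : ℕ) (hi : i < D.length), g i = f D[i]) →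
      ∀ (i : ℕ) (hi : i < (D ++ [x]).length),
        Function.update g D.length (f x) i = f (D ++ [x])[i] := by
    intro f g hg i hi
    rw [List.length_append, List.length_singleton] at hi
    by_cases h : i = D.length
    · subst h
      simp
    · have hi' : i < D.length := by omega
      rw [Function.update_of_ne h, hg i hi', List.getElem_append_left hi']
  refine ⟨by simpa using h10, ?_, ?_, ?_⟩
  · rw [h0]
    exact key (fun y => y.1) _ h.fst
  · rw [h1]
    exact key (fun y => y.2.1) _ h.snd
  · rw [h2]
    exact key (fun y => y.2.2) _ h.trd

theorem Prog.reaches_quotientEdges {c : ℕ → ℕ} {e : ℕ → ℕ × ℕ × ℕ} (hW : m + 4 ≤ W)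
    (hσ : σ.Bounded W) (hm : σ.reg 1 = m) (h10 : σ.reg 10 = 0) (hc : σ.mem 4 = c)
    (hU : σ.mem 13 = U) (hV : σ.mem 14 = V) (hLb : σ.mem 15 = Lb)
    (he : ∀ k, e k = (c (U k), c (V k), Lb k))
    (hcont : ∀ p q, p < q → q < m → e p = e q → e (q - 1) = e q) :
    quotientEdges.Reaches W (100 * (m + 1)) σ (fun τ => ∃ D, HoldsTriples D τ ∧ D.Nodup ∧
      ∀ x, x ∈ D ↔ ∃ j < m, e j = x) := by
  refine (reaches_forLoop (by decide) rfl rfl (by omega)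
    (fun k τ => ∃ D, HoldsTriples D τ ∧ D.Nodup ∧ D.length ≤ k ∧ ∀ x, x ∈ D ↔ ∃ j < k, e j = x)
    hσ hm ?_ ?_).mono ?_ fun τ ⟨D, h1, h2, _, h3⟩ => ⟨D, h1, h2, h3⟩
  · exact ⟨[], ⟨h10, by simp, by simp, by simp⟩, List.nodup_nil, le_rfl, by simp⟩
  · rintro k hk ρ hρ hf h3 ⟨D, hD, hnd, hle, hmem⟩
    have hc' : ρ.mem 4 = c := (hf.mem 4 rfl).trans hc
    have hU' : ρ.mem 13 = U := (hf.mem 13 rfl).trans hU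
    have hV' : ρ.mem 14 = V := (hf.mem 14 rfl).trans hV
    have hLb' : ρ.mem 15 = Lb := (hf.mem 15 rfl).trans hLb
    have hev : newTest.eval ρ = (if k = 0 then 1 else 0) +
        (1 - if c (U (k - 1)) = c (U k) then 1 else 0) +
        ((1 - if c (V (k - 1)) = c (V k) then 1 else 0) +
          (1 - if Lb (k - 1) = Lb k then 1 else 0)) := by
      simp only [newTest, prevClassAt, classAt, Expr.eval, Op.eval, h3, hc', hU', hV', hLb']
    -- The test is a sum of four numbers that are at most 1, which explains the 4 in `hW`.
    have hok : newTest.Ok W ρ := by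
      have hone : 1 ≤ W := by omega
      have hop : ∀ x y, Op.eval .eq x y ≤ 1 := by
        intro x y
        simp only [Op.eval]
        split_ifs <;> omega
      have heq : Expr.eval ρ (.bin .eq (.reg 3) (.lit 0)) ≤ 1 := hop _ _
      have hsub : ∀ f, Expr.eval ρ (.bin .sub (.lit 1) f) ≤ 1 := fun f => Nat.sub_le 1 _
      have h1 := Nat.add_le_add heq (hsub (.bin .eq (prevClassAt 13) (classAt 13)))
      have h2 := Nat.add_le_add (hsub (.bin .eq (prevClassAt 14) (classAt 14)))
        (hsub (.bin .eq (.read 15 (.bin .sub (.reg 3) (.lit 1))) (.read 15 (.reg 3))))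
      exact ⟨⟨⟨trivial, Nat.zero_le W⟩, ⟨hone, ⟨trivial, hone⟩, trivial⟩, h1.trans (by omega)⟩,
        ⟨⟨hone, ⟨trivial, hone⟩, trivial⟩, ⟨hone, ⟨trivial, hone⟩, trivial⟩, h2.trans (by omega)⟩,
        (Nat.add_le_add h1 h2).trans (by omega)⟩
    -- For `k = 0` truncated subtraction compares the edge with itself, so the test `k = 0` is what
    -- makes the first edge count as new.
    have hiff : newTest.eval ρ ≠ 0 ↔ k = 0 ∨ e (k - 1) ≠ e k := by
      rw [hev, he, he]
      simp only [ne_eq, Prod.mk.injEq, not_and_or]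
      split_ifs <;> simp_all
    by_cases hnew : newTest.eval ρ ≠ 0
    · have hnmem : e k ∉ D := by
        rw [hmem]
        rintro ⟨j, hj, hjk⟩
        rcases hiff.1 hnew with h | h
        · omega
        · exact h (hcont j k hj hk hjk)
      refine ⟨Safe.branch_pos hnew hok ?_, D ++ [e k], ?_, ?_, ?_, ?_⟩
      · simp [Safe, classAt, run, Expr.Ok, Expr.eval, State.setMem, hD.length]
        omega
      · rw [run_branch_pos hnew]
        refine hD.append (e k) ?_ ?_ ?_ ?_ <;>
        simp [run, classAt, State.setReg, State.setMem, Expr.eval, Op.eval, h3, hc', hU', hV',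
          hLb', hD.length, he]
      · rw [List.nodup_append]
        refine ⟨hnd, List.nodup_singleton _, fun a ha b hb => ?_⟩
        rw [List.mem_singleton] at hb
        rintro rfl
        exact hnmem (hb ▸ ha)
      · simpa using hle
      · intro x
        rw [List.mem_append, List.mem_singleton, hmem]
        constructor
        · rintro (⟨j, hj, rfl⟩ | rfl)
          · exact ⟨j, by omega, rfl⟩
          · exact ⟨k, by omega, rfl⟩
        · rintro ⟨j, hj, rfl⟩
          by_cases h : j = k
          · exact .inr (by rw [h])
          · exact .inl ⟨j, by omega, rfl⟩
    · have hold := hiff.not.1 hnew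
      rw [not_or, not_not] at hold
      rw [not_not] at hnew
      refine ⟨Safe.branch_neg hnew hok trivial, D, ?_, hnd, by omega, fun x => ?_⟩
      · rw [run_branch_neg hnew]
        exact ⟨hD.length, hD.fst, hD.snd, hD.trd⟩
      · rw [hmem]
        constructor
        · rintro ⟨j, hj, rfl⟩
          exact ⟨j, by omega, rfl⟩
        · rintro ⟨j, hj, rfl⟩
          by_cases h : j = k
          · exact ⟨k - 1, by omega, by rw [h, hold.2]⟩
          · exact ⟨j, by omega, rfl⟩
  · simp only [newTest, prevClassAt, classAt, cost, Expr.cost]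
    omega

namespace Prog

/-- Writes the numbers of states and edges and the initial state of the quotient. -/
def quotientHeader : Prog :=
  .seq (.assign 0 (.bin .add (.reg 9) (.lit 1))) <|
  .seq (.assign 1 (.reg 10)) (.assign 2 (.read 4 (.reg 2)))

def buildQuotient : Prog :=
  .seq numberClasses <| .seq finalClasses <| .seq quotientEdges quotientHeader

theorem reaches_buildQuotient {B c : ℕ → ℕ} {e : ℕ → ℕ × ℕ × ℕ} (hW : n + m + 4 ≤ W)
    (hσ : σ.Bounded W) (hn : σ.reg 0 = n) (hm : σ.reg 1 = m) (h9 : σ.reg 9 = 0)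
    (h10 : σ.reg 10 = 0) (hB : σ.mem 5 = B) (hB1 : ∀ i, B i ≤ 1)
    (hU : σ.mem 13 = U) (hV : σ.mem 14 = V) (hLb : σ.mem 15 = Lb)
    (hc : ∀ i, c i = ∑ j ∈ Finset.range (i + 1), B j) (hUn : ∀ k < m, U k < n)
    (hVn : ∀ k < m, V k < n) (hs : σ.reg 2 < n) (hfb : ∀ i < n, σ.mem 19 i = fb i)
    (hcf : ∀ i < n, ∀ j < n, c i = c j → fb i = fb j)
    (he : ∀ k < m, e k = (c (U k), c (V k), Lb k))
    (hcont : ∀ p q, p < q → q < m → e p = e q → e (q - 1) = e q) :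
    buildQuotient.Reaches W (300 * (n + m + 1)) σ (fun τ =>
      (∀ i < n, τ.mem 4 i = c i) ∧ τ.mem 5 = B ∧ (∀ i < n, τ.mem 3 (c i) = fb i) ∧
      τ.reg 0 = ∑ j ∈ Finset.range n, B j + 1 ∧ τ.reg 2 = c (σ.reg 2) ∧
      ∃ D, HoldsTriples D τ ∧ τ.reg 1 = D.length ∧ D.Nodup ∧ ∀ x, x ∈ D ↔ ∃ j < m, e j = x) := by
  have s1 := (reaches_numberClasses (by omega) hσ hn h9 hB hB1).with_frame hσ
  refine (s1.seq (T' := 200 * (n + m + 1)) ?_).mono (by omega) fun _ h => h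
  rintro σ₁ ⟨⟨h9₁, hc₁⟩, hσ₁, hf₁⟩
  have hc₁' : ∀ i < n, σ₁.mem 4 i = c i := fun i hi => by rw [hc₁ i hi, hc]
  have s2 := (reaches_finalClasses (c := σ₁.mem 4) (by omega) hσ₁ ((hf₁.reg 0 rfl).trans hn) rfl
    (by rwa [hf₁.mem 19 rfl]) (fun i hi j hj h => hcf i hi j hj (by
      rwa [hc₁' i hi, hc₁' j hj] at h))).with_frame hσ₁
  refine (s2.seq (T' := 120 * (n + m + 1)) ?_).mono (by omega) fun _ h => h
  rintro σ₂ ⟨hfin, hσ₂, hf₂⟩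
  have he₂ : ∀ k < m, (σ₁.mem 4 (U k), σ₁.mem 4 (V k), Lb k) = e k := fun k hk => by
    rw [he k hk, hc₁' _ (hUn k hk), hc₁' _ (hVn k hk)]
  have s3 := (reaches_quotientEdges (m := m) (c := σ₁.mem 4)
    (e := fun k => (σ₁.mem 4 (U k), σ₁.mem 4 (V k), Lb k)) (by omega) hσ₂
    (by rw [hf₂.reg 1 rfl, hf₁.reg 1 rfl, hm])
    (by rw [hf₂.reg 10 rfl, hf₁.reg 10 rfl, h10])
    (hf₂.mem 4 rfl) (by rw [hf₂.mem 13 rfl, hf₁.mem 13 rfl, hU])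
    (by rw [hf₂.mem 14 rfl, hf₁.mem 14 rfl, hV]) (by rw [hf₂.mem 15 rfl, hf₁.mem 15 rfl, hLb])
    (fun k => rfl) (fun p q hpq hq h => by
      rw [he₂ p (by omega), he₂ q hq] at h
      rw [he₂ (q - 1) (by omega), he₂ q hq]
      exact hcont p q hpq hq h)).with_frame hσ₂
  refine (s3.seq (T' := quotientHeader.cost) ?_).mono
    (by simp only [quotientHeader, cost, Expr.cost]; omega) fun _ h => h
  rintro σ₃ ⟨⟨D, hD, hnd, hmem⟩, hσ₃, hf₃⟩
  have h9₃ : σ₃.reg 9 = ∑ j ∈ Finset.range n, B j := by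
    rw [hf₃.reg 9 rfl, hf₂.reg 9 rfl, h9₁]
  have h2₃ : σ₃.reg 2 = σ.reg 2 := by
    rw [hf₃.reg 2 rfl, hf₂.reg 2 rfl, hf₁.reg 2 rfl]
  have h4₃ : σ₃.mem 4 = σ₁.mem 4 := by rw [hf₃.mem 4 rfl, hf₂.mem 4 rfl]
  have h4 : ∀ i < n, σ₃.mem 4 i = c i := by
    rw [h4₃]
    exact hc₁'
  have hsum : ∑ j ∈ Finset.range n, B j ≤ n := by
    simpa using Finset.sum_le_card_nsmul (Finset.range n) B 1 (fun j _ => hB1 j)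
  refine Safe.reaches (by omega) ?_ hσ₃ ⟨h4, ?_, ?_, ?_, ?_, D, ⟨?_, hD.fst, hD.snd, hD.trd⟩, ?_,
    hnd, ?_⟩
  · simp [quotientHeader, Safe, Expr.Ok, Expr.eval, h9₃]
    omega
  · change σ₃.mem 5 = B
    rw [hf₃.mem 5 rfl, hf₂.mem 5 rfl, hf₁.mem 5 rfl, hB]
  · change ∀ i < n, σ₃.mem 3 (c i) = fb i
    rw [hf₃.mem 3 rfl]
    intro i hi
    rw [← hc₁' i hi]
    exact hfin i hi
  · simp [quotientHeader, run, State.setReg, Expr.eval, Op.eval, h9₃]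
  · simp [quotientHeader, run, State.setReg, Expr.eval, h2₃, h4 _ hs]
  · simp [quotientHeader, run, State.setReg, Expr.eval, hD.length]
  · simp [quotientHeader, run, State.setReg, Expr.eval, hD.length]
  · intro x
    rw [hmem]
    constructor
    · rintro ⟨j, hj, rfl⟩
      exact ⟨j, hj, (he₂ j hj).symm⟩
    · rintro ⟨j, hj, rfl⟩
      exact ⟨j, hj, he₂ j hj⟩

end Prog

end Quotient

/-! ### Numbering of the classes and the complete algorithm -/

section Assembly

/-- The number of boundaries up to position `i`. -/
def boundaryCount (B : ℕ → ℕ) (i : ℕ) : ℕ := ∑ j ∈ Finset.range (i + 1), B j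

theorem boundaryCount_succ (B : ℕ → ℕ) (i : ℕ) :
    boundaryCount B (i + 1) = boundaryCount B i + B (i + 1) := Finset.sum_range_succ _ _

theorem boundaryCount_mono (B : ℕ → ℕ) : Monotone (boundaryCount B) :=
  monotone_nat_of_le_succ fun i => by rw [boundaryCount_succ]; omega

/-- The count is monotone and increases exactly at marked positions. -/
theorem boundaryCount_eq_iff {B : ℕ → ℕ} {M : ℕ → Prop} (hB : ∀ i, i ≠ 0 → (B i = 0 ↔ ¬ M i))
    (i j : ℕ) : boundaryCount B i = boundaryCount B j ↔ Unseparated M i j := by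
  have key : ∀ i d, boundaryCount B i = boundaryCount B (i + d) ↔ Unseparated M i (i + d) := by
    intro i d
    induction d with
    | zero => exact ⟨fun _ => .refl M i, fun _ => rfl⟩
    | succ d ih =>
      have h1 := boundaryCount_mono B (show i ≤ i + d by omega)
      have h2 := boundaryCount_succ B (i + d)
      have h3 := hB (i + d + 1) (by omega)
      rw [← Nat.add_assoc]
      constructor
      · intro h
        exact (ih.1 (by omega)).trans (unseparated_succ (h3.1 (by omega)))
      · intro h
        have h4 := h3.2 (h _ (by omega) (by omega))
        have h5 := ih.2 (h.subinterval (by omega) (by omega))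
        omega
  rcases le_total i j with h | h
  · obtain ⟨d, rfl⟩ := Nat.exists_eq_add_of_le h
    exact key i d
  · obtain ⟨d, rfl⟩ := Nat.exists_eq_add_of_le h
    rw [eq_comm, key]
    exact ⟨.symm, .symm⟩

/-- Discrete intermediate values: the count starts at `0` and grows by at most one per position, so
no class number is skipped. -/
theorem exists_boundaryCount_eq {B : ℕ → ℕ} (hB0 : B 0 = 0) (hB1 : ∀ i, B i ≤ 1) {n i : ℕ}
    (hn : 0 < n) (hi : i ≤ ∑ j ∈ Finset.range n, B j) : ∃ j < n, boundaryCount B j = i := by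
  induction n with
  | zero => omega
  | succ n ih =>
    rw [Finset.sum_range_succ] at hi
    by_cases h : i ≤ ∑ j ∈ Finset.range n, B j
    · rcases Nat.eq_zero_or_pos n with rfl | hn'
      · refine ⟨0, by omega, ?_⟩
        simp only [Finset.range_zero, Finset.sum_empty] at h
        simp [boundaryCount, hB0]
        omega
      · obtain ⟨j, hj, h'⟩ := ih hn' h
        exact ⟨j, by omega, h'⟩
    · refine ⟨n, by omega, ?_⟩
      have := hB1 n
      rw [boundaryCount, Finset.sum_range_succ]
      omega

variable {Q : Type u} {α : Type v} {A : Automaton Q α} {le : Q → Q → Prop} {code : α → ℕ}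
  {idx : Q → ℕ} {L : List (Q × Q × α)} {σ : State} {W : ℕ}

/-- The quotient, held by the memory, from the numbers of the classes and the list of its edges. -/
theorem holds_quot [Finite Q] (hidx : IsNumbering le (σ.reg 0) idx) {B fb : ℕ → ℕ} {τ : State}
    (hcode : Function.Injective code) (hB0 : B 0 = 0) (hB1 : ∀ i, B i ≤ 1)
    (hcls : ∀ x y, maxAutobisim A le x y ↔ boundaryCount B (idx x) = boundaryCount B (idx y))
    (hF1 : ∀ x ∈ A.F, fb (idx x) = 1) (hF0 : ∀ x ∉ A.F, fb (idx x) = 0)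
    (h3 : ∀ i < σ.reg 0, τ.mem 3 (boundaryCount B i) = fb i)
    (h0 : τ.reg 0 = ∑ j ∈ Finset.range (σ.reg 0), B j + 1)
    (h2 : τ.reg 2 = boundaryCount B (idx A.s)) {D : List (ℕ × ℕ × ℕ)}
    (hD : HoldsTriples D τ) (h1 : τ.reg 1 = D.length) (hnd : D.Nodup)
    (hmem : ∀ t, t ∈ D ↔ ∃ x y a, (x, y, a) ∈ A.E ∧
      t = (boundaryCount B (idx x), boundaryCount B (idx y), code a)) :
    ∃ (idx' : QuotState A le → ℕ) (L' : List (QuotState A le × QuotState A le × α)),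
      Holds (quotAutomaton A le) (quotLe A le) code idx' L' τ ∧
      ∀ x, idx' (toQuot A le x) = boundaryCount B (idx x) := by
  have hsurj := toQuot_surjective (A := A) (le := le)
  let idx' : QuotState A le → ℕ := fun U => boundaryCount B (idx (Function.surjInv hsurj U))
  have hidx' : ∀ x, idx' (toQuot A le x) = boundaryCount B (idx x) := by
    intro x
    rw [← hcls, ← toQuot_eq_iff]
    exact Function.surjInv_eq hsurj _
  have hinj' : Function.Injective idx' := by
    intro U V h
    obtain ⟨x, rfl⟩ := hsurj U
    obtain ⟨y, rfl⟩ := hsurj V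
    rwa [hidx', hidx', ← hcls, ← toQuot_eq_iff] at h
  let φ : QuotState A le × QuotState A le × α → ℕ × ℕ × ℕ :=
    fun e => (idx' e.1, idx' e.2.1, code e.2.2)
  have hφ : Function.Injective φ := by
    rintro ⟨U, V, a⟩ ⟨U', V', a'⟩ h
    simp only [φ, Prod.mk.injEq] at h ⊢
    exact ⟨hinj' h.1, hinj' h.2.1, hcode h.2.2⟩
  have hrange : ∀ t ∈ D, t ∈ Set.range φ := by
    intro t ht
    obtain ⟨x, y, a, -, rfl⟩ := (hmem t).1 ht
    exact ⟨(toQuot A le x, toQuot A le y, a), by simp only [φ, hidx']⟩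
  -- The triples in memory all encode triples of the quotient, so the list lifts along the injective
  -- encoding `φ`.
  obtain ⟨L', rfl⟩ : ∃ L', List.map φ L' = D := by
    rw [← Set.mem_range, Set.range_list_map]
    exact hrange
  have hmemL : ∀ e, e ∈ L' ↔ e ∈ (quotAutomaton A le).E := by
    rintro ⟨U, V, a⟩
    rw [← List.mem_map_of_injective hφ, hmem, mem_quotAutomaton_E]
    constructor
    · rintro ⟨x, y, b, he, h⟩
      simp only [φ, ← hidx', Prod.mk.injEq] at h
      obtain rfl := hcode h.2.2
      exact ⟨x, y, (hinj' h.1).symm, (hinj' h.2.1).symm, he⟩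
    · rintro ⟨x, y, rfl, rfl, he⟩
      exact ⟨x, y, a, he, by simp only [φ, hidx']⟩
  have hsum : ∀ x, boundaryCount B (idx x) < ∑ j ∈ Finset.range (σ.reg 0), B j + 1 := by
    intro x
    have h := hidx.lt x
    exact Nat.lt_succ_of_le (Finset.sum_le_sum_of_subset (Finset.range_subset_range.2 h))
  refine ⟨idx', L', ⟨⟨?_, ?_, ?_⟩, hnd.of_map _, hmemL, by simpa using h1, ?_, ?_, ?_, ?_, ?_, ?_⟩,
    hidx'⟩
  · intro U
    obtain ⟨x, rfl⟩ := hsurj U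
    rw [hidx', h0]
    exact hsum x
  · intro i hi
    have hpos : 0 < σ.reg 0 := (Nat.zero_le _).trans_lt (hidx.lt A.s)
    obtain ⟨j, hj, rfl⟩ := exists_boundaryCount_eq hB0 hB1 hpos (by omega : i ≤ _)
    obtain ⟨x, rfl⟩ := hidx.surj j hj
    exact ⟨toQuot A le x, hidx' x⟩
  · intro U V
    obtain ⟨x, rfl⟩ := hsurj U
    obtain ⟨y, rfl⟩ := hsurj V
    rw [hidx', hidx', quotLe_toQuot_iff]
    constructor
    · rintro ⟨x', y', hx, hy, h⟩
      rw [hcls] at hx hy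
      rw [hx, hy]
      exact boundaryCount_mono B ((hidx.le_iff _ _).1 h)
    · intro h
      have e := equivalence_maxAutobisim A le
      rcases le_total (idx x) (idx y) with h' | h'
      · exact ⟨x, y, e.refl x, e.refl y, (hidx.le_iff _ _).2 h'⟩
      -- Here `y` lies below `x` but its class number is not smaller, so both are in one class and
      -- `x` represents either.
      · refine ⟨x, x, e.refl x, ?_, (hidx.le_iff _ _).2 le_rfl⟩
        rw [hcls]
        exact le_antisymm (boundaryCount_mono B h') h
  · rw [h2]
    exact (hidx' A.s).symm
  · intro k hk
    rw [hD.fst k (by simpa using hk)]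
    simp [φ]
  · intro k hk
    rw [hD.snd k (by simpa using hk)]
    simp [φ]
  · intro k hk
    rw [hD.trd k (by simpa using hk)]
    simp [φ]
  · rintro U ⟨x, hx, hxF⟩
    obtain rfl := mem_val_iff.1 hx
    rw [hidx', h3 _ (hidx.lt x), hF1 x hxF]
  · intro U hU
    obtain ⟨x, rfl⟩ := hsurj U
    rw [hidx', h3 _ (hidx.lt x), hF0 x]
    exact fun hxF => hU ⟨x, mem_val_iff.2 rfl, hxF⟩

theorem Holds.bounded [LinearOrder α] (hA : IsWheelerNFA A le) (hσ : Holds A le code idx L σ)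
    (hclean : CleanElsewhere σ) (hL : L.length ≤ W) (hlab : ∀ e ∈ L, code e.2.2 ≤ W) {W' : ℕ}
    (hW : W + 1 ≤ W') : σ.Bounded W' := by
  have hn := hσ.states_le hA
  constructor
  · intro r
    by_cases hr : 3 ≤ r
    · rw [hclean.reg r hr]
      omega
    · have := hσ.numbering.lt A.s
      have h1 := hσ.length
      have h2 := hσ.start
      interval_cases r <;> omega
  · intro a k
    by_cases ha : 4 ≤ a
    · rw [hclean.others a k ha]
      omega
    by_cases ha3 : a = 3
    · subst ha3
      by_cases hk : k < σ.reg 0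
      · obtain ⟨x, rfl⟩ := hσ.numbering.surj k hk
        by_cases hx : x ∈ A.F
        · rw [hσ.final_one x hx]
          omega
        · rw [hσ.final_zero x hx]
          omega
      · rw [hclean.final k (by omega)]
        omega
    · by_cases hk : k < L.length
      · have h0 := hσ.numbering.lt L[k].1
        have h1 := hσ.numbering.lt L[k].2.1
        have h2 := hlab _ (L.getElem_mem hk)
        have e0 := hσ.source k hk
        have e1 := hσ.target k hk
        have e2 := hσ.label k hk
        interval_cases a <;> omega
      · rw [hclean.edges a k (by omega) (by rw [hσ.length]; omega)]
        omega

/-- Computes the quotient of a Wheeler automaton, where `S` is used to sort the labels. -/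
def Prog.minimize (S : Prog) : Prog :=
  .seq (sortEdges S) (.seq markBoundaries buildQuotient)

theorem Prog.runsTo_minimize [LinearOrder α] {S : Prog} {T W' : ℕ} (hA : IsWheelerNFA A le)
    (hcode : Function.Injective code) (hσ : Holds A le code idx L σ) (hclean : CleanElsewhere σ)
    (hS : SortsLabels S W T code (L.map fun e => e.2.2)) (hW : 20 * (W + 1) ≤ W') :
    ∃ (τ : State) (idx' : QuotState A le → ℕ) (L' : List (QuotState A le × QuotState A le × α)),
      (minimize S).RunsTo W' (T + 3000 * (L.length + 1)) σ τ ∧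
      Holds (quotAutomaton A le) (quotLe A le) code idx' L' τ ∧
      (∀ x, τ.mem 4 (idx x) = idx' (toQuot A le x)) ∧
      ∀ x y, idx y = idx x + 1 →
        (¬ maxAutobisim A le x y → τ.mem 5 (idx y) = 1) ∧
        (maxAutobisim A le x y → τ.mem 5 (idx y) = 0) := by
  have := hA.finite
  have hidx := hσ.numbering
  have hn := hσ.states_le hA
  have hs0 := hidx.lt A.s
  -- The machine of `S` must hold its input, so `W` bounds the number of edges and all label codes.
  obtain ⟨hlen, hlab⟩ : L.length ≤ W ∧ ∀ e ∈ L, code e.2.2 ≤ W := by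
    obtain ⟨ρ, hrun, -⟩ := hS
    refine ⟨by simpa [listState] using hrun.1.1 0, fun e he => ?_⟩
    obtain ⟨k, hk, rfl⟩ := List.getElem_of_mem he
    simpa [listState, hk] using hrun.1.2 0 k
  have hB : σ.Bounded W' := hσ.bounded hA hclean hlen hlab (by omega)
  have hF : ∀ x y, σ.mem 3 (idx x) = σ.mem 3 (idx y) ↔ (x ∈ A.F ↔ y ∈ A.F) := by
    intro x y
    by_cases hx : x ∈ A.F <;> by_cases hy : y ∈ A.F <;>
      simp [hx, hy, hσ.final_one, hσ.final_zero]
  -- sorting the edges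
  obtain ⟨t₁, σ₁, ht₁, hex₁, hsort, hB₁, hf₁⟩ :=
    (reaches_sortEdges hA hcode hσ hclean hS hW hB).with_frame hB
  have hmemf : ∀ a, a < 6 ∨ 16 ≤ a ∧ a < 20 → σ₁.mem a = σ.mem a :=
    fun a ha => hf₁.mem a (wMem_sortEdges S ha)
  have hregf : ∀ r, r < 3 ∨ 5 ≤ r ∧ r < 20 → σ₁.reg r = σ.reg r :=
    fun r hr => hf₁.reg r (wReg_sortEdges S hr)
  set U := σ₁.mem 13 with hU
  set V := σ₁.mem 14 with hV
  set Lb := σ₁.mem 15 with hLb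
  have hUn : ∀ k < L.length, U k < σ.reg 0 := fun k hk => by
    obtain ⟨x, y, a, -, h, -, -⟩ := hsort.edge k hk
    exact h ▸ hidx.lt x
  have hVn : ∀ k < L.length, V k < σ.reg 0 := fun k hk => by
    obtain ⟨x, y, a, -, -, h, -⟩ := hsort.edge k hk
    exact h ▸ hidx.lt y
  have hrule : ∀ j, IsRule U V Lb j → Lb j = Lb (j + 1) := by
    intro j hj
    have h := hj.1
    rw [IsGap, not_or, not_not] at h
    exact h.1
  -- the boundaries
  obtain ⟨t₂, σ₂, ht₂, hex₂, ⟨hfin, hbits⟩, hB₂, hf₂⟩ :=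
    (reaches_markBoundaries (n := σ.reg 0) (m := L.length) (W := W') (fb := σ.mem 3) (by omega) hB₁
      (hregf 0 (by decide)) ((hregf 1 (by decide)).trans hσ.length)
      ((hregf 5 (by decide)).trans (hclean.reg 5 (by decide)))
      ((hregf 6 (by decide)).trans (hclean.reg 6 (by decide)))
      (hmemf 3 (by decide)) hU.symm hV.symm hLb.symm
      (fun i => by rw [hmemf 5 (by decide), hclean.others 5 i (by decide)])
      (fun i => by rw [hmemf 16 (by decide), hclean.others 16 i (by decide)])
      (fun i => by rw [hmemf 17 (by decide), hclean.others 17 i (by decide)]) hUn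
      -- The second target of a rule is strictly larger than the first, hence not `0`.
      (fun j hj hR => by
        have h1 := (hsort.mono j (j + 1) (by omega) hj (hrule j hR)).2
        have h2 := hR.2
        omega)
      (fun i j hi hj hRi hRj h => hsort.rule_unique hA hcode hidx hi hj (hrule i hRi) (hrule j hRj)
        hRi.2 hRj.2 h)).with_frame hB₁
  set B := σ₂.mem 5 with hBdef
  have hB1 : ∀ i, B i ≤ 1 := fun i => by
    rcases hbits i with h | h <;> omega
  have hB0 : B 0 = 0 := by
    rcases hbits 0 with h | h
    · exact absurd rfl h.2.1
    · exact h.1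
  have hBM : ∀ i, i ≠ 0 → (B i = 0 ↔ ¬ Marked (σ.reg 0) L.length (σ.mem 3) U V Lb i) := by
    intro i hi
    rcases hbits i with ⟨h1, -, h2⟩ | ⟨h1, h2⟩
    · simp [h1, h2]
    · exact ⟨fun _ h => h2 ⟨hi, h⟩, fun _ => h1⟩
  have hcls : ∀ x y, maxAutobisim A le x y ↔
      boundaryCount B (idx x) = boundaryCount B (idx y) := by
    intro x y
    rw [hsort.maxAutobisim_iff hA hcode hidx hF, boundaryCount_eq_iff hBM]
  -- the quotient
  have hmono := boundaryCount_mono B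
  obtain ⟨t₃, σ₃, ht₃, hex₃, h4, h5, h3, h0, h2, D, hD, h1, hnd, hDmem⟩ :=
    reaches_buildQuotient (n := σ.reg 0) (m := L.length) (W := W') (fb := σ.mem 3)
      (c := boundaryCount B)
      (e := fun k => (boundaryCount B (U k), boundaryCount B (V k), Lb k)) (by omega) hB₂
      ((hf₂.reg 0 rfl).trans (hregf 0 (by decide)))
      ((hf₂.reg 1 rfl).trans ((hregf 1 (by decide)).trans hσ.length))
      ((hf₂.reg 9 rfl).trans ((hregf 9 (by decide)).trans (hclean.reg 9 (by decide))))
      ((hf₂.reg 10 rfl).trans ((hregf 10 (by decide)).trans (hclean.reg 10 (by decide))))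
      hBdef.symm hB1 (hf₂.mem 13 rfl) (hf₂.mem 14 rfl) (hf₂.mem 15 rfl) (fun _ => rfl) hUn hVn
      (by rw [hf₂.reg 2 rfl, hregf 2 (by decide), hσ.start]; exact hs0) hfin
      (by
        intro i hi j hj h
        obtain ⟨x, rfl⟩ := hidx.surj i hi
        obtain ⟨y, rfl⟩ := hidx.surj j hj
        exact (hF x y).2 ((isWheelerAutobisimulation_maxAutobisim A le).wheeler.bisimulation.final
          x y ((hcls x y).2 h)))
      (fun _ _ => rfl)
      (by
        -- Sources and targets increase within a label and class numbers are monotone, so the edge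
        -- before `q` is squeezed between two edges with equal images.
        intro p q hpq hq h
        simp only [Prod.mk.injEq] at h ⊢
        have hL := hsort.contiguous p (q - 1) q (by omega) (by omega) hq h.2.2
        have m1 := hsort.mono p (q - 1) (by omega) (by omega) (by omega)
        have m2 := hsort.mono (q - 1) q (by omega) hq hL
        have a1 := hmono m1.1
        have a2 := hmono m2.1
        have b1 := hmono m1.2
        have b2 := hmono m2.2
        exact ⟨by omega, by omega, hL⟩)
  have h2' : σ₃.reg 2 = boundaryCount B (idx A.s) := by
    rw [h2, hf₂.reg 2 rfl, hregf 2 (by decide), hσ.start]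
  obtain ⟨idx', L', hH, hidx'⟩ := holds_quot hidx hcode hB0 hB1 hcls hσ.final_one hσ.final_zero
    h3 h0 h2' hD h1 hnd (by
      intro t
      rw [hDmem]
      constructor
      · rintro ⟨j, hj, rfl⟩
        obtain ⟨x, y, a, he, hx, hy, ha⟩ := hsort.edge j hj
        exact ⟨x, y, a, he, by simp only [hx, hy, ha]⟩
      · rintro ⟨x, y, a, he, rfl⟩
        obtain ⟨j, hj, hx, hy, ha⟩ := hsort.exists_index x y a he
        exact ⟨j, hj, by simp only [hx, hy, ha]⟩)
  refine ⟨σ₃, idx', L', ⟨hB, _, ?_, .seq hex₁ (.seq hex₂ hex₃)⟩, hH, fun x => ?_, fun x y hxy => ?_⟩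
  -- The three phases cost 700, 1400 and 600 times `L.length + 1` besides `T`, because the number of
  -- states plus the number of edges plus one is at most twice `L.length + 1`.
  · omega
  · rw [h4 _ (hidx.lt x), hidx']
  · have hbit : maxAutobisim A le x y ↔ B (idx y) = 0 := by
      rw [hcls, hxy, boundaryCount_succ]
      omega
    rw [h5, hbit]
    have := hB1 (idx y)
    exact ⟨fun h => by omega, id⟩

end Assembly

end WheelerMin

open WheelerMin in
theorem mainTheorem7 :
    -- the maximum Wheeler autobisimulation exists, and the quotient is a Wheeler NFA
    (∀ (Q : Type u) (α : Type v) [Finite α] [LinearOrder α] (A : Automaton Q α)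
        (le : Q → Q → Prop), IsWheelerNFA A le →
        IsGreatest {R | IsWheelerAutobisimulation A le R} (maxAutobisim A le) ∧
        Equivalence (maxAutobisim A le) ∧
        (∀ x, IsConvex le (cls A le x)) ∧
        IsWheelerNFA (quotAutomaton A le) (quotLe A le)) ∧
    -- if the labels can be sorted in linear time, the quotient can be built in linear time
    ∀ S : Prog, ∃ P : Prog, ∀ c : ℕ, ∃ C : ℕ,
      ∀ (Q : Type u) (α : Type v) [Finite α] [LinearOrder α] (A : Automaton Q α)
        (le : Q → Q → Prop) (code : α → ℕ) (idx : Q → ℕ) (L : List (Q × Q × α)) (σ : State)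
        (W : ℕ),
        IsWheelerNFA A le → Function.Injective code →
        Holds A le code idx L σ → CleanElsewhere σ →
        SortsLabels S W (c * (L.length + 1)) code (L.map fun e => e.2.2) →
        ∃ (τ : State) (idx' : QuotState A le → ℕ)
          (L' : List (QuotState A le × QuotState A le × α)),
          P.RunsTo (C * (W + 1)) (C * (L.length + 1)) σ τ ∧
          Holds (quotAutomaton A le) (quotLe A le) code idx' L' τ ∧
          (∀ x, τ.mem 4 (idx x) = idx' (toQuot A le x)) ∧
          (∀ x y, idx y = idx x + 1 →
            (¬ maxAutobisim A le x y → τ.mem 5 (idx y) = 1) ∧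
            (maxAutobisim A le x y → τ.mem 5 (idx y) = 0)) := by
  -- The program depends on `S` only. The running time of `S` contributes `c` to the constant, and
  -- 3000 also covers the factor 20 in the word bound.
  refine ⟨?_, fun S => ⟨Prog.minimize S, fun c => ⟨c + 3000, ?_⟩⟩⟩
  · intro Q α _ _ A le hA
    have := hA.finite
    exact ⟨isGreatest_maxAutobisim A le, equivalence_maxAutobisim A le, isConvex_cls hA.order,
      hA.quot⟩
  · intro Q α _ _ A le code idx L σ W hA hcode hσ hclean hS
    have h := Prog.runsTo_minimize hA hcode hσ hclean hS (W' := (c + 3000) * (W + 1))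
      (Nat.mul_le_mul_right _ (by omega))
    rwa [← Nat.add_mul] at h
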